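/- **Setting.** Let $\varepsilon>0$ and $k\ge 1$. Let $B_\varepsilon\subset\mathbb R^2$ be the closed disc of radius $\varepsilon$ about $0$, $D_\varepsilon=\mathbb R^2\setminus B_\varepsilon$, $\mathbb R_+=(0,\infty)$, $\mathbb Z_+=\{1,2,\dots\}$, and let $E=D_\varepsilon\cup\{a^*\}\cup\mathbb R_+$ be the space obtained by collapsing $B_\varepsilon$ to the point $a^*$ and identifying $a^*$ with the origin of the half-line, with its geodesic distance $\rho$. Let $D^k_\varepsilon=D_\varepsilon\cap 2^{-k}\mathbb Z^2$, let $a_k^*=a^*$ be the point to which the lattice points of $B_\varepsilon$ are collapsed, and $E^k=2^{-k}\mathbb Z_+\cup\{a_k^*\}\cup D_\varepsilon^k$. For $E_0\subseteq E$ put $E_0^k=E_0\cap E^k$ and let $G_0^k$ be the simple graph on $E_0^k$ whose edges are: (a) the pairs $x,y\in D_\varepsilon^k$ with $|x-y|=2^{-k}$ for which the segment $xy$ avoids $B_\varepsilon$; (b) the pairs $x,y\in 2^{-k}\mathbb Z_+\cup\{0\}$ with $|x-y|=2^{-k}$, where $0=a_k^*$; (c) the pairs $x,a_k^*$ with $x\in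 D_\varepsilon^k$ for which there is $y\in 2^{-k}\mathbb Z^2\cap B_\varepsilon$ with $|x-y|=2^{-k}$; in each case the edge (the image in $E$ of the segment, in case (c) of a segment $xy$) is required to be contained in $E_0$. Write $v(x)$ for the number of neighbours of $x$ in $G_0^k$, and let $\mathfrak m$ be the measure on $E_0^k$ with $$\mathfrak m(x)=\tfrac{2^{-2k}}4v(x)\ (x\in D_\varepsilon^k),\quad \mathfrak m(x)=\tfrac{2^{-k}}2v(x)\ (x\in 2^{-k}\mathbb Z_+),\quad \mathfrak m(a_k^*)=\tfrac{2^{-k}}2+\tfrac{2^{-2k}}4\,(v(a_k^*)-1).$$ On $L^2(E_0^k,\mathfrak m)$ consider, with domain all of $L^2(E_0^k,\mathfrak m)$, the form obtained by polarization from $$\mathcal E(f,f)=\tfrac18\sum_{(x,y)}(f(x)-f(y))^2+\tfrac{2^k}4\sum_{(x,y)}(f(x)-f(y))^2,$$ the first sum over the oriented edges of $G_0^k$ with $x,y\in D_\varepsilon^k\cup\{a_k^*\}$, the second over those with $x,y\in 2^{-k}\mathbb Z_+\cup\{a_k^*\}$. For $E_0=E$ write $G^k,v_k,m_k,\mathcal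 E^k$ for $G_0^k,v,\mathfrak m,\mathcal E$; in general write $G_0^k,\bar v_k,\overline m_k,\widetilde{\mathcal E}^k$. A right-continuous Markov process (possibly with a cemetery) is *associated* with the form if its transition operators are versions of the $L^2$-semigroup of the form. A process is a *pure jump process with speed function $\lambda$ and road map $Q$* if in each state $x$ it stays for an exponential time of parameter $\lambda(x)$ and then jumps, independently of that time, to a point with law $Q(x,\cdot)$, holding times and jumps depending on the past only through the current state; here $Q$ is a probability kernel with $Q(x,\{x\})=0$. **Proposition.** 1. $\mathcal E^k(f,f)<\infty$ for $f\in L^2(E^k,m_k)$, and $\mathcal E^k$ is a regular symmetric Dirichlet form on $L^2(E^k,m_k)$. There is a process $X^k$ associated with it, and every such process is a pure jump process with constant speed function $2^{2k}$ and road map $J_k(x,\cdot)=\sum_{z\leftrightarrow x\text{ in }G^k}j_k(x,z)\,\delta_z$, where $j_k(x,y)=1/v_k(x)$ for $x\ne a_k^*$ and $$j_k(a_k^*,y)=\begin{cases}\dfrac{1}{v_k(a_k^*)+2^{k+1}-1},&y\in D_\varepsilon^k,\\[2mm] \dfrac{2^{k+1}}{v_k(a_k^*)+2^{k+1}-1},&y\in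 2^{-k}\mathbb Z_+.\end{cases}$$ 2. Let $E_0\subset E$ be a bounded domain (open and connected) with $a^*\in E_0$ and $\rho(a^*,\partial E_0)>16\varepsilon$, and suppose that $2^{-k}<\varepsilon/4$ and that $G_0^k$ is connected. Then the same statements hold for the reflected walk $\widetilde X^k$: $\widetilde{\mathcal E}^k(f,f)<\infty$ for $f\in L^2(E_0^k,\overline m_k)$, $\widetilde{\mathcal E}^k$ is a regular symmetric Dirichlet form on $L^2(E_0^k,\overline m_k)$, there is a process $\widetilde X^k$ associated with it, and every such process is a pure jump process with constant speed function $2^{2k}$ and the road map obtained from $J_k$ by replacing $G^k$ and $v_k$ with $G_0^k$ and $\bar v_k$. -/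

import Mathlib

open MeasureTheory ProbabilityTheory Filter Topology Set
open scoped NNReal ENNReal

/-! Part 1: symmetric Dirichlet forms and their semigroups. -/

section DirichletForms

variable {S : Type*} [MeasurableSpace S]

/-- `(𝓔, D)` is a symmetric Dirichlet form on `L²(S; m)`: a densely defined nonnegative symmetric
bilinear form that is closed (`D` is complete for `𝓔₁(f,f) = 𝓔(f,f) + ‖f‖²`) and Markovian
(the unit contraction operates). The values of `𝓔` outside `D` are irrelevant. -/
structure IsDirichletForm (m : Measure S) (D : Submodule ℝ (Lp ℝ 2 m))
    (𝓔 : Lp ℝ 2 m → Lp ℝ 2 m → ℝ) : Prop where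
  dense : Dense (D : Set (Lp ℝ 2 m))
  add_left : ∀ f ∈ D, ∀ g ∈ D, ∀ h ∈ D, 𝓔 (f + g) h = 𝓔 f h + 𝓔 g h
  smul_left : ∀ c : ℝ, ∀ f ∈ D, ∀ g ∈ D, 𝓔 (c • f) g = c * 𝓔 f g
  symm : ∀ f ∈ D, ∀ g ∈ D, 𝓔 f g = 𝓔 g f
  nonneg : ∀ f ∈ D, 0 ≤ 𝓔 f f
  closed : ∀ u : ℕ → Lp ℝ 2 m, (∀ n, u n ∈ D) →
    (∀ δ > (0 : ℝ), ∃ N, ∀ i ≥ N, ∀ j ≥ N, 𝓔 (u i - u j) (u i - u j) + ‖u i - u j‖ ^ 2 < δ) →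
    ∃ f ∈ D, Tendsto (fun n => 𝓔 (u n - f) (u n - f) + ‖u n - f‖ ^ 2) atTop (𝓝 0)
  markov : ∀ f ∈ D, ∃ g ∈ D, (∀ᵐ x ∂m, g x = min (max (f x) 0) 1) ∧ 𝓔 g g ≤ 𝓔 f f

/-- A regular symmetric Dirichlet form: `m` is a Radon measure with full support, and
`D ∩ C_c(S)` is dense in `D` for the `𝓔₁`-norm and in `C_c(S)` for the uniform norm. -/
structure IsRegularDirichletForm [TopologicalSpace S] (m : Measure S)
    (D : Submodule ℝ (Lp ℝ 2 m)) (𝓔 : Lp ℝ 2 m → Lp ℝ 2 m → ℝ) : Prop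
    extends IsDirichletForm m D 𝓔 where
  finite_on_compacts : ∀ K : Set S, IsCompact K → m K < ∞
  full_support : ∀ U : Set S, IsOpen U → U.Nonempty → 0 < m U
  core_dense : ∀ f ∈ D, ∀ δ > (0 : ℝ), ∃ φ : S → ℝ, Continuous φ ∧ HasCompactSupport φ ∧
    ∃ g ∈ D, (∀ᵐ x ∂m, g x = φ x) ∧ 𝓔 (f - g) (f - g) + ‖f - g‖ ^ 2 < δ
  core_uniformly_dense : ∀ ψ : S → ℝ, Continuous ψ → HasCompactSupport ψ → ∀ δ > (0 : ℝ),
    ∃ φ : S → ℝ, Continuous φ ∧ HasCompactSupport φ ∧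
      (∃ g ∈ D, ∀ᵐ x ∂m, g x = φ x) ∧ ∀ x, |ψ x - φ x| < δ

/-- `T` is the strongly continuous symmetric contraction semigroup on `L²(S; m)` of the
form `(𝓔, D)`: `D` consists of the `f` for which `(f - T_t f, f) / t` has a finite limit as
`t ↓ 0`, and `𝓔(f, g) = lim (f - T_t f, g) / t` for `f, g ∈ D`. -/
structure IsSemigroupOfForm (m : Measure S) (D : Submodule ℝ (Lp ℝ 2 m))
    (𝓔 : Lp ℝ 2 m → Lp ℝ 2 m → ℝ) (T : ℝ≥0 → (Lp ℝ 2 m →L[ℝ] Lp ℝ 2 m)) : Prop where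
  zero : ∀ f, T 0 f = f
  add : ∀ s t f, T (s + t) f = T s (T t f)
  contraction : ∀ t f, ‖T t f‖ ≤ ‖f‖
  symm : ∀ t f g, inner ℝ (T t f) g = inner ℝ f (T t g)
  strongly_continuous : ∀ f, Tendsto (fun t => T t f) (𝓝[>] 0) (𝓝 f)
  mem_domain_iff : ∀ f, f ∈ D ↔
    ∃ l : ℝ, Tendsto (fun t : ℝ≥0 => (t : ℝ)⁻¹ * inner ℝ (f - T t f) f) (𝓝[>] 0) (𝓝 l)
  form_eq : ∀ f ∈ D, ∀ g ∈ D,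
    Tendsto (fun t : ℝ≥0 => (t : ℝ)⁻¹ * inner ℝ (f - T t f) g) (𝓝[>] 0) (𝓝 (𝓔 f g))

end DirichletForms

/-! Part 2: Markov processes, with a cemetery `∞`, and pure jump processes. -/

section Processes

/-- The Borel σ-algebra on the state space with the cemetery `∞` adjoined. -/
instance onePointBorel (S : Type*) [TopologicalSpace S] : MeasurableSpace (OnePoint S) :=
  borel (OnePoint S)

/-- A (time-homogeneous) Markov process on `S` with right-continuous paths in `S ∪ {∞}`, where
`∞` is an absorbing cemetery: the family `P x` of laws depends measurably on the starting point,
and the simple Markov property holds for the natural filtration. -/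
structure MarkovProcess (S : Type*) [TopologicalSpace S] (Ω : Type*) [MeasurableSpace Ω] where
  X : ℝ≥0 → Ω → OnePoint S
  P : Kernel (OnePoint S) Ω
  isMarkovKernel : IsMarkovKernel P
  measurable_X : ∀ t, Measurable (X t)
  start : ∀ x, ∀ᵐ ω ∂(P x), X 0 ω = x
  absorbing : ∀ ω s t, s ≤ t → X s ω = OnePoint.infty → X t ω = OnePoint.infty
  right_continuous : ∀ ω t, ContinuousWithinAt (fun s => X s ω) (Ici t) t
  markov : ∀ (x : OnePoint S) (s t : ℝ≥0) (A : Set Ω),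
    MeasurableSet[⨆ u : Iic s, MeasurableSpace.comap (X u) inferInstance] A →
    ∀ B : Set (OnePoint S), MeasurableSet B →
      P x (A ∩ X (s + t) ⁻¹' B) = ∫⁻ ω in A, P (X s ω) (X t ⁻¹' B) ∂(P x)

variable {S : Type*} [TopologicalSpace S] [MeasurableSpace S] {Ω : Type*} [MeasurableSpace Ω]

/-- The transition function `P_t f (x) = 𝔼_x[f(X_t)]`, where `f(∞) = 0`. -/
noncomputable def MarkovProcess.transition (M : MarkovProcess S Ω) (t : ℝ≥0) (f : S → ℝ)
    (x : S) : ℝ :=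
  ∫ ω, (M.X t ω).elim 0 f ∂(M.P (x : OnePoint S))

/-- The process is associated with the form `(𝓔, D)` on `L²(S; m)`: `P_t f` is a version
of `T_t f` for every bounded measurable `f ∈ L²(S; m)`, `T` being the semigroup of the form. -/
def MarkovProcess.IsAssociatedWith (M : MarkovProcess S Ω) (m : Measure S)
    (D : Submodule ℝ (Lp ℝ 2 m)) (𝓔 : Lp ℝ 2 m → Lp ℝ 2 m → ℝ) : Prop :=
  ∃ T : ℝ≥0 → (Lp ℝ 2 m →L[ℝ] Lp ℝ 2 m), IsSemigroupOfForm m D 𝓔 T ∧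
    ∀ (t : ℝ≥0) (f : S → ℝ) (hf : MemLp f 2 m), Measurable f → (∃ C, ∀ x, |f x| ≤ C) →
      ∀ᵐ x ∂m, T t (hf.toLp f) x = M.transition t f x

/-- The history of the first `n` jumps: `Y_0, …, Y_n` and the holding times `τ_0, …, τ_{n-1}`. -/
abbrev jumpHistory (Y : ℕ → Ω → S) (τ : ℕ → Ω → ℝ≥0) (n : ℕ) : MeasurableSpace Ω :=
  (⨆ i : Iic n, MeasurableSpace.comap (Y i) inferInstance) ⊔
    ⨆ i : Iio n, MeasurableSpace.comap (τ i) inferInstance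

/-- The process is a pure jump process with speed function `speed` and road map `Q`.
Started from `x`, it visits the states `Y_0 = x, Y_1, Y_2, …` and stays in `Y_n` during a holding
time `τ_n`; given the past, `τ_n` is exponential with parameter `speed (Y_n)` and independent of
`Y_{n+1}`, which has law `Q(Y_n, ·)`. If the jump times accumulate, the process is then sent
to the cemetery. -/
structure MarkovProcess.IsPureJump (M : MarkovProcess S Ω) (speed : S → ℝ)
    (Q : S → Measure S) : Prop where
  speed_pos : ∀ x, 0 < speed x
  measurable_speed : Measurable speed
  measurable_roadMap : Measurable Q
  probability_roadMap : ∀ x, IsProbabilityMeasure (Q x)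
  roadMap_self : ∀ x, Q x {x} = 0
  jumps : ∃ (Y : ℕ → Ω → S) (τ : ℕ → Ω → ℝ≥0),
    (∀ n, Measurable (Y n)) ∧ (∀ n, Measurable (τ n)) ∧
    ∀ x : S,
      (∀ᵐ ω ∂(M.P (x : OnePoint S)), Y 0 ω = x ∧ ∀ t : ℝ≥0,
        (∀ n, ∑ i ∈ Finset.range n, τ i ω ≤ t → t < ∑ i ∈ Finset.range (n + 1), τ i ω →
          M.X t ω = (Y n ω : OnePoint S)) ∧
        ((∀ n, ∑ i ∈ Finset.range n, τ i ω ≤ t) → M.X t ω = OnePoint.infty)) ∧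
      ∀ (n : ℕ) (A : Set Ω), MeasurableSet[jumpHistory Y τ n] A →
        ∀ (t : ℝ≥0) (B : Set S), MeasurableSet B →
          M.P (x : OnePoint S) (A ∩ {ω | t < τ n ω ∧ Y (n + 1) ω ∈ B}) =
            ∫⁻ ω in A, ENNReal.ofReal (Real.exp (-(speed (Y n ω) * t))) * Q (Y n ω) B
              ∂(M.P (x : OnePoint S))

end Processes

/-! Part 3: the plane with a half-line attached to a shorted disc. -/

/-- The Euclidean plane. -/
abbrev Plane := EuclideanSpace ℝ (Fin 2)

/-- The space `E = D_ε ∪ {a*} ∪ ℝ₊`: `plane z` is a point of `D_ε = {|z| > ε}`, `star` is the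
point `a*` to which the closed disc of radius `ε` is collapsed (it is also the origin of the
half-line), and `pole s`, `s > 0`, is a point of `ℝ₊`. -/
inductive VDSpace (ε : ℝ) : Type
  | plane (z : Plane) (hz : ε < ‖z‖) : VDSpace ε
  | star : VDSpace ε
  | pole (s : ℝ) (hs : 0 < s) : VDSpace ε

namespace VDSpace

variable {ε : ℝ}

/-- The geodesic distance `|x|_ρ` to `a*`. -/
noncomputable def radius : VDSpace ε → ℝ
  | plane z _ => ‖z‖ - ε
  | star => 0
  | pole s _ => s

/-- The geodesic distance `ρ`. -/
noncomputable def rho : VDSpace ε → VDSpace ε → ℝ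
  | plane z _, plane w _ => min ‖z - w‖ ((‖z‖ - ε) + (‖w‖ - ε))
  | pole s _, pole t _ => |s - t|
  | x, y => radius x + radius y

noncomputable instance : MetricSpace (VDSpace ε) where
  dist := rho
  dist_self x := by
    cases x with
    | plane z hz => simp only [rho, sub_self, norm_zero]; exact min_eq_left (by linarith)
    | star => simp [rho, radius]
    | pole s hs => simp [rho]
  dist_comm x y := by
    rcases x with ⟨z, hz⟩ | _ | ⟨s, hs⟩ <;> rcases y with ⟨w, hw⟩ | _ | ⟨t, ht⟩ <;>
      simp only [rho, radius, norm_sub_rev, abs_sub_comm, add_comm]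
  dist_triangle x y z := by
    rcases x with ⟨a, ha⟩ | _ | ⟨a, ha⟩ <;> rcases y with ⟨b, hb⟩ | _ | ⟨b, hb⟩ <;>
      rcases z with ⟨c, hc⟩ | _ | ⟨c, hc⟩ <;> simp only [rho, radius]
    case plane.plane.plane =>
      have h1 := norm_sub_le_norm_sub_add_norm_sub a b c
      have h2 := norm_sub_norm_le a b
      have h3 := norm_sub_norm_le c b
      rw [norm_sub_rev c b] at h3
      rcases min_cases ‖a - b‖ (‖a‖ - ε + (‖b‖ - ε)) with h | h <;>
      rcases min_cases ‖b - c‖ (‖b‖ - ε + (‖c‖ - ε)) with h' | h' <;>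
      first
        | exact (min_le_left _ _).trans (by linarith)
        | exact (min_le_right _ _).trans (by linarith)
    all_goals first
      | linarith
      | grind
      | (have h2 := norm_sub_norm_le a b
         rcases min_cases ‖a - b‖ (‖a‖ - ε + (‖b‖ - ε)) with h | h <;> linarith)
      | (have h3 := norm_sub_norm_le c b
         rw [norm_sub_rev c b] at h3
         rcases min_cases ‖b - c‖ (‖b‖ - ε + (‖c‖ - ε)) with h | h <;> linarith)
  eq_of_dist_eq_zero {x y} h := by
    change rho x y = 0 at h
    rcases x with ⟨z, hz⟩ | _ | ⟨s, hs⟩ <;> rcases y with ⟨w, hw⟩ | _ | ⟨t, ht⟩ <;>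
      simp only [rho, radius] at h
    · have h0 : ‖z - w‖ = 0 := by
        rcases min_cases ‖z - w‖ (‖z‖ - ε + (‖w‖ - ε)) with h' | h' <;> linarith
      have h1 : z = w := sub_eq_zero.1 (norm_eq_zero.1 h0)
      subst h1; rfl
    · linarith
    · linarith
    · linarith
    · rfl
    · linarith
    · linarith
    · linarith
    · have h1 : s = t := sub_eq_zero.1 (abs_eq_zero.1 h)
      subst h1; rfl

noncomputable instance : MeasurableSpace (VDSpace ε) := borel (VDSpace ε)

open Classical in
/-- The map of the plane to `E` that collapses the closed disc `B_ε` to `a*`. -/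
noncomputable def ofPlane (ε : ℝ) (z : Plane) : VDSpace ε :=
  if h : ε < ‖z‖ then plane z h else star

open Classical in
/-- The map of the closed half-line to `E` that sends its origin to `a*`. -/
noncomputable def ofPole (ε : ℝ) (s : ℝ) : VDSpace ε :=
  if h : 0 < s then pole s h else star

/-- The mesh `2^{-k}` of the lattices. -/
noncomputable def mesh (k : ℕ) : ℝ := ((2 : ℝ) ^ k)⁻¹

/-- The square lattice `2^{-k}ℤ²`. -/
def squareLattice (k : ℕ) : Set Plane := {z | ∀ i, ∃ n : ℤ, z i = n * mesh k}

/-- `E^k = 2^{-k}ℤ₊ ∪ {a*_k} ∪ D_ε^k` as a subset of `E`, where `a*_k` is the point `a*`. -/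
def IsVertex (k : ℕ) : VDSpace ε → Prop
  | plane z _ => z ∈ squareLattice k
  | star => True
  | pole s _ => ∃ n : ℕ, s = n * mesh k

/-- Two vertices are joined by an edge that is contained in `E₀`. Between planar vertices
it is a lattice segment that avoids the disc. A planar vertex is joined to `a*_k` if a lattice
segment leads from it to a lattice point in the disc, the edge being the image in `E` of that
segment. On the half-line consecutive points of `2^{-k}ℤ₊ ∪ {0}` are joined. -/
def Joined (k : ℕ) (E₀ : Set (VDSpace ε)) : VDSpace ε → VDSpace ε → Prop
  | plane z _, plane w _ => ‖z - w‖ = mesh k ∧ Disjoint (segment ℝ z w) (Metric.closedBall 0 ε) ∧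
      ofPlane ε '' segment ℝ z w ⊆ E₀
  | plane z _, star => ∃ w ∈ squareLattice k, ‖w‖ ≤ ε ∧ ‖z - w‖ = mesh k ∧
      ofPlane ε '' segment ℝ z w ⊆ E₀
  | star, plane z _ => ∃ w ∈ squareLattice k, ‖w‖ ≤ ε ∧ ‖z - w‖ = mesh k ∧
      ofPlane ε '' segment ℝ z w ⊆ E₀
  | pole s _, pole t _ => |s - t| = mesh k ∧ ofPole ε '' segment ℝ s t ⊆ E₀
  | pole s _, star => s = mesh k ∧ ofPole ε '' segment ℝ 0 s ⊆ E₀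
  | star, pole s _ => s = mesh k ∧ ofPole ε '' segment ℝ 0 s ⊆ E₀
  | _, _ => False

/-- The vertex set `E₀^k = E₀ ∩ E^k`; for `E₀ = univ` this is `E^k`. -/
abbrev Vertex (ε : ℝ) (k : ℕ) (E₀ : Set (VDSpace ε)) : Type :=
  {x : VDSpace ε // x ∈ E₀ ∧ IsVertex k x}

/-- The graph `G₀^k` on `E₀^k`; for `E₀ = univ` this is the graph `G^k` on `E^k`. -/
def latticeGraph (ε : ℝ) (k : ℕ) (E₀ : Set (VDSpace ε)) : SimpleGraph (Vertex ε k E₀) where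
  Adj x y := Joined k E₀ x.1 y.1
  symm := ⟨by
    rintro ⟨x, hx⟩ ⟨y, hy⟩ h
    rcases x with ⟨z, hz⟩ | _ | ⟨s, hs⟩ <;> rcases y with ⟨w, hw⟩ | _ | ⟨t, ht⟩ <;>
      simp only [Joined] at h ⊢ <;> try exact h
    · rwa [norm_sub_rev, segment_symm]
    · rwa [abs_sub_comm, segment_symm]⟩
  loopless := ⟨by
    have hm : mesh k ≠ 0 := by unfold mesh; positivity
    rintro ⟨x, hx⟩ h
    rcases x with ⟨z, hz⟩ | _ | ⟨s, hs⟩ <;> simp only [Joined, sub_self, norm_zero, abs_zero] at h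
    · exact hm h.1.symm
    · exact hm h.1.symm⟩

/-- `x ∈ D_ε ∪ {a*}`. -/
def InPlane : VDSpace ε → Prop
  | plane _ _ => True
  | star => True
  | pole _ _ => False

/-- `x ∈ ℝ₊ ∪ {a*}`. -/
def InPole : VDSpace ε → Prop
  | plane _ _ => False
  | star => True
  | pole _ _ => True

variable {k : ℕ} {E₀ : Set (VDSpace ε)}

/-- The number of vertices adjacent to `x`. -/
noncomputable def valency (x : Vertex ε k E₀) : ℕ := ((latticeGraph ε k E₀).neighborSet x).ncard

/-- The mass that the reference measure gives to a vertex. -/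
noncomputable def vertexMass (x : Vertex ε k E₀) : ℝ :=
  match x.1 with
  | plane _ _ => mesh k ^ 2 / 4 * valency x
  | pole _ _ => mesh k / 2 * valency x
  | star => mesh k / 2 + mesh k ^ 2 / 4 * ((valency x : ℝ) - 1)

/-- The reference measure on `E₀^k` (`m_k` for `E₀ = univ`, otherwise `m̄_k`). -/
noncomputable def refMeasure (ε : ℝ) (k : ℕ) (E₀ : Set (VDSpace ε)) : Measure (Vertex ε k E₀) :=
  Measure.sum fun x => ENNReal.ofReal (vertexMass x) • Measure.dirac x

/-- The oriented edges with both endpoints in `D_ε^k ∪ {a*_k}`. -/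
abbrev PlaneEdge (ε : ℝ) (k : ℕ) (E₀ : Set (VDSpace ε)) : Type :=
  {p : Vertex ε k E₀ × Vertex ε k E₀ //
    (latticeGraph ε k E₀).Adj p.1 p.2 ∧ InPlane p.1.1 ∧ InPlane p.2.1}

/-- The oriented edges with both endpoints in `2^{-k}ℤ₊ ∪ {a*_k}`. -/
abbrev PoleEdge (ε : ℝ) (k : ℕ) (E₀ : Set (VDSpace ε)) : Type :=
  {p : Vertex ε k E₀ × Vertex ε k E₀ //
    (latticeGraph ε k E₀).Adj p.1 p.2 ∧ InPole p.1.1 ∧ InPole p.2.1}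

/-- The discrete form on `E₀^k`, as a bilinear form. -/
noncomputable def form (ε : ℝ) (k : ℕ) (E₀ : Set (VDSpace ε))
    (f g : Lp ℝ 2 (refMeasure ε k E₀)) : ℝ :=
  1 / 8 * ∑' p : PlaneEdge ε k E₀, (f p.1.1 - f p.1.2) * (g p.1.1 - g p.1.2) +
    2 ^ k / 4 * ∑' p : PoleEdge ε k E₀, (f p.1.1 - f p.1.2) * (g p.1.1 - g p.1.2)

/-- The probability `j_k(x, y)` of a jump from `x` to an adjacent vertex `y`. -/
noncomputable def jumpProb (x y : Vertex ε k E₀) : ℝ :=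
  match x.1, y.1 with
  | star, pole _ _ => 2 ^ (k + 1) / ((valency x : ℝ) + 2 ^ (k + 1) - 1)
  | star, _ => 1 / ((valency x : ℝ) + 2 ^ (k + 1) - 1)
  | _, _ => 1 / (valency x : ℝ)

/-- The road map `J_k(x, ·) = ∑_{z ↔ x} j_k(x, z) δ_z`. -/
noncomputable def roadMap (ε : ℝ) (k : ℕ) (E₀ : Set (VDSpace ε)) (x : Vertex ε k E₀) :
    Measure (Vertex ε k E₀) :=
  Measure.sum fun z : {z // (latticeGraph ε k E₀).Adj x z} =>
    ENNReal.ofReal (jumpProb x z.1) • Measure.dirac z.1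

end VDSpace

open VDSpace

/-!
The proof separates the probability from the geometry. The lattice walk is an instance of a
`Network`: a countable set of states with positive weights `m` and symmetric conductances `c`, where
the total conductance at each state `x` is `speed * m x` with the same constant `speed`. In the
lattice the conductance is `1/4` on planar edges and `2^k/2` on the half-line, and `speed = 4^k`;
this is `hasSum_conductance`, where `a*` is the only vertex at which both kinds of edges meet. The
form is the energy form of the network (`form_eq_energy`), and the road map is
`c(x, z) / (speed * m x)` (`network_jump`). What has to be known about the vertex set is contained
in `NonDegenerate`: no vertex is isolated, and the first edge of the half-line belongs to the graph.
The latter holds for a domain since this edge is too short to reach the frontier.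

*The form.* As the total conductances are bounded by the weights, the energy form is bounded on
`L²`, hence closed with domain all of `L²` and regular, the topology being discrete
(`Network.isRegularDirichletForm`). Its semigroup is `exp(-tL)` with the bounded operator `L` that
represents the form. Since `L = speed * (1 - K)`, where `K` averages with respect to the road map,
the semigroup is the mixture of the powers `K^n` with Poisson weights.

*Existence.* The walk is built from independent exponential holding times and independent jump maps.
The number of jumps up to time `t` has the Poisson law, independently of the states that are
visited, so the transition operators are the above mixture (`lintegral_count`,
`Network.walk_isAssociatedWith`). The Markov property is proved by induction on the number of jumps,
with the lack of memory of the exponential law for the first holding time.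

*Every associated process is a pure jump process.* Only the small-time asymptotics of the transition
function is used: testing the form with indicators of states shows that the process moves from `a`
to `b` at rate `c(a, b) / m a` and leaves `a` at rate `speed` (`MarkovProcess.tendsto_rate`).
Observed at the times `0, h, 2h, …` the process is a Markov chain, for which the number of
observations before it is seen to leave a state is geometric
(`MarkovProcess.measure_exists_gridVisits`). A right-continuous path with
values in a discrete space with an absorbing cemetery eventually shows its true jumps as `h ↓ 0`
(`StepPath.eventually_gridVisits`), and the geometric laws converge to exponential ones. This yields
the law of the successive states and holding times (`MarkovProcess.measure_visits_succ`). In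
particular almost surely every state is left and jumps never lead to the cemetery; as
the holding times are infinitely often larger than `1`, the jump times do not accumulate
(`JumpLaw.ae_exists_lt_sum`).
-/

/-! ### Networks and their energy forms -/

/-- A reversible jump structure on `S`: `mass x` is the weight of the state `x` and `cond x y` the
conductance between `x` and `y`. The total conductance at `x` is `speed * mass x`, so that the
walk that jumps from `x` to `y` at rate `cond x y / mass x` leaves each state at rate `speed`. -/
structure Network (S : Type*) where
  mass : S → ℝ
  cond : S → S → ℝ
  speed : ℝ
  mass_pos : ∀ x, 0 < mass x
  speed_pos : 0 < speed
  cond_nonneg : ∀ x y, 0 ≤ cond x y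
  cond_symm : ∀ x y, cond x y = cond y x
  cond_self : ∀ x, cond x x = 0
  hasSum_cond : ∀ x, HasSum (cond x) (speed * mass x)

namespace Network

variable {S : Type*} (N : Network S)

/-- The energy form `½ ∑_{x,y} c(x, y) (f(x) - f(y)) (g(x) - g(y))`. -/
noncomputable def energy (f g : S → ℝ) : ℝ :=
  1 / 2 * ∑' p : S × S, N.cond p.1 p.2 * ((f p.1 - f p.2) * (g p.1 - g p.2))

/-- Square summability with respect to the weights. -/
def SqSummable (f : S → ℝ) : Prop := Summable fun x => N.mass x * f x ^ 2

variable {N}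

lemma hasSum_cond_mul_sq {f : S → ℝ} (hf : N.SqSummable f) :
    HasSum (fun p : S × S => N.cond p.1 p.2 * f p.1 ^ 2)
      (N.speed * ∑' x, N.mass x * f x ^ 2) := by
  have h1 : ∀ x, HasSum (fun y => N.cond x y * f x ^ 2) (N.speed * (N.mass x * f x ^ 2)) := by
    intro x
    simpa [mul_assoc] using (N.hasSum_cond x).mul_right (f x ^ 2)
  have hs : Summable (fun p : S × S => N.cond p.1 p.2 * f p.1 ^ 2) := by
    refine (summable_prod_of_nonneg fun p => ?_).2 ⟨fun x => (h1 x).summable, ?_⟩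
    · exact mul_nonneg (N.cond_nonneg _ _) (sq_nonneg _)
    · simpa only [(h1 _).tsum_eq] using hf.mul_left N.speed
  have h2 := hs.hasSum.prod_fiberwise h1
  rw [← tsum_mul_left, h2.tsum_eq]
  exact hs.hasSum

lemma hasSum_cond_mul_sq' {f : S → ℝ} (hf : N.SqSummable f) :
    HasSum (fun p : S × S => N.cond p.1 p.2 * f p.2 ^ 2)
      (N.speed * ∑' x, N.mass x * f x ^ 2) := by
  rw [← (Equiv.prodComm S S).hasSum_iff]
  convert hasSum_cond_mul_sq hf using 2
  simp [N.cond_symm]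

lemma summable_energy {f g : S → ℝ} (hf : N.SqSummable f) (hg : N.SqSummable g) :
    Summable fun p : S × S => N.cond p.1 p.2 * ((f p.1 - f p.2) * (g p.1 - g p.2)) := by
  refine Summable.of_norm_bounded (((hasSum_cond_mul_sq hf).add (hasSum_cond_mul_sq' hf)).add
    ((hasSum_cond_mul_sq hg).add (hasSum_cond_mul_sq' hg))).summable fun p => ?_
  rw [Real.norm_eq_abs, abs_mul, abs_of_nonneg (N.cond_nonneg _ _)]
  have h : |(f p.1 - f p.2) * (g p.1 - g p.2)| ≤
      (f p.1 ^ 2 + f p.2 ^ 2) + (g p.1 ^ 2 + g p.2 ^ 2) := by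
    rw [abs_le]
    constructor <;> nlinarith [sq_nonneg ((f p.1 - f p.2) + (g p.1 - g p.2)),
      sq_nonneg ((f p.1 - f p.2) - (g p.1 - g p.2)), sq_nonneg (f p.1 + f p.2),
      sq_nonneg (g p.1 + g p.2)]
  calc _ ≤ N.cond p.1 p.2 * ((f p.1 ^ 2 + f p.2 ^ 2) + (g p.1 ^ 2 + g p.2 ^ 2)) :=
        mul_le_mul_of_nonneg_left h (N.cond_nonneg _ _)
    _ = _ := by ring

lemma energy_add_left {f g h : S → ℝ} (hf : N.SqSummable f) (hg : N.SqSummable g)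
    (hh : N.SqSummable h) : N.energy (f + g) h = N.energy f h + N.energy g h := by
  rw [energy, energy, energy, ← mul_add, ← (summable_energy hf hh).tsum_add (summable_energy hg hh)]
  congr 2 with p
  simp only [Pi.add_apply]; ring

lemma energy_smul_left (c : ℝ) (f g : S → ℝ) : N.energy (c • f) g = c * N.energy f g := by
  rw [energy, energy, ← mul_assoc, mul_comm c, mul_assoc, ← tsum_mul_left (a := c)]
  congr 2 with p
  simp only [Pi.smul_apply, smul_eq_mul]; ring

lemma energy_symm (f g : S → ℝ) : N.energy f g = N.energy g f := by
  simp only [energy, mul_comm (f _ - f _)]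

lemma energy_nonneg (f : S → ℝ) : 0 ≤ N.energy f f :=
  mul_nonneg (by norm_num)
    (tsum_nonneg fun p => mul_nonneg (N.cond_nonneg _ _) (mul_self_nonneg _))

lemma energy_le {f : S → ℝ} (hf : N.SqSummable f) :
    N.energy f f ≤ 2 * N.speed * ∑' x, N.mass x * f x ^ 2 := by
  have h := (hasSum_cond_mul_sq hf).add (hasSum_cond_mul_sq' hf)
  have h2 : ∑' p : S × S, N.cond p.1 p.2 * ((f p.1 - f p.2) * (f p.1 - f p.2)) ≤
      2 * (N.speed * (∑' x, N.mass x * f x ^ 2) + N.speed * ∑' x, N.mass x * f x ^ 2) := by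
    refine hasSum_le (fun p => ?_) (summable_energy hf hf).hasSum (h.mul_left 2)
    have := N.cond_nonneg p.1 p.2
    nlinarith [mul_nonneg this (sq_nonneg (f p.1 + f p.2))]
  rw [energy]; linarith

/-- The unit contraction, and more generally every contraction of the line, operates. -/
lemma energy_le_of_contraction {f g : S → ℝ} (hf : N.SqSummable f) (hg : N.SqSummable g)
    (h : ∀ x y, |g x - g y| ≤ |f x - f y|) : N.energy g g ≤ N.energy f f := by
  refine mul_le_mul_of_nonneg_left ?_ (by norm_num)
  refine (summable_energy hg hg).tsum_le_tsum (fun p => ?_) (summable_energy hf hf)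
  refine mul_le_mul_of_nonneg_left ?_ (N.cond_nonneg _ _)
  simpa only [abs_mul_abs_self] using
    mul_self_le_mul_self (abs_nonneg _) (h p.1 p.2)

lemma summable_cond_mul {f : S → ℝ} (hf : N.SqSummable f) (x : S) :
    Summable fun y => N.cond x y * f y := by
  have h1 : Summable fun y => N.cond x y * f y ^ 2 :=
    (hasSum_cond_mul_sq' hf).summable.prod_factor x
  refine Summable.of_norm_bounded (h1.add (N.hasSum_cond x).summable) fun y => ?_
  rw [Real.norm_eq_abs, abs_mul, abs_of_nonneg (N.cond_nonneg _ _)]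
  have h : |f y| ≤ f y ^ 2 + 1 := by
    rw [← sq_abs]; nlinarith [sq_nonneg (|f y| - 1), sq_abs (f y)]
  nlinarith [N.cond_nonneg x y, mul_le_mul_of_nonneg_left h (N.cond_nonneg x y)]

lemma sqSummable_indicator (z : S) : N.SqSummable (indicator {z} fun _ => 1) := by
  refine summable_of_ne_finset_zero (s := {z}) fun b hb => ?_
  have : b ∉ ({z} : Set S) := by simpa using hb
  simp [this]

/-- The generator of the walk, read off from the form by testing with the indicator of a point. -/
lemma energy_indicator {f : S → ℝ} (hf : N.SqSummable f) (z : S) :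
    N.energy f (indicator {z} fun _ => 1) =
      N.speed * N.mass z * f z - ∑' y, N.cond z y * f y := by
  classical
  have hs : HasSum (fun y => N.cond z y * (f z - f y))
      (N.speed * N.mass z * f z - ∑' y, N.cond z y * f y) := by
    simpa only [mul_sub] using
      ((N.hasSum_cond z).mul_right (f z)).sub (summable_cond_mul hf z).hasSum
  have h1 : HasSum (fun p : S × S => N.cond p.1 p.2 * ((f p.1 - f p.2) *
      (indicator {z} (fun _ => (1 : ℝ)) p.1)))
      (N.speed * N.mass z * f z - ∑' y, N.cond z y * f y) := by
    rw [← (Prod.mk_right_injective z).hasSum_iff]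
    · simpa [Function.comp_def] using hs
    · rintro ⟨a, b⟩ hab
      have : a ≠ z := by rintro rfl; exact hab ⟨b, rfl⟩
      simp [this]
  have h2 : HasSum (fun p : S × S => N.cond p.1 p.2 * ((f p.1 - f p.2) *
      (indicator {z} (fun _ => (1 : ℝ)) p.2)))
      (-(N.speed * N.mass z * f z - ∑' y, N.cond z y * f y)) := by
    rw [← (Equiv.prodComm S S).hasSum_iff]
    refine h1.neg.congr_fun fun p => ?_
    simp only [Function.comp_apply, Equiv.prodComm_apply, Prod.fst_swap, Prod.snd_swap,
      N.cond_symm p.2 p.1]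
    ring
  have h3 := h1.sub h2
  rw [energy, (h3.congr_fun ?_).tsum_eq]
  · ring
  · intro p; ring

lemma sqSummable_of_hasCompactSupport [TopologicalSpace S] [DiscreteTopology S] {φ : S → ℝ}
    (h : HasCompactSupport φ) : N.SqSummable φ := by
  refine summable_of_hasFiniteSupport ((isCompact_iff_finite.1 h).subset fun x hx => ?_)
  refine subset_tsupport _ fun h0 => hx ?_
  simp [h0]

variable [MeasurableSpace S]
variable (N)

/-- The reference measure, which gives mass `mass x` to the state `x`. -/
noncomputable def measure : Measure S :=
  Measure.sum fun x => ENNReal.ofReal (N.mass x) • Measure.dirac x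

variable {N} [MeasurableSingletonClass S]

lemma measure_singleton (x : S) : N.measure {x} = ENNReal.ofReal (N.mass x) := by
  classical
  rw [measure, Measure.sum_apply _ (measurableSet_singleton x), tsum_eq_single x]
  · simp
  · intro y hy; simp [hy]

lemma measure_singleton_ne_top (x : S) : N.measure {x} ≠ ∞ := by simp [measure_singleton]

lemma forall_of_ae {p : S → Prop} (h : ∀ᵐ x ∂N.measure, p x) (x : S) : p x := by
  by_contra hx
  have h0 : N.measure {x} = 0 := measure_mono_null (by simpa using hx) h
  rw [measure_singleton, ENNReal.ofReal_eq_zero] at h0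
  exact absurd (N.mass_pos x) (not_lt.2 h0)

lemma coe_add (f g : Lp ℝ 2 N.measure) : ⇑(f + g) = f + g :=
  funext <| forall_of_ae (Lp.coeFn_add f g)

lemma coe_sub (f g : Lp ℝ 2 N.measure) : ⇑(f - g) = f - g :=
  funext <| forall_of_ae (Lp.coeFn_sub f g)

lemma coe_smul (c : ℝ) (f : Lp ℝ 2 N.measure) : ⇑(c • f) = c • ⇑f :=
  funext <| forall_of_ae (Lp.coeFn_smul c f)

lemma coe_toLp {f : S → ℝ} (hf : MemLp f 2 N.measure) : ⇑(hf.toLp f) = f :=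
  funext <| forall_of_ae hf.coeFn_toLp

/-- The indicator of a state as an element of `L²`. -/
noncomputable def point (N : Network S) (z : S) : Lp ℝ 2 N.measure :=
  indicatorConstLp 2 (measurableSet_singleton z) (measure_singleton_ne_top z) (1 : ℝ)

lemma coe_point (z : S) : ⇑(N.point z) = indicator {z} fun _ => 1 :=
  funext <| forall_of_ae indicatorConstLp_coeFn

lemma hasSum_inner (f g : Lp ℝ 2 N.measure) :
    HasSum (fun x => N.mass x * (f x * g x)) (inner ℝ f g) := by
  have h := L2.integrable_inner (𝕜 := ℝ) f g
  rw [L2.inner_def]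
  have h2 := hasSum_integral_measure (f := fun x => inner ℝ (f x) (g x)) h
  simp only [integral_smul_measure, integral_dirac,
    ENNReal.toReal_ofReal (N.mass_pos _).le, smul_eq_mul, RCLike.inner_apply, conj_trivial] at h2
  simp only [mul_comm (f _) (g _)]
  exact h2

lemma norm_sq_eq (f : Lp ℝ 2 N.measure) : ‖f‖ ^ 2 = ∑' x, N.mass x * f x ^ 2 := by
  rw [← real_inner_self_eq_norm_sq, ← (hasSum_inner f f).tsum_eq]
  simp [sq]

lemma inner_point (f : Lp ℝ 2 N.measure) (z : S) : inner ℝ f (N.point z) = N.mass z * f z := by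
  rw [← (hasSum_inner f (N.point z)).tsum_eq, tsum_eq_single z]
  · simp [coe_point]
  · intro y hy; simp [coe_point, hy]

variable [Countable S]

lemma memLp_iff {f : S → ℝ} : MemLp f 2 N.measure ↔ N.SqSummable f := by
  rw [memLp_two_iff_integrable_sq (Measurable.of_discrete).aestronglyMeasurable, measure,
    integrable_sum_dirac_iff (by simp), SqSummable]
  simp [ENNReal.toReal_ofReal (N.mass_pos _).le]

lemma sqSummable_coe (f : Lp ℝ 2 N.measure) : N.SqSummable f := memLp_iff.1 (Lp.memLp f)

lemma energy_le_norm_sq (f : Lp ℝ 2 N.measure) : N.energy f f ≤ 2 * N.speed * ‖f‖ ^ 2 := by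
  rw [norm_sq_eq]; exact energy_le (sqSummable_coe f)

lemma energy_tendsto_zero {u : ℕ → Lp ℝ 2 N.measure} (hu : Tendsto (fun n => ‖u n‖) atTop (𝓝 0)) :
    Tendsto (fun n => N.energy (u n) (u n) + ‖u n‖ ^ 2) atTop (𝓝 0) := by
  have h2 : Tendsto (fun n => (2 * N.speed + 1) * ‖u n‖ ^ 2) atTop (𝓝 0) := by
    simpa using (hu.pow 2).const_mul (2 * N.speed + 1)
  refine squeeze_zero (fun n => add_nonneg (energy_nonneg _) (sq_nonneg _)) (fun n => ?_) h2
  linarith [energy_le_norm_sq (N := N) (u n)]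

/-- The energy form, being bounded on `L²`, is a Dirichlet form with domain `L²`. -/
lemma isDirichletForm : IsDirichletForm N.measure ⊤ fun f g => N.energy f g where
  dense := by simp
  add_left f _ g _ h _ := by
    rw [coe_add]; exact energy_add_left (sqSummable_coe f) (sqSummable_coe g) (sqSummable_coe h)
  smul_left c f _ g _ := by rw [coe_smul]; exact energy_smul_left c f g
  symm f _ g _ := energy_symm f g
  nonneg f _ := energy_nonneg _
  closed u _ hu := by
    have hc : CauchySeq u := by
      refine Metric.cauchySeq_iff.2 fun δ hδ => ?_
      obtain ⟨n₀, hn₀⟩ := hu (δ ^ 2) (by positivity)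
      refine ⟨n₀, fun i hi j hj => ?_⟩
      have h1 := hn₀ i hi j hj
      have h2 := energy_nonneg (N := N) ⇑(u i - u j)
      rw [dist_eq_norm]
      exact lt_of_pow_lt_pow_left₀ 2 hδ.le (by linarith)
    obtain ⟨f, hf⟩ := cauchySeq_tendsto_of_complete hc
    refine ⟨f, trivial, energy_tendsto_zero (tendsto_iff_norm_sub_tendsto_zero.1 hf)⟩
  markov f _ := by
    have h0 : N.SqSummable fun x => min (max (f x) 0) 1 := by
      refine Summable.of_nonneg_of_le
        (fun x => mul_nonneg (N.mass_pos x).le (sq_nonneg _)) (fun x => ?_) (sqSummable_coe f)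
      refine mul_le_mul_of_nonneg_left (sq_le_sq.2 ?_) (N.mass_pos x).le
      rw [abs_of_nonneg (le_min (le_max_right _ _) zero_le_one)]
      exact (min_le_left _ _).trans (max_le (le_abs_self _) (abs_nonneg _))
    refine ⟨(memLp_iff.2 h0).toLp _, trivial, (memLp_iff.2 h0).coeFn_toLp, ?_⟩
    rw [coe_toLp]
    refine energy_le_of_contraction (sqSummable_coe f) h0 fun x y => ?_
    exact (abs_min_sub_min_le_max _ _ _ _).trans
      (by simpa using abs_max_sub_max_le_abs (f x) (f y) 0)

variable [TopologicalSpace S] [DiscreteTopology S]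

/-- The functions with finite support are dense in `L²`. -/
lemma exists_hasCompactSupport_norm_sub_lt (f : Lp ℝ 2 N.measure) {δ : ℝ} (hδ : 0 < δ) :
    ∃ φ : S → ℝ, HasCompactSupport φ ∧ ∃ g : Lp ℝ 2 N.measure, ⇑g = φ ∧ ‖f - g‖ ^ 2 < δ := by
  classical
  obtain ⟨s, hs⟩ := ((tendsto_tsum_compl_atTop_zero fun x => N.mass x * f x ^ 2).eventually
    (gt_mem_nhds hδ)).exists
  have hφ : HasCompactSupport (indicator (s : Set S) f) :=
    HasCompactSupport.intro s.finite_toSet.isCompact fun x hx => by simp_all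
  refine ⟨_, hφ, (memLp_iff.2 (sqSummable_of_hasCompactSupport hφ)).toLp _, coe_toLp _, ?_⟩
  rw [norm_sq_eq, coe_sub, coe_toLp]
  refine lt_of_eq_of_lt ?_ hs
  refine Eq.trans ?_ (tsum_subtype {x | x ∉ s} fun x => N.mass x * f x ^ 2).symm
  congr 1 with x
  by_cases hx : x ∈ s <;> simp [hx]

lemma isRegularDirichletForm : IsRegularDirichletForm N.measure ⊤ fun f g => N.energy f g where
  toIsDirichletForm := isDirichletForm
  finite_on_compacts K hK := by
    have : K = ⋃ x ∈ K, {x} := by simp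
    rw [this]
    exact measure_biUnion_lt_top (isCompact_iff_finite.1 hK)
      fun x _ => (measure_singleton_ne_top x).lt_top
  full_support U _ hU := by
    obtain ⟨x, hx⟩ := hU
    refine lt_of_lt_of_le ?_ (measure_mono (singleton_subset_iff.2 hx))
    rw [measure_singleton]; simpa using N.mass_pos x
  core_dense f _ δ hδ := by
    have hl := N.speed_pos
    obtain ⟨φ, hφ, g, hg, h⟩ := exists_hasCompactSupport_norm_sub_lt f
      (show 0 < δ / (2 * N.speed + 1) by positivity)
    refine ⟨φ, continuous_of_discreteTopology, hφ, g, trivial, ae_of_all _ fun x => by rw [hg], ?_⟩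
    rw [lt_div_iff₀ (by positivity)] at h
    linarith [energy_le_norm_sq (N := N) (f - g)]
  core_uniformly_dense ψ hc hψ δ hδ :=
    ⟨ψ, hc, hψ, ⟨(memLp_iff.2 (sqSummable_of_hasCompactSupport hψ)).toLp _, trivial,
      (memLp_iff.2 (sqSummable_of_hasCompactSupport hψ)).coeFn_toLp⟩, fun x => by simpa⟩

end Network

/-! ### The semigroup of a network -/

namespace Network

variable {S : Type*} {N : Network S} [MeasurableSpace S] [MeasurableSingletonClass S] [Countable S]

/-- The energy form as a bilinear form on `L²`. -/
noncomputable def bilinForm (N : Network S) : LinearMap.BilinForm ℝ (Lp ℝ 2 N.measure) :=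
  LinearMap.mk₂ ℝ (fun f g : Lp ℝ 2 N.measure => N.energy f g)
    (fun f g h => by
      rw [coe_add]
      exact energy_add_left (sqSummable_coe f) (sqSummable_coe g) (sqSummable_coe h))
    (fun c f g => by rw [coe_smul]; exact energy_smul_left c f g)
    (fun f g h => by
      rw [coe_add, energy_symm, energy_symm f g, energy_symm f h]
      exact energy_add_left (sqSummable_coe g) (sqSummable_coe h) (sqSummable_coe f))
    (fun c f g => by
      rw [coe_smul, energy_symm, energy_symm f g]; exact energy_smul_left c g f)

/-- The energy form as a bounded bilinear form on `L²`. -/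
noncomputable def boundedForm (N : Network S) :
    Lp ℝ 2 N.measure →L[ℝ] Lp ℝ 2 N.measure →L[ℝ] ℝ :=
  LinearMap.mkContinuous₂ N.bilinForm (2 * N.speed) fun f g => by
    have hl := N.speed_pos
    have h := LinearMap.BilinForm.apply_sq_le_of_symm N.bilinForm
      (fun f => energy_nonneg (N := N) ⇑f) ⟨fun f g => energy_symm (N := N) ⇑f ⇑g⟩ f g
    refine abs_le_of_sq_le_sq (h.trans ?_) (by positivity)
    refine (mul_le_mul (energy_le_norm_sq f) (energy_le_norm_sq g) (energy_nonneg _)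
      (by positivity)).trans_eq (by ring)

/-- The positive self-adjoint operator `L` with `(L f, g) = 𝓔(f, g)`. -/
noncomputable def generator (N : Network S) : Lp ℝ 2 N.measure →L[ℝ] Lp ℝ 2 N.measure :=
  InnerProductSpace.continuousLinearMapOfBilin (𝕜 := ℝ) N.boundedForm

lemma inner_generator (f g : Lp ℝ 2 N.measure) :
    inner ℝ (N.generator f) g = N.energy f g :=
  InnerProductSpace.continuousLinearMapOfBilin_apply (𝕜 := ℝ) N.boundedForm f g

lemma isSelfAdjoint_generator : IsSelfAdjoint N.generator := by
  rw [ContinuousLinearMap.isSelfAdjoint_iff_isSymmetric]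
  intro f g
  change inner ℝ (N.generator f) g = inner ℝ f (N.generator g)
  rw [real_inner_comm (N.generator g), inner_generator, inner_generator, energy_symm]

/-- The group `exp(-t L)`, `t ∈ ℝ`. -/
noncomputable def semigroup (N : Network S) (t : ℝ) :
    Lp ℝ 2 N.measure →L[ℝ] Lp ℝ 2 N.measure :=
  NormedSpace.exp (t • (-N.generator))

lemma semigroup_zero : N.semigroup 0 = 1 := by simp [semigroup]

lemma semigroup_add (s t : ℝ) : N.semigroup (s + t) = N.semigroup s * N.semigroup t := by
  let +nondep : NormedAlgebra ℚ (Lp ℝ 2 N.measure →L[ℝ] Lp ℝ 2 N.measure) :=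
    .restrictScalars ℚ ℝ _
  rw [semigroup, add_smul]
  exact NormedSpace.exp_add_of_commute (((Commute.refl _).smul_left s).smul_right t)

lemma inner_semigroup (t : ℝ) (f g : Lp ℝ 2 N.measure) :
    inner ℝ (N.semigroup t f) g = inner ℝ f (N.semigroup t g) := by
  have h : IsSelfAdjoint (N.semigroup t) := by
    refine IsSelfAdjoint.exp ?_
    exact (IsSelfAdjoint.all t).smul isSelfAdjoint_generator.neg
  exact ContinuousLinearMap.isSelfAdjoint_iff_isSymmetric.1 h f g

lemma hasDerivAt_semigroup (t : ℝ) (f : Lp ℝ 2 N.measure) :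
    HasDerivAt (fun t => N.semigroup t f) (-N.generator (N.semigroup t f)) t := by
  have h := hasDerivAt_exp_smul_const' (𝕂 := ℝ) (-N.generator) t
  simpa [semigroup] using h.clm_apply (hasDerivAt_const t f)

lemma norm_semigroup_le {t : ℝ} (ht : 0 ≤ t) (f : Lp ℝ 2 N.measure) :
    ‖N.semigroup t f‖ ≤ ‖f‖ := by
  have h1 : ∀ t, HasDerivAt (fun t => ‖N.semigroup t f‖ ^ 2)
      (2 * inner ℝ (N.semigroup t f) (-N.generator (N.semigroup t f))) t := fun t =>
    (hasDerivAt_semigroup t f).norm_sq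
  have h2 : Antitone fun t => ‖N.semigroup t f‖ ^ 2 := by
    refine antitone_of_deriv_nonpos (fun t => (h1 t).differentiableAt) fun t => ?_
    rw [(h1 t).deriv, inner_neg_right, real_inner_comm, inner_generator]
    linarith [energy_nonneg (N := N) ⇑(N.semigroup t f)]
  have h3 := h2 ht
  simp only [semigroup_zero, one_apply_eq_self] at h3
  exact le_of_sq_le_sq h3 (norm_nonneg f)

lemma tendsto_semigroup (f g : Lp ℝ 2 N.measure) :
    Tendsto (fun t : ℝ≥0 => (t : ℝ)⁻¹ * inner ℝ (f - N.semigroup t f) g) (𝓝[>] 0)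
      (𝓝 (N.energy f g)) := by
  have h := (hasDerivAt_semigroup (N := N) 0 f).tendsto_slope_zero_right
  simp only [zero_add, semigroup_zero, one_apply_eq_self] at h
  have h2 : Tendsto (fun t : ℝ≥0 => (t : ℝ)) (𝓝[>] 0) (𝓝[>] 0) := by
    refine tendsto_nhdsWithin_iff.2 ⟨?_, ?_⟩
    · exact (NNReal.continuous_coe.tendsto' 0 0 rfl).mono_left nhdsWithin_le_nhds
    · filter_upwards [self_mem_nhdsWithin] with t ht using ht
  have h3 := ((h.comp h2).neg.inner (tendsto_const_nhds (x := g)) (𝕜 := ℝ))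
  rw [neg_neg, inner_generator] at h3
  refine h3.congr fun t => ?_
  simp only [Function.comp_apply]
  rw [← smul_neg, neg_sub, real_inner_smul_left]

lemma isSemigroupOfForm :
    IsSemigroupOfForm N.measure ⊤ (fun f g => N.energy f g) fun t => N.semigroup t where
  zero f := by simp [semigroup_zero]
  add s t f := by simp [semigroup_add]
  contraction t f := norm_semigroup_le t.2 f
  symm t f g := inner_semigroup t f g
  strongly_continuous f := by
    have h := (hasDerivAt_semigroup (N := N) 0 f).continuousAt
    have h2 : Tendsto (fun t : ℝ≥0 => (t : ℝ)) (𝓝[>] 0) (𝓝 0) :=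
      (NNReal.continuous_coe.tendsto' 0 0 rfl).mono_left nhdsWithin_le_nhds
    simpa [semigroup_zero, Function.comp_def] using h.tendsto.comp h2
  mem_domain_iff f := ⟨fun _ => ⟨_, tendsto_semigroup f f⟩, fun _ => trivial⟩
  form_eq f _ g _ := tendsto_semigroup f g

/-- The law `∑_z c(x, z) / (speed * mass x) δ_z` of a jump from `x`. -/
noncomputable def jump (N : Network S) (x : S) : Measure S :=
  Measure.sum fun z => ENNReal.ofReal (N.cond x z / (N.speed * N.mass x)) • Measure.dirac z

omit [Countable S] in
lemma jump_singleton (x y : S) :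
    N.jump x {y} = ENNReal.ofReal (N.cond x y / (N.speed * N.mass x)) := by
  classical
  rw [jump, Measure.sum_apply _ (measurableSet_singleton y), tsum_eq_single y]
  · simp
  · intro z hz; simp [hz]

omit [Countable S] in
lemma jump_self (x : S) : N.jump x {x} = 0 := by simp [jump_singleton, N.cond_self]

omit [MeasurableSingletonClass S] [Countable S] in
lemma isProbabilityMeasure_jump (x : S) : IsProbabilityMeasure (N.jump x) := by
  have h0 : 0 < N.speed * N.mass x := mul_pos N.speed_pos (N.mass_pos x)
  have h := (N.hasSum_cond x).div_const (N.speed * N.mass x)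
  refine ⟨?_⟩
  rw [jump, Measure.sum_apply _ MeasurableSet.univ]
  simp only [Measure.smul_apply, measure_univ, smul_eq_mul, mul_one]
  rw [← ENNReal.ofReal_tsum_of_nonneg (fun z => div_nonneg (N.cond_nonneg _ _) h0.le) h.summable,
    h.tsum_eq, div_self h0.ne', ENNReal.ofReal_one]

/-- The averaging operator `K = 1 - L / speed` on `L²`: `K f(x)` is the mean of `f` after a jump
from `x`. -/
noncomputable def average (N : Network S) : Lp ℝ 2 N.measure →L[ℝ] Lp ℝ 2 N.measure :=
  1 - N.speed⁻¹ • N.generator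

lemma average_apply (f : Lp ℝ 2 N.measure) (x : S) :
    N.average f x = ∑' y, N.cond x y / (N.speed * N.mass x) * f y := by
  have hm := N.mass_pos x
  have hl := N.speed_pos
  have h1 : N.mass x * N.generator f x =
      N.speed * N.mass x * f x - ∑' y, N.cond x y * f y := by
    rw [← inner_point, inner_generator, coe_point, energy_indicator (sqSummable_coe f)]
  have h2 : ∀ y, N.cond x y / (N.speed * N.mass x) * f y =
      (N.speed * N.mass x)⁻¹ * (N.cond x y * f y) := fun y => by ring
  simp only [h2]
  rw [tsum_mul_left, average, sub_apply, one_apply_eq_self,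
    smul_apply, coe_sub, coe_smul, Pi.sub_apply, Pi.smul_apply, smul_eq_mul,
    show ∑' y, N.cond x y * f y = N.speed * N.mass x * f x - N.mass x * N.generator f x by
      linarith]
  field_simp

/-- The averaging operator on functions with values in `[0, ∞]`. -/
noncomputable def eaverage (N : Network S) (g : S → ℝ≥0∞) (x : S) : ℝ≥0∞ :=
  ∫⁻ y, g y ∂N.jump x

lemma ofReal_average {f : Lp ℝ 2 N.measure} (hf : ∀ x, 0 ≤ f x) (x : S) :
    0 ≤ N.average f x ∧
      ENNReal.ofReal (N.average f x) = N.eaverage (fun y => ENNReal.ofReal (f y)) x := by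
  have h0 : 0 < N.speed * N.mass x := mul_pos N.speed_pos (N.mass_pos x)
  have h1 : ∀ y, 0 ≤ N.cond x y / (N.speed * N.mass x) := fun y =>
    div_nonneg (N.cond_nonneg _ _) h0.le
  rw [average_apply]
  refine ⟨tsum_nonneg fun y => mul_nonneg (h1 y) (hf y), ?_⟩
  rw [ENNReal.ofReal_tsum_of_nonneg (fun y => mul_nonneg (h1 y) (hf y)), eaverage, jump,
    lintegral_sum_measure]
  · congr 1 with y
    rw [lintegral_smul_measure, lintegral_dirac, ENNReal.ofReal_mul (h1 y), smul_eq_mul]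
  · refine ((summable_cond_mul (sqSummable_coe f) x).mul_left (N.speed * N.mass x)⁻¹).congr
      fun y => by ring

lemma ofReal_average_pow {f : Lp ℝ 2 N.measure} (hf : ∀ x, 0 ≤ f x) (n : ℕ) :
    (∀ x, 0 ≤ (N.average ^ n) f x) ∧ ∀ x,
      ENNReal.ofReal ((N.average ^ n) f x) = N.eaverage^[n] (fun y => ENNReal.ofReal (f y)) x := by
  induction n with
  | zero => exact ⟨by simpa using hf, by simp⟩
  | succ n ih =>
    have h : (N.average ^ (n + 1)) f = N.average ((N.average ^ n) f) := by
      rw [pow_succ']; rfl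
    rw [h]
    refine ⟨fun x => (ofReal_average ih.1 x).1, fun x => ?_⟩
    rw [(ofReal_average ih.1 x).2, Function.iterate_succ_apply']
    congr 1
    exact funext ih.2

/-- The probability `e^{-λt} (λt)^n / n!` of `n` jumps up to time `t` at rate `λ`. -/
noncomputable def poissonWeight (rate t : ℝ) (n : ℕ) : ℝ :=
  Real.exp (-(rate * t)) * (rate * t) ^ n / n.factorial

lemma poissonWeight_nonneg {rate t : ℝ} (hr : 0 ≤ rate) (ht : 0 ≤ t) (n : ℕ) :
    0 ≤ poissonWeight rate t n := by unfold poissonWeight; positivity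

/-- The semigroup is the mixture of the powers of the averaging operator with Poisson weights. -/
lemma hasSum_semigroup (t : ℝ) (f : Lp ℝ 2 N.measure) (x : S) :
    HasSum (fun n => poissonWeight N.speed t n * (N.average ^ n) f x) (N.semigroup t f x) := by
  have hl := N.speed_pos.ne'
  let +nondep : NormedAlgebra ℚ (Lp ℝ 2 N.measure →L[ℝ] Lp ℝ 2 N.measure) :=
    .restrictScalars ℚ ℝ _
  have h1 : N.semigroup t =
      Real.exp (-(N.speed * t)) • NormedSpace.exp ((N.speed * t) • N.average) := by
    have h2 : t • (-N.generator) = (-(N.speed * t)) • (1 : Lp ℝ 2 N.measure →L[ℝ] Lp ℝ 2 N.measure)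
        + (N.speed * t) • N.average := by
      rw [average, smul_sub, smul_smul, mul_right_comm, mul_inv_cancel₀ hl, one_mul, neg_smul,
        smul_neg]
      abel
    rw [semigroup, h2, NormedSpace.exp_add_of_commute
      (((Commute.one_left _).smul_left _).smul_right _), ← Algebra.algebraMap_eq_smul_one,
      ← NormedSpace.algebraMap_exp_comm (𝕂 := ℝ), ← Real.exp_eq_exp_ℝ,
      Algebra.algebraMap_eq_smul_one, smul_mul_assoc, one_mul]
  have h3 := NormedSpace.exp_series_hasSum_exp' (𝕂 := ℝ) ((N.speed * t) • N.average)
  have h4 := h3.mapL (ContinuousLinearMap.apply ℝ (Lp ℝ 2 N.measure) f)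
  have h5 : HasSum (fun n => (N.mass x)⁻¹ * inner ℝ (N.point x) ((n.factorial : ℝ)⁻¹ •
      ((N.speed * t) • N.average) ^ n • f)) ((N.mass x)⁻¹ * inner ℝ (N.point x)
        (NormedSpace.exp ((N.speed * t) • N.average) f)) :=
    (h4.mapL (innerSL ℝ (N.point x))).mul_left (N.mass x)⁻¹
  have hm := (N.mass_pos x).ne'
  have h6 : ∀ g : Lp ℝ 2 N.measure, (N.mass x)⁻¹ * inner ℝ (N.point x) g = g x := fun g => by
    rw [real_inner_comm, inner_point, inv_mul_cancel_left₀ hm]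
  simp only [h6] at h5
  rw [h1, smul_apply, coe_smul, Pi.smul_apply, smul_eq_mul]
  refine (h5.mul_left (Real.exp (-(N.speed * t)))).congr_fun fun n => ?_
  rw [smul_pow, coe_smul, ContinuousLinearMap.smul_def, smul_apply, coe_smul, poissonWeight]
  simp only [Pi.smul_apply, smul_eq_mul]
  ring

lemma ofReal_semigroup {t : ℝ} (ht : 0 ≤ t) {f : Lp ℝ 2 N.measure} (hf : ∀ x, 0 ≤ f x) (x : S) :
    0 ≤ N.semigroup t f x ∧ ENNReal.ofReal (N.semigroup t f x) =
      ∑' n, ENNReal.ofReal (poissonWeight N.speed t n) *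
        N.eaverage^[n] (fun y => ENNReal.ofReal (f y)) x := by
  have h0 := poissonWeight_nonneg N.speed_pos.le ht
  have h := hasSum_semigroup t f x
  have h1 : ∀ n, 0 ≤ poissonWeight N.speed t n * (N.average ^ n) f x := fun n =>
    mul_nonneg (h0 n) ((ofReal_average_pow hf n).1 x)
  refine ⟨h.nonneg h1, ?_⟩
  rw [← h.tsum_eq, ENNReal.ofReal_tsum_of_nonneg h1 h.summable]
  congr 1 with n
  rw [ENNReal.ofReal_mul (h0 n), (ofReal_average_pow hf n).2]

end Network

/-! ### The exponential law of a holding time -/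

/-- The exponential law as a measure on `[0, ∞)`. -/
noncomputable def expLaw (rate : ℝ) : Measure ℝ≥0 := (expMeasure rate).map Real.toNNReal

section expLaw

variable {rate : ℝ}

lemma isProbabilityMeasure_expLaw (hr : 0 < rate) : IsProbabilityMeasure (expLaw rate) := by
  have := isProbabilityMeasure_expMeasure hr
  exact Measure.isProbabilityMeasure_map (by fun_prop)

lemma expLaw_Ioi (hr : 0 < rate) (s : ℝ≥0) :
    expLaw rate (Ioi s) = ENNReal.ofReal (Real.exp (-(rate * s))) := by
  have := isProbabilityMeasure_expMeasure hr
  have h1 : Real.toNNReal ⁻¹' Ioi s = (Iic (s : ℝ))ᶜ := by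
    ext x; simp [Real.lt_toNNReal_iff_coe_lt]
  have h2 := cdf_expMeasure_eq hr s
  rw [if_pos s.coe_nonneg, cdf_eq_real] at h2
  have h3 : (expMeasure rate).real (Iic (s : ℝ))ᶜ = Real.exp (-(rate * s)) := by
    rw [probReal_compl_eq_one_sub measurableSet_Iic, h2]; ring
  rw [expLaw, Measure.map_apply (by fun_prop) measurableSet_Ioi, h1, ← h3, ofReal_measureReal]

/-- The exponential law has no memory. -/
lemma lintegral_expLaw_sub (hr : 0 < rate) (s : ℝ≥0) {g : ℝ≥0 → ℝ≥0∞} (hg : Measurable g) :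
    ∫⁻ r in Ioi s, g (r - s) ∂expLaw rate =
      ENNReal.ofReal (Real.exp (-(rate * s))) * ∫⁻ r, g r ∂expLaw rate := by
  have := isProbabilityMeasure_expLaw hr
  have hm : Measurable fun r : ℝ≥0 => r - s := by fun_prop
  have h : ((expLaw rate).restrict (Ioi s)).map (fun r => r - s) =
      ENNReal.ofReal (Real.exp (-(rate * s))) • expLaw rate := by
    refine ext_of_generate_finite _ (BorelSpace.measurable_eq.trans (borel_eq_generateFrom_Ioi _))
      isPiSystem_Ioi ?_ ?_
    · rintro _ ⟨a, rfl⟩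
      rw [Measure.map_apply hm measurableSet_Ioi,
        Measure.restrict_apply (hm measurableSet_Ioi), Measure.smul_apply, expLaw_Ioi hr,
        smul_eq_mul, ← ENNReal.ofReal_mul (Real.exp_pos _).le, ← Real.exp_add]
      have : (fun r => r - s) ⁻¹' Ioi a ∩ Ioi s = Ioi (a + s) := by
        ext r
        simp only [mem_inter_iff, mem_preimage, mem_Ioi, lt_tsub_iff_right, and_iff_left_iff_imp]
        exact fun h => lt_of_le_of_lt le_add_self h
      rw [this, expLaw_Ioi hr]
      congr 2
      push_cast; ring
    · rw [Measure.map_apply hm MeasurableSet.univ, preimage_univ, Measure.restrict_apply_univ,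
        expLaw_Ioi hr, Measure.smul_apply, measure_univ, smul_eq_mul, mul_one]
  rw [← lintegral_map hg hm, h, lintegral_smul_measure, smul_eq_mul]

/-- The recursion that yields the Poisson law of the number of jumps: the first jump takes place
at a time `r ≤ t` and is followed by `n` jumps up to time `t`. -/
lemma lintegral_poissonWeight (hr : 0 < rate) (t : ℝ≥0) (n : ℕ) :
    ∫⁻ r in Iic t, ENNReal.ofReal (Network.poissonWeight rate ((t - r : ℝ≥0) : ℝ) n) ∂expLaw rate =
      ENNReal.ofReal (Network.poissonWeight rate t (n + 1)) := by
  have hw : ∀ n, Continuous fun u : ℝ => Network.poissonWeight rate u n := fun n => by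
    unfold Network.poissonWeight; fun_prop
  have hm : Measurable fun r : ℝ≥0 =>
      ENNReal.ofReal (Network.poissonWeight rate ((t - r : ℝ≥0) : ℝ) n) :=
    ((hw n).measurable.comp
      (by fun_prop : Measurable fun r : ℝ≥0 => ((t - r : ℝ≥0) : ℝ))).ennreal_ofReal
  set c : ℝ := Real.exp (-(rate * t)) * rate ^ (n + 1) / n.factorial
  rw [← lintegral_indicator measurableSet_Iic, expLaw,
    lintegral_map (hm.indicator measurableSet_Iic) (by fun_prop)]
  have h2 : ∫⁻ x, (Iic t).indicator (fun r : ℝ≥0 => ENNReal.ofReal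
      (Network.poissonWeight rate ((t - r : ℝ≥0) : ℝ) n)) x.toNNReal ∂expMeasure rate =
      ∫⁻ x in Icc 0 (t : ℝ), ENNReal.ofReal (c * (t - x) ^ n) := by
    change ∫⁻ x, _ ∂(volume.withDensity (exponentialPDF rate)) = _
    have hm2 : Measurable fun x : ℝ => (Iic t).indicator (fun r : ℝ≥0 => ENNReal.ofReal
        (Network.poissonWeight rate ((t - r : ℝ≥0) : ℝ) n)) x.toNNReal :=
      (hm.indicator measurableSet_Iic).comp (by fun_prop)
    have hd : Measurable (exponentialPDF rate) :=
      (measurable_exponentialPDFReal rate).ennreal_ofReal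
    rw [lintegral_withDensity_eq_lintegral_mul _ hd hm2, ← lintegral_indicator measurableSet_Icc]
    congr 1 with x
    simp only [Pi.mul_apply]
    rcases lt_or_ge x 0 with hx | hx
    · rw [exponentialPDF_of_neg hx, zero_mul, indicator_of_notMem (by simp [hx])]
    · rw [exponentialPDF_of_nonneg hx]
      lift x to ℝ≥0 using hx
      by_cases hxt : x ≤ t
      · rw [indicator_of_mem (by simpa using hxt), indicator_of_mem (by simpa using hxt),
          ← ENNReal.ofReal_mul (by positivity)]
        congr 1
        simp only [Real.toNNReal_coe, NNReal.coe_sub hxt, Network.poissonWeight, c]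
        rw [show -(rate * (t : ℝ)) = -(rate * x) + -(rate * ((t : ℝ) - x)) by ring, Real.exp_add,
          mul_pow]
        ring
      · rw [indicator_of_notMem (by simpa using hxt), indicator_of_notMem (by simpa using hxt),
          mul_zero]
  rw [h2, ← ofReal_integral_eq_lintegral_ofReal]
  · congr 1
    rw [integral_Icc_eq_integral_Ioc, ← intervalIntegral.integral_of_le t.coe_nonneg,
      intervalIntegral.integral_const_mul, intervalIntegral.integral_comp_sub_left (fun x => x ^ n),
      integral_pow]
    simp only [Network.poissonWeight, c, Nat.factorial_succ]
    have : (n.factorial : ℝ) ≠ 0 := by positivity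
    push_cast
    field_simp
    simp [mul_pow]
  · exact (by fun_prop : Continuous fun x : ℝ => c * ((t : ℝ) - x) ^ n).integrableOn_Icc
  · refine (ae_restrict_iff' measurableSet_Icc).2 (ae_of_all _ fun x hx => ?_)
    have : 0 ≤ (t : ℝ) - x := sub_nonneg.2 hx.2
    simp only [Pi.zero_apply, c]
    positivity

lemma tsum_poissonWeight (hr : 0 < rate) (t : ℝ≥0) :
    ∑' n, ENNReal.ofReal (Network.poissonWeight rate t n) = 1 := by
  have h : HasSum (fun n => Network.poissonWeight rate t n) 1 := by
    have h1 := (NormedSpace.expSeries_div_hasSum_exp (𝔸 := ℝ) (rate * t)).mul_left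
      (Real.exp (-(rate * t)))
    rw [← Real.exp_eq_exp_ℝ, ← Real.exp_add, neg_add_cancel, Real.exp_zero] at h1
    simpa only [Network.poissonWeight, mul_div_assoc] using h1
  rw [← ENNReal.ofReal_tsum_of_nonneg (Network.poissonWeight_nonneg hr.le t.coe_nonneg) h.summable,
    h.tsum_eq, ENNReal.ofReal_one]

end expLaw

/-! ### Sequences of independent random elements -/

section iid

variable {α : Type*}

/-- The sequence `a, ω 0, ω 1, …`. -/
def seqCons (a : α) (ω : ℕ → α) : ℕ → α
  | 0 => a
  | n + 1 => ω n

variable [MeasurableSpace α]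

lemma measurable_seqCons : Measurable fun p : α × (ℕ → α) => seqCons p.1 p.2 := by
  refine measurable_pi_lambda _ fun n => ?_
  cases n with
  | zero => exact measurable_fst
  | succ n => exact (measurable_pi_apply n).comp measurable_snd

lemma map_seqCons (μ : Measure α) [IsProbabilityMeasure μ] :
    (μ.prod (Measure.infinitePi fun _ : ℕ => μ)).map (fun p => seqCons p.1 p.2) =
      Measure.infinitePi fun _ : ℕ => μ := by
  refine Measure.eq_infinitePi _ fun s t ht => ?_
  have hs : MeasurableSet (Set.pi s t) := MeasurableSet.pi s.countable_toSet fun i _ => ht i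
  rw [Measure.map_apply measurable_seqCons hs]
  classical
  -- the coordinates `n + 1 ∈ s`, shifted
  let s' : Finset ℕ := s.preimage (· + 1) (add_left_injective 1).injOn
  have h1 : (fun p : α × (ℕ → α) => seqCons p.1 p.2) ⁻¹' (Set.pi s t) =
      (if 0 ∈ s then t 0 else univ) ×ˢ Set.pi s' fun i => t (i + 1) := by
    ext ⟨a, ω⟩
    simp only [mem_preimage, Set.mem_pi, mem_prod, Finset.mem_coe, s', Finset.mem_preimage]
    constructor
    · intro h
      refine ⟨?_, fun i hi => h (i + 1) hi⟩
      split_ifs with h0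
      · exact h 0 h0
      · trivial
    · rintro ⟨h0, h⟩ i hi
      cases i with
      | zero => rwa [if_pos hi] at h0
      | succ i => exact h i hi
  rw [h1, Measure.prod_prod, Measure.infinitePi_pi _ fun i _ => ht _]
  have h2 : ∏ i ∈ s', μ (t (i + 1)) = ∏ i ∈ s.erase 0, μ (t i) := by
    refine Finset.prod_bij (fun i _ => i + 1) (fun i hi => ?_) (fun _ _ _ _ h => by simpa using h)
      (fun b hb => ?_) (fun _ _ => rfl)
    · simpa [s'] using hi
    · obtain ⟨hb0, hb⟩ := Finset.mem_erase.1 hb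
      obtain ⟨c, rfl⟩ := Nat.exists_eq_succ_of_ne_zero hb0
      exact ⟨c, by simpa [s'] using hb, rfl⟩
  rw [h2]
  split_ifs with h0
  · exact Finset.mul_prod_erase s (fun i => μ (t i)) h0
  · rw [measure_univ, one_mul, Finset.erase_eq_of_notMem h0]

/-- Conditioning an independent sequence on its first term. -/
lemma lintegral_seqCons (μ : Measure α) [IsProbabilityMeasure μ] {F : (ℕ → α) → ℝ≥0∞}
    (hF : Measurable F) :
    ∫⁻ ω, F ω ∂Measure.infinitePi (fun _ : ℕ => μ) =
      ∫⁻ a, ∫⁻ ω, F (seqCons a ω) ∂Measure.infinitePi (fun _ : ℕ => μ) ∂μ := by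
  conv_lhs => rw [← map_seqCons μ]
  rw [lintegral_map hF measurable_seqCons]
  exact lintegral_prod _ (hF.comp measurable_seqCons).aemeasurable

end iid

/-! ### The walk driven by an independent sequence of holding times and jump maps -/

section OnePointDiscrete

instance (S : Type*) [TopologicalSpace S] : BorelSpace (OnePoint S) := ⟨rfl⟩

instance (S : Type*) [Countable S] : Countable (OnePoint S) :=
  inferInstanceAs (Countable (Option S))

end OnePointDiscrete

/-- The driving sequences: the `n`-th term consists of the `n`-th holding time and of a map that
sends each state to the state to which the walk would jump from it. -/
abbrev Driver (S : Type*) : Type _ := ℕ → ℝ≥0 × (S → S)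

namespace Driver

variable {S : Type*}

/-- The time of the `n`-th jump. -/
noncomputable def arrival (ω : Driver S) (n : ℕ) : ℝ≥0 := ∑ i ∈ Finset.range n, (ω i).1

/-- The state after `n` jumps. -/
def state (x : S) (ω : Driver S) : ℕ → S
  | 0 => x
  | n + 1 => (ω n).2 (state x ω n)

/-- The event that exactly `n` jumps take place up to time `t`. -/
def count (t : ℝ≥0) (n : ℕ) : Set (Driver S) :=
  {ω | arrival ω n ≤ t ∧ t < arrival ω (n + 1)}

open Classical in
/-- The walk at time `t`. It is in the cemetery if there are infinitely many jumps up to `t`. -/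
noncomputable def path (x : S) (t : ℝ≥0) (ω : Driver S) : OnePoint S :=
  if h : ∃ n, ω ∈ count t n then OnePoint.some (state x ω h.choose) else OnePoint.infty

lemma arrival_succ (ω : Driver S) (n : ℕ) : arrival ω (n + 1) = arrival ω n + (ω n).1 :=
  Finset.sum_range_succ _ _

lemma arrival_mono (ω : Driver S) : Monotone (arrival ω) :=
  monotone_nat_of_le_succ fun n => by rw [arrival_succ]; exact le_self_add

lemma arrival_seqCons (a : ℝ≥0 × (S → S)) (ω : Driver S) (n : ℕ) :
    arrival (seqCons a ω) (n + 1) = a.1 + arrival ω n := by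
  rw [arrival, Finset.sum_range_succ', add_comm]; rfl

lemma state_seqCons (x : S) (a : ℝ≥0 × (S → S)) (ω : Driver S) (n : ℕ) :
    state x (seqCons a ω) (n + 1) = state (a.2 x) ω n := by
  induction n with
  | zero => rfl
  | succ n ih => rw [state, ih]; rfl

lemma count_unique {t : ℝ≥0} {m n : ℕ} {ω : Driver S} (hm : ω ∈ count t m) (hn : ω ∈ count t n) :
    m = n := by
  by_contra h
  rcases lt_or_gt_of_ne h with h | h
  · exact absurd ((arrival_mono ω h).trans hn.1) (not_le.2 hm.2)
  · exact absurd ((arrival_mono ω h).trans hm.1) (not_le.2 hn.2)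

lemma arrival_le_of_forall_notMem {t : ℝ≥0} {ω : Driver S} (h : ∀ n, ω ∉ count t n) (n : ℕ) :
    arrival ω n ≤ t := by
  induction n with
  | zero => simp [arrival]
  | succ n ih => exact not_lt.1 fun h' => h n ⟨ih, h'⟩

lemma path_of_mem {t : ℝ≥0} {n : ℕ} {ω : Driver S} (x : S) (h : ω ∈ count t n) :
    path x t ω = OnePoint.some (state x ω n) := by
  have h' : ∃ n, ω ∈ count t n := ⟨n, h⟩
  rw [path, dif_pos h', count_unique h'.choose_spec h]

lemma path_of_forall_le {t : ℝ≥0} {ω : Driver S} (x : S) (h : ∀ n, arrival ω n ≤ t) :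
    path x t ω = OnePoint.infty :=
  dif_neg fun ⟨n, hn⟩ => absurd (h (n + 1)) (not_le.2 hn.2)

lemma mem_count_zero {t : ℝ≥0} {ω : Driver S} : ω ∈ count t 0 ↔ t < (ω 0).1 := by
  simp [count, arrival]

lemma seqCons_mem_count {t : ℝ≥0} {n : ℕ} {a : ℝ≥0 × (S → S)} {ω : Driver S} :
    seqCons a ω ∈ count t (n + 1) ↔ a.1 ≤ t ∧ ω ∈ count (t - a.1) n := by
  simp only [count, mem_ofPred_eq, arrival_seqCons]
  constructor
  · rintro ⟨h1, h2⟩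
    have ha : a.1 ≤ t := le_self_add.trans h1
    exact ⟨ha, (le_tsub_iff_left ha).2 h1, (tsub_lt_iff_left ha).2 h2⟩
  · rintro ⟨ha, h1, h2⟩
    exact ⟨(le_tsub_iff_left ha).1 h1, (tsub_lt_iff_left ha).1 h2⟩

lemma path_seqCons_of_lt {t : ℝ≥0} {a : ℝ≥0 × (S → S)} (h : t < a.1) (x : S) (ω : Driver S) :
    path x t (seqCons a ω) = (x : OnePoint S) :=
  path_of_mem x (mem_count_zero.2 h)

lemma path_seqCons_of_le {t : ℝ≥0} {a : ℝ≥0 × (S → S)} (h : a.1 ≤ t) (x : S) (ω : Driver S) :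
    path x t (seqCons a ω) = path (a.2 x) (t - a.1) ω := by
  by_cases hn : ∃ n, ω ∈ count (t - a.1) n
  · obtain ⟨n, hn⟩ := hn
    rw [path_of_mem _ hn, path_of_mem _ (seqCons_mem_count.2 ⟨h, hn⟩), state_seqCons]
  · have h1 := arrival_le_of_forall_notMem (not_exists.1 hn)
    rw [path_of_forall_le _ h1, path_of_forall_le]
    intro n
    cases n with
    | zero => simp [arrival]
    | succ n => rw [arrival_seqCons]; exact (le_tsub_iff_left h).1 (h1 n)

lemma path_eq_infty_of_le {x : S} {ω : Driver S} {s t : ℝ≥0} (hst : s ≤ t)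
    (h : path x s ω = OnePoint.infty) : path x t ω = OnePoint.infty := by
  refine path_of_forall_le x fun n => (arrival_le_of_forall_notMem (fun m hm => ?_) n).trans hst
  rw [path_of_mem x hm] at h
  exact OnePoint.coe_ne_infty _ h

lemma continuousWithinAt_path [TopologicalSpace S] (x : S) (ω : Driver S) (t : ℝ≥0) :
    ContinuousWithinAt (fun s => path x s ω) (Ici t) t := by
  by_cases hn : ∃ n, ω ∈ count t n
  · obtain ⟨n, hn⟩ := hn
    refine (continuousWithinAt_const (b := OnePoint.some (state x ω n))).congr_of_eventuallyEq ?_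
      (path_of_mem x hn)
    filter_upwards [self_mem_nhdsWithin, mem_nhdsWithin_of_mem_nhds (Iio_mem_nhds hn.2)]
      with s hs hs'
    exact path_of_mem x ⟨hn.1.trans hs, hs'⟩
  · have h := path_of_forall_le x (arrival_le_of_forall_notMem (not_exists.1 hn))
    exact (continuousWithinAt_const (b := OnePoint.infty)).congr
      (fun s hs => path_eq_infty_of_le hs h) h

variable [MeasurableSpace S]

lemma measurable_arrival (n : ℕ) : Measurable fun ω : Driver S => arrival ω n := by
  unfold arrival; fun_prop

lemma measurableSet_count (t : ℝ≥0) (n : ℕ) : MeasurableSet (count t n : Set (Driver S)) := by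
  have h : MeasurableSet {ω : Driver S | t < arrival ω (n + 1)} :=
    measurableSet_lt measurable_const (measurable_arrival (n + 1))
  exact (measurableSet_le (measurable_arrival n) measurable_const).inter h

variable [Countable S] [MeasurableSingletonClass S]

lemma measurable_state (x : S) (n : ℕ) : Measurable fun ω : Driver S => state x ω n := by
  induction n with
  | zero => exact measurable_const
  | succ n ih =>
    have h : Measurable fun p : (S → S) × S => p.1 p.2 :=
      measurable_from_prod_countable_left fun y => measurable_pi_apply y
    exact h.comp ((measurable_snd.comp (measurable_pi_apply n)).prodMk ih)

variable [TopologicalSpace S]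

lemma measurable_path (x : S) (t : ℝ≥0) : Measurable (path x t : Driver S → OnePoint S) := by
  classical
  have h : ∀ y : S, MeasurableSet (path x t ⁻¹' {(y : OnePoint S)}) := fun y => by
    have : path x t ⁻¹' {(y : OnePoint S)} =
        ⋃ n, count t n ∩ {ω : Driver S | state x ω n = y} := by
      ext ω
      simp only [mem_preimage, mem_singleton_iff, mem_iUnion, mem_inter_iff, mem_ofPred_eq]
      constructor
      · intro h
        by_cases hn : ∃ n, ω ∈ count t n
        · obtain ⟨n, hn⟩ := hn
          rw [path_of_mem x hn] at h
          exact ⟨n, hn, OnePoint.coe_injective h⟩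
        · rw [path_of_forall_le x (arrival_le_of_forall_notMem (not_exists.1 hn))] at h
          exact absurd h (OnePoint.infty_ne_coe y)
      · rintro ⟨n, hn, rfl⟩
        exact path_of_mem x hn
    rw [this]
    exact MeasurableSet.iUnion fun n =>
      (measurableSet_count t n).inter (measurable_state x n (measurableSet_singleton y))
  refine measurable_to_countable' fun y => ?_
  induction y using OnePoint.rec with
  | coe y => exact h y
  | infty =>
    have : path x t ⁻¹' {(OnePoint.infty : OnePoint S)} =
        (⋃ y : S, path x t ⁻¹' {(y : OnePoint S)})ᶜ := by
      ext ω
      have h2 := OnePoint.ne_infty_iff_exists (x := path x t ω)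
      simp only [mem_preimage, mem_singleton_iff, mem_compl_iff, mem_iUnion]
      simp only [eq_comm (a := path x t ω)] at h2 ⊢
      rw [← h2, not_ne_iff, eq_comm]
    rw [this]
    exact (MeasurableSet.iUnion h).compl

end Driver

namespace Network

open Driver

variable {S : Type*} (N : Network S) [MeasurableSpace S]

/-- The law of one term of the driving sequence: an exponential time, and independent jumps from
all the states. -/
noncomputable def stepLaw : Measure (ℝ≥0 × (S → S)) :=
  (expLaw N.speed).prod (Measure.infinitePi N.jump)

/-- The law of the driving sequence. -/
noncomputable def driverLaw : Measure (Driver S) := Measure.infinitePi fun _ => N.stepLaw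

variable {N}

instance : IsProbabilityMeasure (expLaw N.speed) := isProbabilityMeasure_expLaw N.speed_pos

instance (x : S) : IsProbabilityMeasure (N.jump x) := isProbabilityMeasure_jump x

instance : IsProbabilityMeasure N.stepLaw := by unfold stepLaw; infer_instance

instance : IsProbabilityMeasure N.driverLaw := by unfold driverLaw; infer_instance

lemma lintegral_driver {F : Driver S → ℝ≥0∞} (hF : Measurable F) :
    ∫⁻ ω, F ω ∂N.driverLaw = ∫⁻ a, ∫⁻ ω, F (seqCons a ω) ∂N.driverLaw ∂N.stepLaw :=
  lintegral_seqCons N.stepLaw hF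

variable [Countable S] [MeasurableSingletonClass S]

lemma lintegral_step (g : ℝ≥0 → ℝ≥0∞) (hg : Measurable g) (f : S → ℝ≥0∞) (x : S) :
    ∫⁻ a, g a.1 * f (a.2 x) ∂N.stepLaw = (∫⁻ r, g r ∂expLaw N.speed) * N.eaverage f x := by
  have hf : Measurable fun φ : S → S => f (φ x) :=
    Measurable.of_discrete.comp (measurable_pi_apply x)
  rw [stepLaw, lintegral_prod_mul hg.aemeasurable hf.aemeasurable, eaverage,
    ← Measure.infinitePi_map_eval N.jump x, lintegral_map Measurable.of_discrete
      (measurable_pi_apply x)]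

/-- On the event of exactly `n` jumps up to time `t`, the walk at time `t` has law
`Q^n(x, ·)`, and the number of jumps has the Poisson law. -/
lemma lintegral_count (f : S → ℝ≥0∞) (n : ℕ) : ∀ (t : ℝ≥0) (x : S),
    ∫⁻ ω in count t n, f (state x ω n) ∂N.driverLaw =
      ENNReal.ofReal (poissonWeight N.speed t n) * N.eaverage^[n] f x := by
  classical
  have hmeas : ∀ n t x, Measurable ((count t n).indicator fun ω : Driver S => f (state x ω n)) :=
    fun n t x => (Measurable.of_discrete.comp (measurable_state x n)).indicator
      (measurableSet_count t n)
  induction n with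
  | zero =>
    intro t x
    rw [← lintegral_indicator (measurableSet_count t 0), lintegral_driver (hmeas 0 t x)]
    have h : ∀ (a : ℝ≥0 × (S → S)) (ω : Driver S),
        (count t 0).indicator (fun ω : Driver S => f (state x ω 0)) (seqCons a ω) =
          (Ioi t).indicator (fun _ => f x) a.1 * 1 := fun a ω => by
      simp only [indicator_apply, mem_count_zero, mem_Ioi, mul_one]; rfl
    simp only [h, lintegral_const, measure_univ, mul_one]
    have h2 := lintegral_step (N := N) ((Ioi t).indicator fun _ => f x)
      (measurable_const.indicator measurableSet_Ioi) (fun _ => 1) x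
    simp only [mul_one] at h2
    rw [h2, lintegral_indicator measurableSet_Ioi, setLIntegral_const, expLaw_Ioi N.speed_pos,
      eaverage, lintegral_one, measure_univ]
    simp [poissonWeight, mul_comm]
  | succ n ih =>
    intro t x
    rw [← lintegral_indicator (measurableSet_count t _), lintegral_driver (hmeas _ t x)]
    have h : ∀ a : ℝ≥0 × (S → S), ∫⁻ ω, (count t (n + 1)).indicator
        (fun ω : Driver S => f (state x ω (n + 1))) (seqCons a ω) ∂N.driverLaw =
          (Iic t).indicator (fun r => ENNReal.ofReal
            (poissonWeight N.speed ((t - r : ℝ≥0) : ℝ) n)) a.1 *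
            N.eaverage^[n] f (a.2 x) := fun a => by
      by_cases ha : a.1 ≤ t
      · rw [indicator_of_mem (by exact ha), ← ih, ← lintegral_indicator (measurableSet_count _ n)]
        congr 1 with ω
        simp only [indicator_apply, seqCons_mem_count, ha, true_and, state_seqCons]
      · rw [indicator_of_notMem (by simpa using ha), zero_mul]
        simp [seqCons_mem_count, ha]
    have hg : Measurable fun r : ℝ≥0 => ENNReal.ofReal
        (poissonWeight N.speed ((t - r : ℝ≥0) : ℝ) n) := by unfold poissonWeight; fun_prop
    simp only [h]
    rw [lintegral_step _ (hg.indicator measurableSet_Iic), lintegral_indicator measurableSet_Iic,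
      lintegral_poissonWeight N.speed_pos, Function.iterate_succ_apply']

lemma tsum_measure_count (x : S) (t : ℝ≥0) : ∑' n, N.driverLaw (count t n) = 1 := by
  have h1 : ∀ n, N.eaverage^[n] (fun _ => 1) = fun _ => 1 := fun n =>
    Function.iterate_fixed (by funext x; simp [eaverage]) n
  rw [← tsum_poissonWeight N.speed_pos t]
  congr 1 with n
  have := lintegral_count (N := N) (fun _ => 1) n t x
  simpa [h1] using this

end Network

/-! ### The Markov property of the walk -/

namespace Driver

variable {S : Type*} [TopologicalSpace S]

/-- The events that depend on the walk up to time `s` only. -/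
@[reducible]
noncomputable def past (x : S) (s : ℝ≥0) : MeasurableSpace (Driver S) :=
  ⨆ u : Iic s, MeasurableSpace.comap (path x u) inferInstance

lemma measurableSet_past {x : S} {s u : ℝ≥0} (hu : u ≤ s) {B : Set (OnePoint S)}
    (hB : MeasurableSet B) : MeasurableSet[past x s] (path x u ⁻¹' B) :=
  le_iSup (fun u : Iic s => MeasurableSpace.comap (path x u) inferInstance) ⟨u, hu⟩ _ ⟨B, hB, rfl⟩

/-- Past events, seen from the first jump on. If this jump takes place after time `s`, the remaining
time `s - a.1` is truncated to `0`. -/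
lemma measurableSet_past_seqCons {x : S} {s : ℝ≥0} {A : Set (Driver S)}
    (hA : MeasurableSet[past x s] A) {a : ℝ≥0 × (S → S)} :
    MeasurableSet[past (a.2 x) (s - a.1)] (seqCons a ⁻¹' A) := by
  have h : past x s ≤ (past (a.2 x) (s - a.1)).map (seqCons a) := by
    refine iSup_le ?_
    rintro ⟨u, hu⟩ _ ⟨B, hB, rfl⟩
    change MeasurableSet[past (a.2 x) (s - a.1)] (seqCons a ⁻¹' (path x u ⁻¹' B))
    rcases lt_or_ge u a.1 with hua | hua
    · have : seqCons a ⁻¹' (path x u ⁻¹' B) = {_ω : Driver S | OnePoint.some x ∈ B} := by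
        ext ω; simp [path_seqCons_of_lt hua]
      rw [this]
      exact MeasurableSet.const _
    · have : seqCons a ⁻¹' (path x u ⁻¹' B) = path (a.2 x) (u - a.1) ⁻¹' B := by
        ext ω; simp [path_seqCons_of_le hua]
      rw [this]
      exact measurableSet_past (tsub_le_tsub_right hu _) hB
  exact h _ hA

/-- Before the first jump the past is trivial. -/
lemma mem_iff_of_measurableSet_past {x : S} {s : ℝ≥0} {A : Set (Driver S)}
    (hA : MeasurableSet[past x s] A) {ω ω' : Driver S} (h : ω ∈ count s 0) (h' : ω' ∈ count s 0) :
    ω ∈ A ↔ ω' ∈ A := by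
  let m : MeasurableSpace (Driver S) :=
    { MeasurableSet' := fun A => ∀ ω ∈ count s 0, ∀ ω' ∈ count s 0, (ω ∈ A ↔ ω' ∈ A)
      measurableSet_empty := by simp
      measurableSet_compl := fun A hA ω h ω' h' => not_congr (hA ω h ω' h')
      measurableSet_iUnion := fun A hA ω h ω' h' => by
        simp only [mem_iUnion]; exact exists_congr fun i => hA i ω h ω' h' }
  have hm : past x s ≤ m := by
    refine iSup_le ?_
    rintro ⟨u, hu⟩ _ ⟨B, hB, rfl⟩ ω h ω' h'
    have hp : ∀ ω ∈ count s 0, path x u ω = OnePoint.some x := fun ω h =>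
      path_of_mem x (mem_count_zero.2 (lt_of_le_of_lt hu (mem_count_zero.1 h)))
    simp only [mem_preimage, hp ω h, hp ω' h']
  exact hm _ hA ω h ω' h'

omit [TopologicalSpace S] in
lemma path_add_seqCons {x : S} {s t : ℝ≥0} {a : ℝ≥0 × (S → S)} (h : s < a.1) (ω : Driver S) :
    path x (s + t) (seqCons a ω) = path x t (seqCons (a.1 - s, a.2) ω) := by
  rcases lt_or_ge t (a.1 - s) with ht | ht
  · rw [path_seqCons_of_lt (a := (a.1 - s, a.2)) ht, path_seqCons_of_lt (lt_tsub_iff_left.1 ht)]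
  · rw [path_seqCons_of_le (a := (a.1 - s, a.2)) ht, path_seqCons_of_le (tsub_le_iff_left.1 ht)]
    congr 1
    rw [tsub_tsub_eq_add_tsub_of_le h.le, add_comm]

end Driver

namespace Network

open Driver

variable {S : Type*} {N : Network S} [MeasurableSpace S] [Countable S] [MeasurableSingletonClass S]

section

variable [TopologicalSpace S]

lemma past_le (x : S) (s : ℝ≥0) : past x s ≤ (inferInstance : MeasurableSpace (Driver S)) :=
  iSup_le fun u => (measurable_path x u).comap_le

omit [Countable S] [MeasurableSingletonClass S] [TopologicalSpace S] in
lemma driverLaw_apply {E : Set (Driver S)} (hE : MeasurableSet E) :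
    N.driverLaw E = ∫⁻ a, N.driverLaw (seqCons a ⁻¹' E) ∂N.stepLaw := by
  have hm : ∀ a : ℝ≥0 × (S → S), Measurable (seqCons a) := fun a =>
    measurable_seqCons.comp measurable_prodMk_left
  rw [← lintegral_indicator_one hE, lintegral_driver (measurable_one.indicator hE)]
  congr 1 with a
  rw [← lintegral_indicator_one (hm a hE)]
  rfl

omit [TopologicalSpace S] in
lemma driverLaw_count_zero (x : S) (s : ℝ≥0) :
    N.driverLaw (count s 0) = ENNReal.ofReal (Real.exp (-(N.speed * s))) := by
  simpa [poissonWeight] using lintegral_count (N := N) (fun _ => 1) 0 s x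

/-- The Markov property on the event that there is no jump up to time `s`. -/
lemma driverLaw_count_zero_inter (x : S) (s t : ℝ≥0) {B : Set (OnePoint S)}
    (hB : MeasurableSet B) :
    N.driverLaw (count s 0 ∩ path x (s + t) ⁻¹' B) =
      ENNReal.ofReal (Real.exp (-(N.speed * s))) * N.driverLaw (path x t ⁻¹' B) := by
  have hE := measurable_path x t hB
  set h : ℝ≥0 × (S → S) → ℝ≥0∞ := fun a => N.driverLaw (seqCons a ⁻¹' (path x t ⁻¹' B))
  have hh : Measurable h := measurable_measure_prodMk_left (measurable_seqCons hE)
  have hg : Measurable fun r => ∫⁻ φ, h (r, φ) ∂Measure.infinitePi N.jump :=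
    hh.lintegral_prod_right'
  have h1 : ∀ a, N.driverLaw (seqCons a ⁻¹' (count s 0 ∩ path x (s + t) ⁻¹' B)) =
      (Ioi s).indicator (fun r => h (r - s, a.2)) a.1 := fun a => by
    by_cases ha : s < a.1
    · rw [indicator_of_mem (by exact ha)]
      congr 1
      ext ω
      have : seqCons a ω ∈ count s 0 := mem_count_zero.2 ha
      simp only [mem_preimage, mem_inter_iff, this, true_and, path_add_seqCons ha]
    · rw [indicator_of_notMem (by exact ha)]
      refine measure_mono_null (fun ω hω => ?_) measure_empty
      exact ha (mem_count_zero.1 hω.1)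
  rw [driverLaw_apply ((measurableSet_count s 0).inter (measurable_path x (s + t) hB)),
    driverLaw_apply hE]
  simp only [h1]
  have hm : Measurable fun a : ℝ≥0 × (S → S) =>
      (Ioi s).indicator (fun r => h (r - s, a.2)) a.1 := by
    have h2 : Measurable fun a : ℝ≥0 × (S → S) => h (a.1 - s, a.2) := hh.comp (by fun_prop)
    exact h2.indicator (measurable_fst measurableSet_Ioi)
  rw [stepLaw, lintegral_prod _ hm.aemeasurable, lintegral_prod _ hh.aemeasurable,
    ← lintegral_expLaw_sub N.speed_pos s hg, ← lintegral_indicator measurableSet_Ioi]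
  congr 1 with r
  by_cases hr : r ∈ Ioi s <;> simp [hr]

/-- The Markov property on the event of exactly `n` jumps up to time `s`, by induction on `n`
through the first jump. -/
lemma driverLaw_count_inter (n : ℕ) : ∀ (x : S) (s t : ℝ≥0) (A : Set (Driver S)),
    MeasurableSet[past x s] A → ∀ B : Set (OnePoint S), MeasurableSet B →
      N.driverLaw (A ∩ count s n ∩ path x (s + t) ⁻¹' B) =
        ∫⁻ ω in A ∩ count s n, N.driverLaw (path (state x ω n) t ⁻¹' B) ∂N.driverLaw := by
  classical
  induction n with
  | zero =>
    intro x s t A hA B hB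
    rcases (A ∩ count s 0).eq_empty_or_nonempty with h | ⟨ω₀, h₀, h₀'⟩
    · simp [h]
    · have : A ∩ count s 0 = count s 0 := inter_eq_right.2 fun ω hω =>
        (mem_iff_of_measurableSet_past hA h₀' hω).1 h₀
      rw [this, driverLaw_count_zero_inter x s t hB]
      simp only [state]
      rw [setLIntegral_const, driverLaw_count_zero x, mul_comm]
  | succ n ih =>
    intro x s t A hA B hB
    have hA' := past_le x s _ hA
    have hE := hA'.inter (measurableSet_count s (n + 1))
    rw [driverLaw_apply (hE.inter (measurable_path x (s + t) hB)), ← lintegral_indicator hE,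
      lintegral_driver]
    · congr 1 with a
      by_cases ha : a.1 ≤ s
      · have hAa := measurableSet_past_seqCons (a := a) hA
        have h1 : seqCons a ⁻¹' (A ∩ count s (n + 1) ∩ path x (s + t) ⁻¹' B) =
            seqCons a ⁻¹' A ∩ count (s - a.1) n ∩ path (a.2 x) (s - a.1 + t) ⁻¹' B := by
          ext ω
          simp only [mem_preimage, mem_inter_iff, seqCons_mem_count, ha, true_and,
            path_seqCons_of_le (ha.trans le_self_add), tsub_add_eq_add_tsub ha]
        rw [h1, ih _ _ _ _ hAa _ hB,
          ← lintegral_indicator ((past_le _ _ _ hAa).inter (measurableSet_count _ n))]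
        congr 1 with ω
        simp only [indicator_apply, mem_inter_iff, mem_preimage, seqCons_mem_count, ha, true_and,
          state_seqCons]
      · have h1 : ∀ ω, seqCons a ω ∉ A ∩ count s (n + 1) := fun ω h =>
          ha (seqCons_mem_count.1 h.2).1
        simp only [indicator_of_notMem (h1 _), lintegral_zero]
        exact measure_mono_null (fun ω hω => h1 ω hω.1) measure_empty
    · exact (Measurable.of_discrete (f := fun y : S => N.driverLaw (path y t ⁻¹' B))).comp
        (measurable_state x _) |>.indicator hE

omit [TopologicalSpace S] in
lemma ae_exists_mem_count (x : S) (t : ℝ≥0) : ∀ᵐ ω ∂N.driverLaw, ω ∈ ⋃ n, count t n := by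
  have h : N.driverLaw (⋃ n, count t n) = 1 := by
    rw [measure_iUnion _ (measurableSet_count t), tsum_measure_count x t]
    exact fun m n hmn => disjoint_left.2 fun ω hm hn => hmn (count_unique hm hn)
  exact (mem_ae_iff_prob_eq_one (MeasurableSet.iUnion (measurableSet_count t))).2 h

omit [TopologicalSpace S] in
lemma setLIntegral_eq_tsum_count (x : S) (t : ℝ≥0) {A : Set (Driver S)} (hA : MeasurableSet A)
    (F : Driver S → ℝ≥0∞) :
    ∫⁻ ω in A, F ω ∂N.driverLaw = ∑' n, ∫⁻ ω in A ∩ count t n, F ω ∂N.driverLaw := by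
  rw [← lintegral_iUnion (fun n => hA.inter (measurableSet_count t n))
    (fun m n hmn => disjoint_left.2 fun ω hm hn => hmn (count_unique hm.2 hn.2)),
    ← inter_iUnion]
  refine setLIntegral_congr ?_
  filter_upwards [ae_exists_mem_count x t] with ω hω
  exact propext ⟨fun h => ⟨h, hω⟩, fun h => h.1⟩

lemma driverLaw_markov (x : S) (s t : ℝ≥0) {A : Set (Driver S)} (hA : MeasurableSet[past x s] A)
    {B : Set (OnePoint S)} (hB : MeasurableSet B) :
    N.driverLaw (A ∩ path x (s + t) ⁻¹' B) = ∫⁻ ω in A,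
      (path x s ω).elim (indicator B 1 OnePoint.infty)
        (fun y => N.driverLaw (path y t ⁻¹' B)) ∂N.driverLaw := by
  have hA' := past_le x s _ hA
  have hE := hA'.inter (measurable_path x (s + t) hB)
  rw [setLIntegral_eq_tsum_count x s hA', ← setLIntegral_one, setLIntegral_eq_tsum_count x s hE]
  congr 1 with n
  rw [setLIntegral_one, inter_right_comm, driverLaw_count_inter n x s t A hA B hB]
  refine setLIntegral_congr_fun (hA'.inter (measurableSet_count s n)) fun ω hω => ?_
  simp only [path_of_mem x hω.2, OnePoint.elim_some]

/-- The law of the starting point and the driving sequence, which are independent. -/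
noncomputable def walkLaw (N : Network S) : Kernel (OnePoint S) (OnePoint S × Driver S) :=
  Kernel.id ×ₖ Kernel.const _ N.driverLaw

instance : IsMarkovKernel N.walkLaw := by unfold walkLaw; infer_instance

omit [MeasurableSingletonClass S] [Countable S] in
lemma walkLaw_eq_map (x : OnePoint S) : N.walkLaw x = N.driverLaw.map (Prod.mk x) := by
  rw [walkLaw, Kernel.prod_apply, Kernel.id_apply, Kernel.const_apply, Measure.dirac_prod]

omit [MeasurableSingletonClass S] [Countable S] in
lemma walkLaw_apply (x : OnePoint S) {E : Set (OnePoint S × Driver S)} (hE : MeasurableSet E) :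
    N.walkLaw x E = N.driverLaw (Prod.mk x ⁻¹' E) := by
  rw [walkLaw_eq_map, Measure.map_apply measurable_prodMk_left hE]

/-- The position of the walk, as a function of the starting point and the driving sequence. -/
noncomputable def position (t : ℝ≥0) (ω : OnePoint S × Driver S) : OnePoint S :=
  ω.1.elim OnePoint.infty fun x => path x t ω.2

variable [DiscreteTopology S]

lemma measurable_position (t : ℝ≥0) :
    Measurable (position t : OnePoint S × Driver S → OnePoint S) := by
  refine measurable_from_prod_countable_right fun x => ?_
  induction x using OnePoint.rec with
  | infty => exact measurable_const
  | coe x => exact measurable_path x t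

/-- The walk as a Markov process. -/
noncomputable def walk (N : Network S) : MarkovProcess S (OnePoint S × Driver S) where
  X := position
  P := N.walkLaw
  isMarkovKernel := inferInstance
  measurable_X := measurable_position
  start x := by
    have hm : MeasurableSet {ω : OnePoint S × Driver S | position 0 ω = x} :=
      measurable_position 0 (measurableSet_singleton x)
    rw [walkLaw_eq_map, ae_map_iff measurable_prodMk_left.aemeasurable hm]
    induction x using OnePoint.rec with
    | infty => exact ae_of_all _ fun _ => rfl
    | coe x =>
      have h : ∀ᵐ ω ∂N.driverLaw, ω ∈ (count 0 0 : Set (Driver S)) :=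
        (mem_ae_iff_prob_eq_one (measurableSet_count 0 0)).2 (by simp [driverLaw_count_zero x])
      filter_upwards [h] with ω hω using path_of_mem x hω
  absorbing ω s t hst h := by
    obtain ⟨x, ω⟩ := ω
    induction x using OnePoint.rec with
    | infty => rfl
    | coe x => exact path_eq_infty_of_le hst h
  right_continuous ω t := by
    obtain ⟨x, ω⟩ := ω
    induction x using OnePoint.rec with
    | infty => exact continuousWithinAt_const
    | coe x => exact continuousWithinAt_path x ω t
  markov x s t A hA B hB := by
    have hA' : MeasurableSet A :=
      (iSup_le fun u : Iic s => (measurable_position (S := S) u).comap_le) A hA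
    have hX := measurable_position (S := S) (s + t) hB
    rw [walkLaw_apply x (hA'.inter hX), walkLaw_eq_map x, ← lintegral_indicator hA',
      lintegral_map _ measurable_prodMk_left]
    · have h1 : ∀ y : OnePoint S, N.walkLaw y (position t ⁻¹' B) =
          y.elim (indicator B 1 OnePoint.infty) fun y => N.driverLaw (path y t ⁻¹' B) := by
        intro y
        rw [walkLaw_apply y (measurable_position t hB)]
        induction y using OnePoint.rec with
        | infty =>
          change N.driverLaw {ω : Driver S | OnePoint.infty ∈ B} = _
          by_cases hB' : OnePoint.infty ∈ B <;> simp [hB']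
        | coe y => rfl
      simp only [h1]
      change _ = ∫⁻ ω, (Prod.mk x ⁻¹' A).indicator (fun ω => (position s (x, ω)).elim _ _) ω
        ∂N.driverLaw
      rw [lintegral_indicator (measurable_prodMk_left hA')]
      induction x using OnePoint.rec with
      | infty =>
        change N.driverLaw (Prod.mk OnePoint.infty ⁻¹' A ∩ {ω : Driver S | OnePoint.infty ∈ B}) =
          ∫⁻ ω in Prod.mk OnePoint.infty ⁻¹' A, indicator B 1 OnePoint.infty ∂N.driverLaw
        by_cases hB' : OnePoint.infty ∈ B <;> simp [hB']
      | coe x =>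
        have hAx : MeasurableSet[past x s] (Prod.mk (OnePoint.some x) ⁻¹' A) := by
          have h : (⨆ u : Iic s, MeasurableSpace.comap (position (S := S) u) inferInstance) ≤
              (past x s).map (Prod.mk (OnePoint.some x)) := by
            refine iSup_le ?_
            rintro ⟨u, hu⟩ _ ⟨B, hB, rfl⟩
            exact measurableSet_past hu hB
          exact h A hA
        exact driverLaw_markov x s t hAx hB
    · refine Measurable.indicator ?_ hA'
      exact (Measurable.of_discrete
        (f := fun y : OnePoint S => N.walkLaw y (position t ⁻¹' B))).comp (measurable_position s)

lemma transition_walk (t : ℝ≥0) (f : S → ℝ) (x : S) :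
    N.walk.transition t f x = ∫ ω, (path x t ω).elim 0 f ∂N.driverLaw := by
  have h : Measurable fun ω : OnePoint S × Driver S => (position t ω).elim 0 f :=
    (Measurable.of_discrete (f := fun y : OnePoint S => y.elim 0 f)).comp (measurable_position t)
  change ∫ ω, (position t ω).elim 0 f ∂N.walkLaw (OnePoint.some x) = _
  rw [walkLaw_eq_map, integral_map measurable_prodMk_left.aemeasurable h.aestronglyMeasurable]
  rfl

lemma integrable_elim_path (t : ℝ≥0) {f : S → ℝ} (hb : ∃ C, ∀ x, |f x| ≤ C) (x : S) :
    Integrable (fun ω => (path x t ω).elim 0 f) N.driverLaw := by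
  obtain ⟨C, hC⟩ := hb
  have h : Measurable fun ω : Driver S => (path x t ω).elim 0 f :=
    (Measurable.of_discrete (f := fun y : OnePoint S => y.elim 0 f)).comp (measurable_path x t)
  refine Integrable.of_bound h.aestronglyMeasurable |C| (ae_of_all _ fun ω => ?_)
  induction path x t ω using OnePoint.rec with
  | infty => simp
  | coe y => exact (hC y).trans (le_abs_self C)

lemma semigroup_eq_transition_of_nonneg (t : ℝ≥0) (f : S → ℝ) (hf : MemLp f 2 N.measure)
    (h0 : ∀ x, 0 ≤ f x) (hb : ∃ C, ∀ x, |f x| ≤ C) (x : S) :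
    N.semigroup t (hf.toLp f) x = N.walk.transition t f x := by
  have h1 := ofReal_semigroup t.coe_nonneg (f := hf.toLp f) (by rwa [coe_toLp]) x
  rw [coe_toLp] at h1
  rw [← ENNReal.toReal_ofReal h1.1, h1.2, transition_walk,
    integral_eq_lintegral_of_nonneg_ae _ (integrable_elim_path t hb x).aestronglyMeasurable]
  · congr 1
    rw [← setLIntegral_univ, setLIntegral_eq_tsum_count x t MeasurableSet.univ]
    congr 1 with n
    rw [univ_inter, ← lintegral_count]
    refine (setLIntegral_congr_fun (measurableSet_count t n) fun ω hω => ?_).symm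
    simp only [path_of_mem x hω, OnePoint.elim_some]
  · refine ae_of_all _ fun ω => ?_
    change 0 ≤ (path x t ω).elim 0 f
    induction path x t ω using OnePoint.rec with
    | infty => exact le_rfl
    | coe y => exact h0 y

/-- The walk is associated with the energy form. -/
lemma walk_isAssociatedWith :
    N.walk.IsAssociatedWith N.measure ⊤ fun f g => N.energy f g := by
  refine ⟨fun t => N.semigroup t, isSemigroupOfForm, fun t f hf _ hb => ae_of_all _ fun x => ?_⟩
  have hb1 : ∃ C, ∀ x, |max (f x) 0| ≤ C := by
    obtain ⟨C, hC⟩ := hb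
    refine ⟨C, fun x => (abs_max_le_max_abs_abs).trans (max_le (hC x) ?_)⟩
    simpa using (abs_nonneg _).trans (hC x)
  have hb2 : ∃ C, ∀ x, |max (-f x) 0| ≤ C := by
    obtain ⟨C, hC⟩ := hb
    refine ⟨C, fun x => (abs_max_le_max_abs_abs).trans (max_le (by rw [abs_neg]; exact hC x) ?_)⟩
    simpa using (abs_nonneg _).trans (hC x)
  have h1 : MemLp (fun x => max (f x) 0) 2 N.measure := hf.pos_part
  have h2 : MemLp (fun x => max (-f x) 0) 2 N.measure := hf.neg_part
  have h3 : hf.toLp f = h1.toLp _ - h2.toLp _ := by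
    rw [← MemLp.toLp_sub]
    refine MemLp.toLp_congr _ _ (ae_of_all _ fun x => ?_)
    exact (max_zero_sub_max_neg_zero_eq_self (f x)).symm
  rw [h3, map_sub, coe_sub, Pi.sub_apply,
    semigroup_eq_transition_of_nonneg t _ h1 (fun x => le_max_right _ _) hb1,
    semigroup_eq_transition_of_nonneg t _ h2 (fun x => le_max_right _ _) hb2,
    transition_walk, transition_walk, transition_walk,
    ← integral_sub (integrable_elim_path t hb1 x) (integrable_elim_path t hb2 x)]
  congr 1 with ω
  induction path x t ω using OnePoint.rec with
  | infty => simp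
  | coe y => exact max_zero_sub_max_neg_zero_eq_self (f y)

end

end Network

/-! ### The jumps of a right-continuous path, and their approximation along grids -/

namespace StepPath

variable {S : Type*}

/-- The jump times of a path: `jumpTime X (n + 1)` is the first time after `jumpTime X n` at which
the path is in another state, and the junk value `0` if there is no such time. -/
noncomputable def jumpTime (X : ℝ≥0 → OnePoint S) : ℕ → ℝ≥0
  | 0 => 0
  | n + 1 => sInf {u | jumpTime X n ≤ u ∧ X u ≠ X (jumpTime X n)}

/-- The path visits the states `y 0, …, y n` of `S`, in this order, and its holding time in `y i`
exceeds `t i` for `i < n`. -/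
def Visits (X : ℝ≥0 → OnePoint S) (y : ℕ → S) (t : ℕ → ℝ≥0) (n : ℕ) : Prop :=
  (∀ i ≤ n, X (jumpTime X i) = OnePoint.some (y i)) ∧
    ∀ i < n, jumpTime X i + t i < jumpTime X (i + 1)

/-- The analogue of `Visits` for the path observed at the times `0, h, 2h, …`: the state `y n` is
entered at the time `j * h`, after stays in the previous states `y i` during which the path is
observed at least `⌈t i / h⌉ + 1` times in `y i`. -/
def GridVisits (h : ℝ≥0) (X : ℝ≥0 → OnePoint S) (y : ℕ → S) (t : ℕ → ℝ≥0) : ℕ → ℕ → Prop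
  | 0, j => j = 0 ∧ X 0 = OnePoint.some (y 0)
  | n + 1, j => ∃ i m, j = i + (⌈t n / h⌉₊ + m) + 1 ∧ GridVisits h X y t n i ∧
      (∀ u ≤ ⌈t n / h⌉₊ + m, X ((i + u : ℕ) * h) = OnePoint.some (y n)) ∧
      X (j * h) = OnePoint.some (y (n + 1))

variable {X : ℝ≥0 → OnePoint S} {y : ℕ → S} {t : ℕ → ℝ≥0}

lemma GridVisits.apply {h : ℝ≥0} {n j : ℕ} (hj : GridVisits h X y t n j) :
    X (j * h) = OnePoint.some (y n) := by
  cases n with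
  | zero => obtain ⟨rfl, h0⟩ := hj; simpa using h0
  | succ n => obtain ⟨i, m, -, -, -, h⟩ := hj; exact h

lemma GridVisits.unique {h : ℝ≥0} {n : ℕ} (hy : ∀ i < n, y i ≠ y (i + 1)) : ∀ {j j' : ℕ},
    GridVisits h X y t n j → GridVisits h X y t n j' → j = j' := by
  induction n with
  | zero => rintro j j' ⟨rfl, -⟩ ⟨rfl, -⟩; rfl
  | succ n ih =>
    rintro _ _ ⟨i, m, rfl, hi, hs, hj⟩ ⟨i', m', rfl, hi', hs', hj'⟩
    obtain rfl := ih (fun i hi => hy i (hi.trans n.lt_succ_self)) hi hi'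
    have key : ∀ {m m' : ℕ}, m < m' →
        (∀ u ≤ ⌈t n / h⌉₊ + m', X ((i + u : ℕ) * h) = OnePoint.some (y n)) →
        X ((i + (⌈t n / h⌉₊ + m) + 1 : ℕ) * h) = OnePoint.some (y (n + 1)) → False := by
      intro m m' hm hs' hj
      have h1 := hs' (⌈t n / h⌉₊ + m + 1) (by omega)
      rw [← add_assoc, hj] at h1
      exact hy n n.lt_succ_self (OnePoint.coe_injective h1).symm
    rcases lt_trichotomy m m' with hm | rfl | hm
    · exact (key hm hs' hj).elim
    · rfl
    · exact (key hm hs hj').elim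

lemma Visits.mono {n m : ℕ} (h : Visits X y t n) (hm : m ≤ n) : Visits X y t m :=
  ⟨fun i hi => h.1 i (hi.trans hm), fun i hi => h.2 i (hi.trans_le hm)⟩

lemma visits_succ {n : ℕ} : Visits X y t (n + 1) ↔ Visits X y t n ∧
    X (jumpTime X (n + 1)) = OnePoint.some (y (n + 1)) ∧
      jumpTime X n + t n < jumpTime X (n + 1) := by
  constructor
  · exact fun h => ⟨h.mono n.le_succ, h.1 _ le_rfl, h.2 n n.lt_succ_self⟩
  · rintro ⟨h, h1, h2⟩
    refine ⟨fun i hi => ?_, fun i hi => ?_⟩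
    · rcases Nat.le_succ_iff.1 hi with hi | rfl
      exacts [h.1 i hi, h1]
    · rcases Nat.lt_succ_iff_lt_or_eq.1 hi with hi | rfl
      exacts [h.2 i hi, h2]

lemma apply_eq_of_lt_jumpTime {n : ℕ} {u : ℝ≥0} (h1 : jumpTime X n ≤ u)
    (h2 : u < jumpTime X (n + 1)) : X u = X (jumpTime X n) := by
  by_contra h
  exact notMem_of_lt_csInf h2 (OrderBot.bddBelow _) ⟨h1, h⟩

variable [TopologicalSpace S] [DiscreteTopology S]

lemma exists_eq_of_continuousWithinAt {r : ℝ≥0} {a : S}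
    (hr : ContinuousWithinAt X (Ici r) r) (ha : X r = OnePoint.some a) :
    ∃ δ > 0, ∀ u, r ≤ u → u < r + δ → X u = OnePoint.some a := by
  have h1 : ({OnePoint.some a} : Set (OnePoint S)) ∈ 𝓝 (X r) := by
    rw [ha]
    refine IsOpen.mem_nhds ?_ rfl
    simpa using OnePoint.isOpenEmbedding_coe.isOpenMap {a} (isOpen_discrete _)
  obtain ⟨v, hv, hv'⟩ := mem_nhdsGE_iff_exists_Ico_subset.1 (hr h1)
  refine ⟨v - r, tsub_pos_of_lt hv, fun u hu hu' => ?_⟩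
  rw [add_tsub_cancel_of_le (le_of_lt hv)] at hu'
  exact hv' ⟨hu, hu'⟩

/-- The first exit from a state that is left at all: the infimum is attained. -/
lemma jumpTime_succ_of_exists (hX : ∀ r, ContinuousWithinAt X (Ici r) r) {n : ℕ} {a : S}
    (ha : X (jumpTime X n) = OnePoint.some a)
    (he : ∃ u, jumpTime X n ≤ u ∧ X u ≠ X (jumpTime X n)) :
    jumpTime X n < jumpTime X (n + 1) ∧ X (jumpTime X (n + 1)) ≠ X (jumpTime X n) := by
  set s := jumpTime X (n + 1)
  have hne : {u | jumpTime X n ≤ u ∧ X u ≠ X (jumpTime X n)}.Nonempty := he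
  have h1 : jumpTime X n ≤ s := le_csInf hne fun u hu => hu.1
  have h2 : X s ≠ X (jumpTime X n) := by
    intro h
    obtain ⟨δ, hδ, hc⟩ := exists_eq_of_continuousWithinAt (hX s) (h.trans ha)
    obtain ⟨u, hu, hu'⟩ := exists_lt_of_csInf_lt hne (show s < s + δ from lt_add_of_pos_right s hδ)
    exact hu.2 ((hc u (csInf_le (OrderBot.bddBelow _) hu) hu').trans ha.symm)
  refine ⟨lt_of_le_of_ne h1 fun h => h2 (by rw [← h]), h2⟩

omit [TopologicalSpace S] [DiscreteTopology S] in
lemma exists_of_jumpTime_lt {n : ℕ} (h : jumpTime X n < jumpTime X (n + 1)) :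
    ∃ u, jumpTime X n ≤ u ∧ X u ≠ X (jumpTime X n) := by
  by_contra he
  have h0 : {u | jumpTime X n ≤ u ∧ X u ≠ X (jumpTime X n)} = ∅ :=
    eq_empty_iff_forall_notMem.2 fun u hu => he ⟨u, hu⟩
  rw [jumpTime, h0, NNReal.sInf_empty] at h
  exact not_lt_bot h

lemma Visits.ne (hX : ∀ r, ContinuousWithinAt X (Ici r) r) {n : ℕ} (h : Visits X y t n) {i : ℕ}
    (hi : i < n) : y i ≠ y (i + 1) := by
  have h1 : jumpTime X i < jumpTime X (i + 1) := le_self_add.trans_lt (h.2 i hi)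
  have h2 := (jumpTime_succ_of_exists hX (h.1 i hi.le) (exists_of_jumpTime_lt h1)).2
  rw [h.1 i hi.le, h.1 (i + 1) hi] at h2
  exact fun h => h2 (by rw [h])

lemma exists_grid_point {h : ℝ≥0} (hh : 0 < h) (s : ℝ≥0) :
    ∃ j : ℕ, s ≤ j * h ∧ (j : ℝ≥0) * h < s + h := by
  refine ⟨⌈s / h⌉₊, (div_le_iff₀ hh).1 (Nat.le_ceil _), ?_⟩
  calc (⌈s / h⌉₊ : ℝ≥0) * h < (s / h + 1) * h :=
        mul_lt_mul_of_pos_right (Nat.ceil_lt_add_one zero_le) hh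
    _ = s + h := by rw [add_mul, div_mul_cancel₀ _ hh.ne', one_mul]

/-- As the mesh of the grid tends to `0`, the observed jumps of a right-continuous path with an
absorbing cemetery eventually are its jumps. The stays at `y i` are required to exceed `t i` by
one mesh, whence the equivalence also for holding times that are equal to `t i`. -/
lemma eventually_gridVisits (hX : ∀ r, ContinuousWithinAt X (Ici r) r)
    (hA : ∀ s u, s ≤ u → X s = OnePoint.infty → X u = OnePoint.infty) (n : ℕ)
    (hy : ∀ i < n, y i ≠ y (i + 1)) :
    (Visits X y t n → ∀ᶠ h in 𝓝[>] (0 : ℝ≥0), ∃ j : ℕ, GridVisits h X y t n j ∧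
      jumpTime X n ≤ j * h ∧ (j : ℝ≥0) * h < jumpTime X n + h) ∧
    (¬ Visits X y t n → ∀ᶠ h in 𝓝[>] (0 : ℝ≥0), ∀ j, ¬ GridVisits h X y t n j) := by
  induction n with
  | zero =>
    constructor
    · intro h
      filter_upwards [self_mem_nhdsWithin] with δ hδ
      exact ⟨0, ⟨rfl, h.1 0 le_rfl⟩, by simp [jumpTime], by simpa [jumpTime] using hδ⟩
    · intro h
      refine Eventually.of_forall fun δ j hj => h ⟨fun i hi => ?_, fun i hi => by omega⟩
      obtain rfl : i = 0 := by omega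
      exact hj.2
  | succ n ih =>
    obtain ⟨ih1, ih2⟩ := ih fun i hi => hy i (hi.trans n.lt_succ_self)
    have hlt : ∀ {δ : ℝ≥0}, 0 < δ → ∀ᶠ h in 𝓝[>] (0 : ℝ≥0), h < δ := fun hδ =>
      mem_nhdsWithin_of_mem_nhds (Iio_mem_nhds hδ)
    constructor
    · intro hV
      obtain ⟨hV', hs, hrs⟩ := visits_succ.1 hV
      set r := jumpTime X n
      set s := jumpTime X (n + 1)
      obtain ⟨δ, hδ, hc⟩ := exists_eq_of_continuousWithinAt (hX s) hs
      have hgap : 0 < (s - (r + t n)) / 2 := div_pos (tsub_pos_of_lt hrs) two_pos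
      filter_upwards [ih1 hV', hlt hδ, hlt hgap, self_mem_nhdsWithin] with h hi h1 h2 h0
      obtain ⟨i, hi, hri, hir⟩ := hi
      obtain ⟨j, hsj, hjs⟩ := exists_grid_point h0 s
      have h3 : (r : ℝ) + t n + 2 * h < s := by
        have h4 : (h : ℝ) < ((s - (r + t n) : ℝ≥0) : ℝ) / 2 := by exact_mod_cast h2
        rw [NNReal.coe_sub hrs.le] at h4
        push_cast at h4; linarith
      have h0' : (0 : ℝ) < h := h0
      have hir' : (i : ℝ) * h < r + h := by exact_mod_cast hir
      have hri' : (r : ℝ) ≤ i * h := by exact_mod_cast hri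
      have hsj' : (s : ℝ) ≤ j * h := by exact_mod_cast hsj
      have hjs' : (j : ℝ) * h < s + h := by exact_mod_cast hjs
      have ht0 : (0 : ℝ) ≤ t n := (t n).coe_nonneg
      have hij : i + 1 ≤ j := by
        by_contra hij
        have : (j : ℝ) ≤ i := by exact_mod_cast (by omega : j ≤ i)
        nlinarith
      obtain ⟨m, rfl⟩ := Nat.exists_eq_add_of_le hij
      push_cast at hsj' hjs'
      have hm : ⌈t n / h⌉₊ ≤ m := by
        rw [Nat.ceil_le, div_le_iff₀ h0]
        have : (t n : ℝ) ≤ m * h := by nlinarith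
        exact_mod_cast this
      obtain ⟨m, rfl⟩ := Nat.exists_eq_add_of_le hm
      refine ⟨_, ⟨i, m, by ring, hi, fun u hu => ?_, hc _ hsj (hjs.trans ?_)⟩, hsj, hjs⟩
      · rw [← hV'.1 n le_rfl]
        refine apply_eq_of_lt_jumpTime (hri.trans ?_) ?_
        · gcongr; omega
        · have hu' : (u : ℝ) ≤ (⌈t n / h⌉₊ + m : ℕ) := by exact_mod_cast hu
          have : ((i + u : ℕ) : ℝ) * h < s := by push_cast at *; nlinarith
          exact_mod_cast this
      · exact add_lt_add_right h1 s
    · intro hV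
      by_cases hV' : Visits X y t n
      · have hXr := hV'.1 n le_rfl
        by_cases he : ∃ u, jumpTime X n ≤ u ∧ X u ≠ X (jumpTime X n)
        · obtain ⟨hrs, hXs⟩ := jumpTime_succ_of_exists hX hXr he
          have hin : ∀ u, jumpTime X n ≤ u → u < jumpTime X (n + 1) →
            X u = X (jumpTime X n) := fun u => apply_eq_of_lt_jumpTime
          have hnot : ¬ (X (jumpTime X (n + 1)) = OnePoint.some (y (n + 1)) ∧
              jumpTime X n + t n < jumpTime X (n + 1)) := fun h => hV (visits_succ.2 ⟨hV', h⟩)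
          generalize jumpTime X (n + 1) = s at *
          generalize jumpTime X n = r at *
          have hne : OnePoint.some (y (n + 1)) ≠ OnePoint.some (y n) := fun h =>
            hy n n.lt_succ_self (OnePoint.coe_injective h).symm
          -- for a small mesh the first observation after the exit sees the state `X s`
          have hδ : ∀ᶠ h in 𝓝[>] (0 : ℝ≥0), ∀ j : ℕ, s ≤ j * h → (j : ℝ≥0) * h < s + h →
              X (j * h) = X s := by
            rcases eq_or_ne (X s) OnePoint.infty with hs | hs
            · exact Eventually.of_forall fun h j hj _ => (hA s _ hj hs).trans hs.symm
            · obtain ⟨z, hz⟩ := OnePoint.ne_infty_iff_exists.1 hs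
              obtain ⟨δ, hδ, hc⟩ := exists_eq_of_continuousWithinAt (hX s) hz.symm
              filter_upwards [hlt hδ] with h h1 j hj hj'
              exact (hc _ hj (hj'.trans (add_lt_add_right h1 s))).trans hz
          filter_upwards [ih1 hV', hδ, hlt (tsub_pos_of_lt hrs), self_mem_nhdsWithin]
            with h hi hδ h1 h0 j hj
          obtain ⟨i, hi, hri, hir⟩ := hi
          obtain ⟨i', m, rfl, hi', hstay, hj⟩ := hj
          obtain rfl := hi'.unique (fun i hi => hy i (hi.trans n.lt_succ_self)) hi
          obtain ⟨j, hsj, hjs⟩ := exists_grid_point h0 s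
          have hXj := hδ j hsj hjs
          have h0' : (0 : ℝ) < h := h0
          have hir' : (i' : ℝ) * h < r + h := by exact_mod_cast hir
          have hri' : (r : ℝ) ≤ i' * h := by exact_mod_cast hri
          have hsj' : (s : ℝ) ≤ j * h := by exact_mod_cast hsj
          have hjs' : (j : ℝ) * h < s + h := by exact_mod_cast hjs
          have h1' : (r : ℝ) + h < s := by
            have : r + h < s := lt_tsub_iff_left.1 h1
            exact_mod_cast this
          have hij : i' < j := by
            by_contra hij
            have : (j : ℝ) ≤ i' := by exact_mod_cast (by omega : j ≤ i')
            nlinarith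
          have hle : s ≤ ((i' + (⌈t n / h⌉₊ + m) + 1 : ℕ) : ℝ≥0) * h := by
            by_contra hlt
            rw [hin _ (hri.trans (by gcongr; omega)) (not_le.1 hlt), hXr] at hj
            exact hne hj.symm
          have hle' : (s : ℝ) ≤ (i' + (⌈t n / h⌉₊ + m) + 1) * h := by exact_mod_cast hle
          have hj1 : j ≤ i' + (⌈t n / h⌉₊ + m) + 1 := by
            by_contra hjj
            have : (i' + (⌈t n / h⌉₊ + m) + 1 : ℝ) + 1 ≤ j := by
              exact_mod_cast (by omega : i' + (⌈t n / h⌉₊ + m) + 1 + 1 ≤ j)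
            nlinarith
          rcases Nat.lt_or_eq_of_le hj1 with hj2 | rfl
          · have h3 := hstay (j - i') (by omega)
            rw [Nat.add_sub_cancel' hij.le, hXj, ← hXr] at h3
            exact hXs h3
          · refine hnot ⟨hXj ▸ hj, ?_⟩
            have h4 : (t n : ℝ) ≤ ⌈t n / h⌉₊ * h := by
              have : t n ≤ ⌈t n / h⌉₊ * h := (div_le_iff₀ h0).1 (Nat.le_ceil _)
              exact_mod_cast this
            have h5 : (r : ℝ) + t n < s := by
              push_cast at hjs'
              have : (0 : ℝ) ≤ m * h := by positivity
              nlinarith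
            exact_mod_cast h5
        · filter_upwards [ih1 hV'] with h hi j hj
          obtain ⟨i, hi, hri, -⟩ := hi
          obtain ⟨i', m, rfl, hi', -, hj⟩ := hj
          obtain rfl := hi'.unique (fun i hi => hy i (hi.trans n.lt_succ_self)) hi
          refine he ⟨(i' + (⌈t n / h⌉₊ + m) + 1 : ℕ) * h, hri.trans ?_, ?_⟩
          · gcongr; omega
          · rw [hj, hXr]
            exact fun h => hy n n.lt_succ_self (OnePoint.coe_injective h).symm
      · filter_upwards [ih2 hV'] with h hi j hj
        obtain ⟨i, m, -, hi', -⟩ := hj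
        exact hi i hi'

/-- A path visits prescribed states if and only if it is eventually observed to do so. -/
lemma eventually_gridVisits_iff (hX : ∀ r, ContinuousWithinAt X (Ici r) r)
    (hA : ∀ s u, s ≤ u → X s = OnePoint.infty → X u = OnePoint.infty) (n : ℕ)
    (hy : ∀ i < n, y i ≠ y (i + 1)) :
    ∀ᶠ h in 𝓝[>] (0 : ℝ≥0), (∃ j, GridVisits h X y t n j) ↔ Visits X y t n := by
  by_cases h : Visits X y t n
  · filter_upwards [(eventually_gridVisits hX hA n hy).1 h] with δ ⟨j, hj, _⟩
    exact ⟨fun _ => h, fun _ => ⟨j, hj⟩⟩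
  · filter_upwards [(eventually_gridVisits hX hA n hy).2 h] with δ hδ
    exact ⟨fun ⟨j, hj⟩ => absurd hj (hδ j), fun h' => absurd h' h⟩

end StepPath

/-! ### The law of the jumps of a process associated with the form -/

namespace MarkovProcess

open StepPath Network

variable {S : Type*} [TopologicalSpace S] {Ω : Type*} [MeasurableSpace Ω] (M : MarkovProcess S Ω)

instance (x : OnePoint S) : IsProbabilityMeasure (M.P x) := M.isMarkovKernel.isProbabilityMeasure x

/-- The events that depend on the process up to time `s` only. -/
@[reducible]
def past (s : ℝ≥0) : MeasurableSpace Ω :=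
  ⨆ u : Iic s, MeasurableSpace.comap (M.X u) inferInstance

/-- The trajectory of `ω`. -/
def trajectory (ω : Ω) : ℝ≥0 → OnePoint S := fun u => M.X u ω

variable {M}

lemma past_le (s : ℝ≥0) : M.past s ≤ (inferInstance : MeasurableSpace Ω) :=
  iSup_le fun u => (M.measurable_X u).comap_le

lemma past_mono {s s' : ℝ≥0} (h : s ≤ s') : M.past s ≤ M.past s' :=
  iSup_le fun u => le_iSup (fun u : Iic s' => MeasurableSpace.comap (M.X u) inferInstance)
    ⟨u, u.2.trans h⟩

lemma measurableSet_past {s u : ℝ≥0} (h : u ≤ s) {B : Set (OnePoint S)} (hB : MeasurableSet B) :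
    MeasurableSet[M.past s] (M.X u ⁻¹' B) :=
  le_iSup (fun u : Iic s => MeasurableSpace.comap (M.X u) inferInstance) ⟨u, h⟩ _ ⟨B, hB, rfl⟩

variable [T1Space S]

lemma measure_inter_of_subset (x : OnePoint S) {s : ℝ≥0} (h : ℝ≥0) {A : Set Ω}
    (hA : MeasurableSet[M.past s] A) {a : OnePoint S} (ha : A ⊆ M.X s ⁻¹' {a}) (b : OnePoint S) :
    M.P x (A ∩ M.X (s + h) ⁻¹' {b}) = M.P x A * M.P a (M.X h ⁻¹' {b}) := by
  rw [M.markov x s h A hA _ (measurableSet_singleton b),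
    setLIntegral_congr_fun (g := fun _ => M.P a (M.X h ⁻¹' {b})) (past_le s A hA)
      fun ω hω => by rw [show M.X s ω = a from ha hω], setLIntegral_const, mul_comm]

variable {y : ℕ → S} {t : ℕ → ℝ≥0}

lemma measurableSet_gridVisits (h : ℝ≥0) (n : ℕ) : ∀ j : ℕ,
    MeasurableSet[M.past (j * h)] {ω | GridVisits h (M.trajectory ω) y t n j} := by
  induction n with
  | zero =>
    intro j
    by_cases hj : j = 0
    · have : {ω | GridVisits h (M.trajectory ω) y t 0 j} = M.X 0 ⁻¹' {OnePoint.some (y 0)} := by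
        ext ω; simp [GridVisits, trajectory, hj]
      rw [this]
      exact measurableSet_past zero_le (measurableSet_singleton _)
    · have : {ω | GridVisits h (M.trajectory ω) y t 0 j} = ∅ := by
        ext ω; simp [GridVisits, hj]
      rw [this]
      exact @MeasurableSet.empty _ (M.past (j * h))
  | succ n ih =>
    intro j
    have : {ω | GridVisits h (M.trajectory ω) y t (n + 1) j} =
        ⋃ (i : ℕ) (m : ℕ) (_ : j = i + (⌈t n / h⌉₊ + m) + 1),
          {ω | GridVisits h (M.trajectory ω) y t n i} ∩
          (⋂ u ∈ Iic (⌈t n / h⌉₊ + m), M.X ((i + u : ℕ) * h) ⁻¹' {OnePoint.some (y n)}) ∩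
          M.X (j * h) ⁻¹' {OnePoint.some (y (n + 1))} := by
      ext ω
      simp only [GridVisits, trajectory, mem_ofPred_eq, mem_iUnion, mem_inter_iff, mem_iInter,
        mem_preimage, mem_singleton_iff, mem_Iic, exists_prop, and_assoc]
    rw [this]
    refine MeasurableSet.iUnion fun i => MeasurableSet.iUnion fun m => MeasurableSet.iUnion
      fun hj => ((past_mono ?_ _ (ih i)).inter (MeasurableSet.biInter (to_countable _)
        fun u hu => measurableSet_past ?_ (measurableSet_singleton _))).inter
        (measurableSet_past le_rfl (measurableSet_singleton _))
    · gcongr; omega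
    · have : u ≤ ⌈t n / h⌉₊ + m := hu
      gcongr; omega

/-- The probability of staying put at `m` further observation times. -/
lemma measure_stay (x : OnePoint S) (h : ℝ≥0) (n i m : ℕ) :
    M.P x ({ω | GridVisits h (M.trajectory ω) y t n i} ∩
      ⋂ u ∈ Iic m, M.X ((i + u : ℕ) * h) ⁻¹' {OnePoint.some (y n)}) =
    M.P x {ω | GridVisits h (M.trajectory ω) y t n i} *
      M.P (OnePoint.some (y n)) (M.X h ⁻¹' {OnePoint.some (y n)}) ^ m := by
  induction m with
  | zero =>
    rw [pow_zero, mul_one]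
    congr 1
    refine inter_eq_left.2 fun ω hω => ?_
    simp only [mem_iInter, mem_Iic, nonpos_iff_eq_zero]
    rintro u rfl
    exact GridVisits.apply hω
  | succ m ih =>
    have hs : ((i + (m + 1) : ℕ) : ℝ≥0) * h = (i + m : ℕ) * h + h := by push_cast; ring
    have hI : Iic (m + 1) = insert (m + 1) (Iic m) := by
      ext u; simp only [mem_Iic, mem_insert_iff]; omega
    have hm := measurableSet_gridVisits (M := M) (y := y) (t := t) h n i
    rw [hI, biInter_insert, inter_comm (M.X _ ⁻¹' _), ← inter_assoc, hs, measure_inter_of_subset x h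
      (a := OnePoint.some (y n)), ih, pow_succ, mul_assoc]
    · refine (past_mono ?_ _ hm).inter (MeasurableSet.biInter (to_countable _)
        fun u hu => measurableSet_past ?_ (measurableSet_singleton _))
      · gcongr; omega
      · have : u ≤ m := hu
        gcongr
    · exact fun ω hω => mem_iInter₂.1 hω.2 m self_mem_Iic

/-- The law of the observed jumps: the number of further observations in a state before it is seen
to be left is geometric. -/
lemma measure_exists_gridVisits (x : OnePoint S) (h : ℝ≥0) (n : ℕ)
    (hy : ∀ i < n + 1, y i ≠ y (i + 1)) :
    M.P x {ω | ∃ j, GridVisits h (M.trajectory ω) y t (n + 1) j} =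
      M.P x {ω | ∃ j, GridVisits h (M.trajectory ω) y t n j} *
        (M.P (OnePoint.some (y n)) (M.X h ⁻¹' {OnePoint.some (y n)}) ^ ⌈t n / h⌉₊ *
          (1 - M.P (OnePoint.some (y n)) (M.X h ⁻¹' {OnePoint.some (y n)}))⁻¹ *
          M.P (OnePoint.some (y n)) (M.X h ⁻¹' {OnePoint.some (y (n + 1))})) := by
  have hy' : ∀ i < n, y i ≠ y (i + 1) := fun i hi => hy i (hi.trans n.lt_succ_self)
  set G : ℕ → Set Ω := fun i => {ω | GridVisits h (M.trajectory ω) y t n i}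
  set p := M.P (OnePoint.some (y n)) (M.X h ⁻¹' {OnePoint.some (y n)})
  set q := M.P (OnePoint.some (y n)) (M.X h ⁻¹' {OnePoint.some (y (n + 1))})
  set E : ℕ × ℕ → Set Ω := fun a => G a.1 ∩
    (⋂ u ∈ Iic (⌈t n / h⌉₊ + a.2), M.X ((a.1 + u : ℕ) * h) ⁻¹' {OnePoint.some (y n)}) ∩
      M.X ((a.1 + (⌈t n / h⌉₊ + a.2) : ℕ) * h + h) ⁻¹' {OnePoint.some (y (n + 1))}
  have hcast : ∀ j : ℕ, ((j + 1 : ℕ) : ℝ≥0) * h = j * h + h := fun j => by push_cast; ring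
  have hE : ∀ a ω, ω ∈ E a →
      GridVisits h (M.trajectory ω) y t (n + 1) (a.1 + (⌈t n / h⌉₊ + a.2) + 1) := by
    rintro ⟨i, m⟩ ω ⟨⟨h1, h2⟩, h3⟩
    refine ⟨i, m, rfl, h1, fun u hu => mem_iInter₂.1 h2 u hu, ?_⟩
    rw [hcast]; exact h3
  have h1 : {ω | ∃ j, GridVisits h (M.trajectory ω) y t (n + 1) j} = ⋃ a, E a := by
    ext ω
    simp only [mem_iUnion, mem_ofPred_eq]
    constructor
    · rintro ⟨j, i, m, rfl, h1, h2, h3⟩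
      refine ⟨⟨i, m⟩, ⟨h1, mem_iInter₂.2 fun u hu => h2 u hu⟩, ?_⟩
      rw [hcast] at h3; exact h3
    · rintro ⟨a, ha⟩
      exact ⟨_, hE a ω ha⟩
  have hG : ∀ i : ℕ, MeasurableSet[M.past (i * h)] (G i) := fun i => measurableSet_gridVisits h n i
  have hst : ∀ a : ℕ × ℕ, MeasurableSet[M.past ((a.1 + (⌈t n / h⌉₊ + a.2) : ℕ) * h)]
      (G a.1 ∩ ⋂ u ∈ Iic (⌈t n / h⌉₊ + a.2),
        M.X ((a.1 + u : ℕ) * h) ⁻¹' {OnePoint.some (y n)}) := fun a => by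
    refine (past_mono ?_ _ (hG _)).inter (MeasurableSet.biInter (to_countable _)
      fun u hu => measurableSet_past ?_ (measurableSet_singleton _))
    · gcongr; omega
    · have : u ≤ ⌈t n / h⌉₊ + a.2 := hu
      gcongr
  have h2 : ∀ a, M.P x (E a) = M.P x (G a.1) * (p ^ ⌈t n / h⌉₊ * p ^ a.2 * q) := fun a => by
    simp only [E]
    rw [measure_inter_of_subset x h (hst a) (a := OnePoint.some (y n))
      (fun ω hω => mem_iInter₂.1 hω.2 _ self_mem_Iic), measure_stay, pow_add, mul_assoc]
  have h3 : {ω | ∃ j, GridVisits h (M.trajectory ω) y t n j} = ⋃ i, G i := by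
    ext ω; simp [G]
  rw [h1, h3, measure_iUnion, measure_iUnion, ENNReal.tsum_prod', ← ENNReal.tsum_mul_right]
  · congr 1 with i
    simp only [h2]
    rw [ENNReal.tsum_mul_left, ENNReal.tsum_mul_right, ENNReal.tsum_mul_left,
      ENNReal.tsum_geometric]
  · exact fun i j hij => disjoint_left.2 fun ω hi hj => hij (GridVisits.unique hy' hi hj)
  · exact fun i => past_le _ _ (hG i)
  · rintro ⟨i, m⟩ ⟨i', m'⟩ hij
    refine disjoint_left.2 fun ω hi hj => hij ?_
    obtain rfl : i = i' := GridVisits.unique hy' hi.1.1 hj.1.1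
    have := GridVisits.unique hy (hE _ ω hi) (hE _ ω hj)
    simp only [Prod.mk.injEq, true_and]
    simp only at this
    omega
  · exact fun a => (past_le _ _ (hst a)).inter (M.measurable_X _ (measurableSet_singleton _))

variable [DiscreteTopology S]

omit [T1Space S] in
lemma eventually_gridVisits_trajectory (n : ℕ) (hy : ∀ i < n, y i ≠ y (i + 1)) (ω : Ω) :
    ∀ᶠ h in 𝓝[>] (0 : ℝ≥0), (∃ j, GridVisits h (M.trajectory ω) y t n j) ↔
      Visits (M.trajectory ω) y t n :=
  eventually_gridVisits_iff (M.right_continuous ω) (fun s u => M.absorbing ω s u) n hy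

omit [DiscreteTopology S] in
lemma measurableSet_exists_gridVisits (h : ℝ≥0) (n : ℕ) :
    MeasurableSet {ω | ∃ j, GridVisits h (M.trajectory ω) y t n j} := by
  have : {ω | ∃ j, GridVisits h (M.trajectory ω) y t n j} =
      ⋃ j, {ω | GridVisits h (M.trajectory ω) y t n j} := by ext; simp
  rw [this]
  exact MeasurableSet.iUnion fun j => past_le _ _ (measurableSet_gridVisits h n j)

omit [T1Space S] in
lemma visits_eq_empty {n : ℕ} (hy : ¬ ∀ i < n, y i ≠ y (i + 1)) :
    {ω | Visits (M.trajectory ω) y t n} = ∅ :=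
  eq_empty_iff_forall_notMem.2 fun ω hω => hy fun _ hi =>
    Visits.ne (M.right_continuous ω) hω hi

lemma measurableSet_visits (y : ℕ → S) (t : ℕ → ℝ≥0) (n : ℕ) :
    MeasurableSet {ω | Visits (M.trajectory ω) y t n} := by
  by_cases hy : ∀ i < n, y i ≠ y (i + 1)
  · exact measurableSet_of_tendsto_indicator (𝓝[>] (0 : ℝ≥0))
      (fun h => measurableSet_exists_gridVisits h n) (eventually_gridVisits_trajectory n hy)
  · rw [visits_eq_empty hy]; exact MeasurableSet.empty

lemma tendsto_measure_gridVisits (x : OnePoint S) (n : ℕ) (hy : ∀ i < n, y i ≠ y (i + 1)) :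
    Tendsto (fun h => M.P x {ω | ∃ j, GridVisits h (M.trajectory ω) y t n j}) (𝓝[>] (0 : ℝ≥0))
      (𝓝 (M.P x {ω | Visits (M.trajectory ω) y t n})) :=
  tendsto_measure_of_ae_tendsto_indicator_of_isFiniteMeasure _ (measurableSet_visits y t n)
    (fun h => measurableSet_exists_gridVisits h n)
    (ae_of_all _ (eventually_gridVisits_trajectory n hy))

end MarkovProcess

/-! ### From the form to the law of the jumps -/

lemma tendsto_ceil_div_mul (t : ℝ≥0) :
    Tendsto (fun h : ℝ≥0 => (⌈t / h⌉₊ : ℝ) * h) (𝓝[>] 0) (𝓝 t) := by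
  have h0 : Tendsto (fun h : ℝ≥0 => (t : ℝ) + h) (𝓝[>] 0) (𝓝 t) := by
    have : Continuous fun h : ℝ≥0 => (t : ℝ) + h := by fun_prop
    simpa using (this.tendsto 0).mono_left nhdsWithin_le_nhds
  refine tendsto_of_tendsto_of_tendsto_of_le_of_le' tendsto_const_nhds h0 ?_ ?_ <;>
    filter_upwards [self_mem_nhdsWithin] with h hh
  · have : t ≤ ⌈t / h⌉₊ * h := (div_le_iff₀ hh).1 (Nat.le_ceil _)
    exact_mod_cast this
  · have : (⌈t / h⌉₊ : ℝ≥0) * h ≤ t + h := by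
      calc (⌈t / h⌉₊ : ℝ≥0) * h ≤ (t / h + 1) * h := by
            gcongr; exact (Nat.ceil_lt_add_one zero_le).le
        _ = t + h := by rw [add_mul, div_mul_cancel₀ _ (ne_of_gt hh), one_mul]
    exact_mod_cast this

/-- The passage from geometric to exponential holding times. -/
lemma tendsto_pow_ceil_mul {p q : ℝ≥0 → ℝ} {l r : ℝ} (hl : 0 < l)
    (hp : Tendsto (fun h : ℝ≥0 => (h : ℝ)⁻¹ * (1 - p h)) (𝓝[>] 0) (𝓝 l))
    (hq : Tendsto (fun h : ℝ≥0 => (h : ℝ)⁻¹ * q h) (𝓝[>] 0) (𝓝 r)) (t : ℝ≥0) :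
    Tendsto (fun h : ℝ≥0 => p h ^ ⌈t / h⌉₊ * (1 - p h)⁻¹ * q h) (𝓝[>] 0)
      (𝓝 (Real.exp (-(l * t)) * (r / l))) := by
  have hid : Tendsto (fun h : ℝ≥0 => (h : ℝ)) (𝓝[>] 0) (𝓝 0) :=
    (NNReal.continuous_coe.tendsto' 0 0 rfl).mono_left nhdsWithin_le_nhds
  have hpos : ∀ᶠ h : ℝ≥0 in 𝓝[>] 0, (0 : ℝ) < h := by
    filter_upwards [self_mem_nhdsWithin] with h hh
    exact hh
  have h1 : Tendsto p (𝓝[>] 0) (𝓝 1) := by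
    have h2 := (hid.mul hp).const_sub 1
    rw [zero_mul, sub_zero] at h2
    refine h2.congr' ?_
    filter_upwards [hpos] with h hh
    field_simp; ring
  have hne : ∀ᶠ h in 𝓝[>] 0, p h ≠ 1 := by
    filter_upwards [hp.eventually (lt_mem_nhds hl)] with h hh heq
    simp [heq] at hh
  have hlog : Tendsto (fun h => slope Real.log 1 (p h)) (𝓝[>] 0) (𝓝 1) := by
    have h3 := hasDerivAt_iff_tendsto_slope.1 (Real.hasDerivAt_log one_ne_zero)
    rw [inv_one] at h3
    exact h3.comp (tendsto_nhdsWithin_iff.2 ⟨h1, hne⟩)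
  have h4 : Tendsto (fun h => p h ^ ⌈t / h⌉₊) (𝓝[>] 0) (𝓝 (Real.exp (-(l * t)))) := by
    have h5 := (((tendsto_ceil_div_mul t).mul hp).mul hlog).neg
    rw [mul_one, mul_comm (t : ℝ)] at h5
    refine ((Real.continuous_exp.tendsto _).comp h5).congr' ?_
    filter_upwards [hpos, hne, h1.eventually (lt_mem_nhds one_pos)] with h hh h6 h7
    have h8 : p h - 1 ≠ 0 := sub_ne_zero.2 h6
    rw [Function.comp_apply, ← Real.exp_log (pow_pos h7 _), Real.log_pow, slope_def_field,
      Real.log_one, sub_zero]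
    congr 1
    field_simp; ring
  refine (h4.mul (hq.div hp hl.ne')).congr' ?_
  filter_upwards [hpos, hne] with h hh h6
  have h8 : 1 - p h ≠ 0 := sub_ne_zero.2 h6.symm
  simp only [Pi.div_apply]
  field_simp

namespace MarkovProcess

open StepPath Network

variable {S : Type*} [TopologicalSpace S] [DiscreteTopology S] [MeasurableSpace S]
  [MeasurableSingletonClass S] [Countable S] {Ω : Type*} [MeasurableSpace Ω]
  {M : MarkovProcess S Ω} {N : Network S}

/-- The jump rates of a process that is associated with the form, found by testing the form with
the indicators of two states. -/
lemma tendsto_rate (hM : M.IsAssociatedWith N.measure ⊤ fun f g => N.energy f g) (a b : S) :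
    Tendsto (fun h : ℝ≥0 => (h : ℝ)⁻¹ * (indicator {b} (fun _ => (1 : ℝ)) a -
        (M.P a).real (M.X h ⁻¹' {OnePoint.some b}))) (𝓝[>] 0)
      (𝓝 (N.speed * indicator {b} (fun _ => (1 : ℝ)) a - N.cond a b / N.mass a)) := by
  classical
  obtain ⟨T, hT, hTM⟩ := hM
  have hm := N.mass_pos a
  have hL : MemLp (indicator {b} fun _ => (1 : ℝ)) 2 N.measure :=
    memLp_iff.2 (sqSummable_indicator b)
  have h1 := (hT.form_eq (hL.toLp _) trivial (N.point a) trivial).const_mul (N.mass a)⁻¹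
  rw [coe_toLp, coe_point, energy_indicator (sqSummable_indicator b), tsum_eq_single b
    (fun z hz => by simp [hz])] at h1
  have h2 : (N.mass a)⁻¹ * (N.speed * N.mass a * indicator {b} (fun _ => (1 : ℝ)) a -
      N.cond a b * indicator {b} (fun _ => (1 : ℝ)) b) =
      N.speed * indicator {b} (fun _ => (1 : ℝ)) a - N.cond a b / N.mass a := by
    simp only [mem_singleton_iff, indicator_of_mem]
    field_simp
  rw [h2] at h1
  refine h1.congr fun h => ?_
  have h3 : T h (hL.toLp _) a = (M.P a).real (M.X h ⁻¹' {OnePoint.some b}) := by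
    rw [forall_of_ae (hTM h _ hL (measurable_of_countable _) ⟨1, fun x => by
      by_cases hx : x = b <;> simp [hx]⟩) a, transition, ← integral_indicator_one
      (M.measurable_X h (measurableSet_singleton _))]
    congr 1 with ω
    change _ = indicator {OnePoint.some b} (fun _ => (1 : ℝ)) (M.X h ω)
    generalize M.X h ω = w
    induction w using OnePoint.rec with
    | infty => simp
    | coe z => by_cases hz : z = b <;> simp [hz]
  rw [inner_point, coe_sub, coe_toLp, Pi.sub_apply, h3]
  field_simp

lemma tendsto_stay (hM : M.IsAssociatedWith N.measure ⊤ fun f g => N.energy f g) (a : S) :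
    Tendsto (fun h : ℝ≥0 => (h : ℝ)⁻¹ * (1 - (M.P a).real (M.X h ⁻¹' {OnePoint.some a})))
      (𝓝[>] 0) (𝓝 N.speed) := by
  simpa [N.cond_self] using tendsto_rate hM a a

lemma tendsto_leave (hM : M.IsAssociatedWith N.measure ⊤ fun f g => N.energy f g) {a b : S}
    (hab : a ≠ b) :
    Tendsto (fun h : ℝ≥0 => (h : ℝ)⁻¹ * (M.P a).real (M.X h ⁻¹' {OnePoint.some b}))
      (𝓝[>] 0) (𝓝 (N.cond a b / N.mass a)) := by
  simpa [hab] using (tendsto_rate hM a b).neg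

/-- The Markov property at the jump times. -/
lemma measure_visits_succ (hM : M.IsAssociatedWith N.measure ⊤ fun f g => N.energy f g)
    (x : OnePoint S) (y : ℕ → S) (t : ℕ → ℝ≥0) (n : ℕ) :
    M.P x {ω | Visits (M.trajectory ω) y t (n + 1)} =
      M.P x {ω | Visits (M.trajectory ω) y t n} *
        (ENNReal.ofReal (Real.exp (-(N.speed * t n))) * N.jump (y n) {y (n + 1)}) := by
  by_cases hy : ∀ i < n + 1, y i ≠ y (i + 1)
  · have hyn : y n ≠ y (n + 1) := hy n n.lt_succ_self
    have h1 := tendsto_stay hM (y n)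
    have h2 := tendsto_pow_ceil_mul N.speed_pos h1 (tendsto_leave hM hyn) (t n)
    have hlim := ENNReal.tendsto_ofReal h2
    rw [ENNReal.ofReal_mul (Real.exp_pos _).le, div_div, mul_comm (N.mass _),
      ← jump_singleton] at hlim
    refine tendsto_nhds_unique (tendsto_measure_gridVisits x (n + 1) hy) ?_
    refine (ENNReal.Tendsto.mul (tendsto_measure_gridVisits x n fun i hi =>
      hy i (hi.trans n.lt_succ_self)) (Or.inr ?_) hlim (Or.inr (measure_ne_top _ _))).congr' ?_
    · exact ENNReal.mul_ne_top ENNReal.ofReal_ne_top (measure_ne_top _ _)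
    · filter_upwards [self_mem_nhdsWithin, h1.eventually (lt_mem_nhds N.speed_pos)] with h hh h3
      have h4 : 0 < 1 - (M.P (y n)).real (M.X h ⁻¹' {OnePoint.some (y n)}) :=
        pos_of_mul_pos_right h3 (by positivity)
      rw [measure_exists_gridVisits x h n hy, ENNReal.ofReal_mul (by positivity),
        ENNReal.ofReal_mul (by positivity), ENNReal.ofReal_pow (by positivity),
        ENNReal.ofReal_inv_of_pos h4, ENNReal.ofReal_sub _ (by positivity), ENNReal.ofReal_one,
        ofReal_measureReal, ofReal_measureReal]
  · push Not at hy
    obtain ⟨i, hi, hyi⟩ := hy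
    rw [visits_eq_empty fun h => h i hi hyi, measure_empty]
    rcases Nat.lt_succ_iff_lt_or_eq.1 hi with hi | rfl
    · rw [visits_eq_empty fun h => h i hi hyi, measure_empty, zero_mul]
    · rw [← hyi, jump_self, mul_zero, mul_zero]

end MarkovProcess

/-! ### Jump laws with a constant rate -/

namespace JumpLaw

variable {S : Type*} {Ω : Type*}

/-- The event that the chain `Y` starts with `y 0, …, y n` and that the holding times exceed
`t 0, …, t (n - 1)`. -/
def history (Y : ℕ → Ω → S) (τ : ℕ → Ω → ℝ≥0) (y : ℕ → S) (t : ℕ → ℝ≥0) (n : ℕ) : Set Ω :=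
  {ω | (∀ i ≤ n, Y i ω = y i) ∧ ∀ i < n, t i < τ i ω}

/-- The extension of `y 0, …, y n` to a sequence. -/
def extend {n : ℕ} (y : Fin (n + 1) → S) (i : ℕ) : S := y ⟨min i n, by omega⟩

lemma extend_apply {n : ℕ} (y : ℕ → S) {i : ℕ} (hi : i ≤ n) :
    extend (fun j : Fin (n + 1) => y j) i = y i := by simp [extend, hi]

lemma extend_apply' {n : ℕ} (y : Fin (n + 1) → S) (i : Fin (n + 1)) : extend y i = y i := by
  have : (i : ℕ) ≤ n := by omega
  simp [extend, this]

variable {Y : ℕ → Ω → S} {τ : ℕ → Ω → ℝ≥0}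

lemma history_inter (y y' : ℕ → S) (t t' : ℕ → ℝ≥0) (n : ℕ)
    (h : (history Y τ y t n ∩ history Y τ y' t' n).Nonempty) :
    history Y τ y t n ∩ history Y τ y' t' n = history Y τ y (t ⊔ t') n := by
  obtain ⟨ω, h1, h2⟩ := h
  ext ω'
  simp only [history, mem_inter_iff, mem_ofPred_eq, Pi.sup_apply, sup_lt_iff]
  constructor
  · rintro ⟨⟨h3, h4⟩, -, h5⟩
    exact ⟨h3, fun i hi => ⟨h4 i hi, h5 i hi⟩⟩
  · rintro ⟨h3, h4⟩
    exact ⟨⟨h3, fun i hi => (h4 i hi).1⟩, fun i hi => by rw [h3 i hi, ← h1.1 i hi, h2.1 i hi],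
      fun i hi => (h4 i hi).2⟩

variable [MeasurableSpace S] [MeasurableSingletonClass S] [Countable S]

omit [Countable S] in
lemma measurableSet_history {m : MeasurableSpace Ω} {n : ℕ} (hY : ∀ i ≤ n, Measurable (Y i))
    (hτ : ∀ i < n, Measurable (τ i)) (y : ℕ → S) (t : ℕ → ℝ≥0) :
    MeasurableSet (history Y τ y t n) := by
  have : history Y τ y t n = (⋂ i ∈ Iic n, Y i ⁻¹' {y i}) ∩ ⋂ i ∈ Iio n, τ i ⁻¹' Ioi (t i) := by
    ext ω; simp [history]
  rw [this]
  exact (MeasurableSet.biInter (to_countable _)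
    fun i hi => hY i hi (measurableSet_singleton _)).inter
    (MeasurableSet.biInter (to_countable _) fun i hi => hτ i hi measurableSet_Ioi)

omit [MeasurableSingletonClass S] in
/-- The events `history` generate the history of the first `n` jumps. -/
lemma jumpHistory_le (hpos : ∀ n ω, 0 < τ n ω) (n : ℕ) :
    jumpHistory Y τ n ≤ MeasurableSpace.generateFrom
      {A | ∃ (y : ℕ → S) (t : ℕ → ℝ≥0), A = history Y τ y t n} := by
  have hmem : ∀ y t, MeasurableSet[MeasurableSpace.generateFrom
      {A | ∃ (y : ℕ → S) (t : ℕ → ℝ≥0), A = history Y τ y t n}] (history Y τ y t n) :=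
    fun y t => MeasurableSpace.measurableSet_generateFrom ⟨y, t, rfl⟩
  let _ : MeasurableSpace Ω := MeasurableSpace.generateFrom
      {A | ∃ (y : ℕ → S) (t : ℕ → ℝ≥0), A = history Y τ y t n}
  refine sup_le (iSup_le fun i => ?_) (iSup_le fun i => ?_)
  · refine Measurable.comap_le (measurable_to_countable' fun s => ?_)
    have : Y i ⁻¹' {s} = ⋃ (y : Fin (n + 1) → S) (_ : extend y i = s),
        history Y τ (extend y) 0 n := by
      ext ω
      simp only [mem_preimage, mem_singleton_iff, mem_iUnion, exists_prop]
      constructor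
      · intro h
        refine ⟨fun j => Y j ω, ?_, fun j hj => (extend_apply (fun j => Y j ω) hj).symm,
          fun j _ => hpos j ω⟩
        rw [extend_apply (fun j => Y j ω) i.2, h]
      · rintro ⟨y, hy, h⟩
        rw [h.1 i i.2, hy]
    rw [this]
    exact MeasurableSet.iUnion fun y => MeasurableSet.iUnion fun _ => hmem _ _
  · classical
    refine Measurable.comap_le (measurable_of_Ioi fun s => ?_)
    have : τ i ⁻¹' Ioi s = ⋃ y : Fin (n + 1) → S,
        history Y τ (extend y) (Function.update 0 (i : ℕ) s) n := by
      ext ω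
      simp only [mem_preimage, mem_Ioi, mem_iUnion]
      constructor
      · intro h
        refine ⟨fun j => Y j ω, fun j hj => (extend_apply (fun j => Y j ω) hj).symm,
          fun j _ => ?_⟩
        by_cases hj : j = i
        · subst hj; simpa using h
        · simpa [hj] using hpos j ω
      · rintro ⟨y, h⟩
        simpa using h.2 i i.2
    rw [this]
    exact MeasurableSet.iUnion fun y => hmem _ _

variable [MeasurableSpace Ω] {μ : Measure Ω} [IsProbabilityMeasure μ] {rate : ℝ}
  {Q : S → Measure S}

/-- A jump law is determined by its values on the events `history`. -/
lemma measure_inter_eq (hY : ∀ n, Measurable (Y n)) (hτ : ∀ n, Measurable (τ n))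
    (hpos : ∀ n ω, 0 < τ n ω)
    (h : ∀ y t n (s : ℝ≥0) (B : Set S), μ (history Y τ y t n ∩ {ω | s < τ n ω ∧ Y (n + 1) ω ∈ B}) =
      μ (history Y τ y t n) * (ENNReal.ofReal (Real.exp (-(rate * s))) * Q (y n) B))
    (n : ℕ) {A : Set Ω} (hA : MeasurableSet[jumpHistory Y τ n] A) (s : ℝ≥0) (B : Set S) :
    μ (A ∩ {ω | s < τ n ω ∧ Y (n + 1) ω ∈ B}) =
      ∫⁻ ω in A, ENNReal.ofReal (Real.exp (-(rate * s))) * Q (Y n ω) B ∂μ := by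
  set D := {ω | s < τ n ω ∧ Y (n + 1) ω ∈ B} with hD
  set C : Set (Set Ω) := {A | ∃ (y : ℕ → S) (t : ℕ → ℝ≥0), A = history Y τ y t n} with hC
  have hm : ∀ y t, MeasurableSet (history Y τ y t n) := fun y t =>
    measurableSet_history (fun i _ => hY i) (fun i _ => hτ i) y t
  have hle : MeasurableSpace.generateFrom C ≤ (inferInstance : MeasurableSpace Ω) := by
    refine MeasurableSpace.generateFrom_le ?_
    rintro _ ⟨y, t, rfl⟩
    exact hm y t
  have hA' := jumpHistory_le hpos n _ hA
  set ν := μ.withDensity fun ω => ENNReal.ofReal (Real.exp (-(rate * s))) * Q (Y n ω) B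
  have hval : ∀ A ∈ C, μ.restrict D A = ν A := by
    rintro _ ⟨y, t, rfl⟩
    rw [Measure.restrict_apply (hm y t), h, withDensity_apply _ (hm y t),
      setLIntegral_congr_fun (g := fun _ => ENNReal.ofReal (Real.exp (-(rate * s))) * Q (y n) B)
        (hm y t) fun ω hω => by rw [hω.1 n le_rfl], setLIntegral_const, mul_comm]
  have huniv : (univ : Set Ω) = ⋃ y : Fin (n + 1) → S, history Y τ (extend y) 0 n := by
    refine (eq_univ_of_forall fun ω => mem_iUnion.2 ⟨fun j : Fin (n + 1) => Y j ω, ?_⟩).symm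
    exact ⟨fun j hj => (extend_apply (fun j => Y j ω) hj).symm, fun j _ => hpos j ω⟩
  have hdisj : Pairwise (Function.onFun Disjoint
      fun y : Fin (n + 1) → S => history Y τ (extend y) 0 n) := by
    refine fun y y' hyy => disjoint_left.2 fun ω h1 h2 => hyy (funext fun i => ?_)
    rw [← extend_apply' y, ← extend_apply' y', ← h1.1 i (by omega), h2.1 i (by omega)]
  have key := ext_on_measurableSpace_of_generate_finite _ C hval hle rfl
    (by
      rintro _ ⟨y, t, rfl⟩ _ ⟨y', t', rfl⟩ hne
      exact ⟨y, t ⊔ t', history_inter y y' t t' n hne⟩)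
    (by
      rw [huniv, measure_iUnion hdisj fun y => hm _ _, measure_iUnion hdisj fun y => hm _ _]
      exact tsum_congr fun y => hval _ ⟨_, _, rfl⟩) hA'
  rwa [Measure.restrict_apply (hle _ hA'), withDensity_apply _ (hle _ hA')] at key

omit [MeasurableSingletonClass S] [Countable S] in
/-- Holding times with a bounded rate are infinitely often larger than `1`, so that the jump times
do not accumulate. -/
lemma ae_exists_lt_sum (hτ : ∀ n, Measurable (τ n))
    (hQ : ∀ x, IsProbabilityMeasure (Q x))
    (h : ∀ (n : ℕ) (A : Set Ω), MeasurableSet[jumpHistory Y τ n] A → ∀ (s : ℝ≥0) (B : Set S),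
      μ (A ∩ {ω | s < τ n ω ∧ Y (n + 1) ω ∈ B}) =
        ∫⁻ ω in A, ENNReal.ofReal (Real.exp (-(rate * s))) * Q (Y n ω) B ∂μ) :
    ∀ᵐ ω ∂μ, ∀ t : ℝ≥0, ∃ n, t < ∑ i ∈ Finset.range n, τ i ω := by
  set c := Real.exp (-(rate * (1 : ℝ≥0)))
  set F : ℕ → ℕ → Set Ω := fun m j => {ω | ∀ i < j, τ (m + i) ω ≤ 1}
  have hsucc : ∀ m j, F m (j + 1) = F m j \ {ω | 1 < τ (m + j) ω} := by
    intro m j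
    ext ω
    simp only [F, mem_ofPred_eq, Set.mem_sdiff, not_lt, Nat.lt_succ_iff_lt_or_eq]
    exact ⟨fun h => ⟨fun i hi => h i (Or.inl hi), h j (Or.inr rfl)⟩,
      fun h i hi => hi.elim (h.1 i) fun e => e ▸ h.2⟩
  have hF : ∀ m j, MeasurableSet[jumpHistory Y τ (m + j)] (F m j) := by
    intro m j
    have : F m j = ⋂ i ∈ Iio j, τ (m + i) ⁻¹' Iic 1 := by ext ω; simp [F]
    rw [this]
    refine MeasurableSet.biInter (to_countable _) fun i hi => ?_
    have hi' : m + i < m + j := Nat.add_lt_add_left hi m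
    refine le_sup_right (α := MeasurableSpace Ω) _ (le_iSup (fun i : Iio (m + j) =>
      MeasurableSpace.comap (τ i) inferInstance) ⟨m + i, hi'⟩ _ ⟨_, measurableSet_Iic, rfl⟩)
  have hreal : ∀ m j, μ.real (F m j) = (1 - c) ^ j := by
    intro m j
    induction j with
    | zero => simp [F]
    | succ j ih =>
      have h1 := h (m + j) _ (hF m j) 1 univ
      simp only [mem_univ, and_true, measure_univ, mul_one, setLIntegral_const] at h1
      have h2 : μ.real (F m j ∩ {ω | 1 < τ (m + j) ω}) = c * μ.real (F m j) := by
        rw [Measure.real, h1, ENNReal.toReal_mul, ENNReal.toReal_ofReal (Real.exp_pos _).le]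
        rfl
      have h3 := measureReal_inter_add_sdiff (μ := μ) (s := F m j)
        (t := {ω | 1 < τ (m + j) ω}) (hτ _ measurableSet_Ioi)
      rw [← hsucc, h2, ih] at h3
      rw [pow_succ]; linarith
  have hnull : ∀ m, ∀ᵐ ω ∂μ, ∃ j, 1 < τ (m + j) ω := by
    intro m
    rw [ae_iff, ← measureReal_eq_zero_iff]
    have hc : 0 < c := Real.exp_pos _
    refine le_antisymm (ge_of_tendsto' (x := atTop) (f := fun j => μ.real (F m j)) ?_ fun j =>
      measureReal_mono ?_) measureReal_nonneg
    · simp only [hreal]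
      have : 0 ≤ 1 - c := by rw [← pow_one (1 - c), ← hreal 0 1]; exact measureReal_nonneg
      exact tendsto_pow_atTop_nhds_zero_of_lt_one this (by linarith)
    · intro ω hω i _
      by_contra hlt
      exact hω ⟨i, not_le.1 hlt⟩
  filter_upwards [ae_all_iff.2 hnull] with ω hω
  have hN : ∀ N : ℕ, ∃ n, (N : ℝ≥0) ≤ ∑ i ∈ Finset.range n, τ i ω := by
    intro N
    induction N with
    | zero => exact ⟨0, by simp⟩
    | succ N ih =>
      obtain ⟨n, hn⟩ := ih
      obtain ⟨j, hj⟩ := hω n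
      refine ⟨n + j + 1, ?_⟩
      rw [Finset.sum_range_succ, Nat.cast_succ]
      refine add_le_add (hn.trans ?_) hj.le
      exact Finset.sum_le_sum_of_subset (Finset.range_mono (Nat.le_add_right n j))
  intro t
  obtain ⟨N, hNt⟩ := exists_nat_gt t
  exact (hN N).imp fun n hn => hNt.trans_le hn

end JumpLaw

/-! ### Associated processes are pure jump processes -/

namespace StepPath

variable {S : Type*} {X : ℝ≥0 → OnePoint S}

/-- The path makes infinitely many jumps before it reaches the cemetery, if it ever does. -/
def Jumps (X : ℝ≥0 → OnePoint S) : Prop :=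
  ∀ n, ∃ y : Fin (n + 1) → S, Visits X (JumpLaw.extend y) 0 n

lemma jumps_iff : Jumps X ↔
    ∀ n, (∃ s : S, X (jumpTime X n) = OnePoint.some s) ∧ jumpTime X n < jumpTime X (n + 1) := by
  constructor
  · intro h n
    obtain ⟨y, hy⟩ := h (n + 1)
    exact ⟨⟨_, hy.1 n n.le_succ⟩, by simpa using hy.2 n n.lt_succ_self⟩
  · intro h n
    choose y hy using fun n => (h n).1
    exact ⟨fun i => y i, fun i hi => by rw [JumpLaw.extend_apply _ hi, hy], fun i _ => by
      simpa using (h i).2⟩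

open Classical in
/-- The states that are visited, with an arbitrary value for paths without jumps. -/
noncomputable def chain [Nonempty S] (X : ℝ≥0 → OnePoint S) (n : ℕ) : S :=
  if Jumps X then (X (jumpTime X n)).elim (Classical.arbitrary S) id else Classical.arbitrary S

open Classical in
/-- The holding times, with the positive value `1` for paths without jumps. -/
noncomputable def holding (X : ℝ≥0 → OnePoint S) (n : ℕ) : ℝ≥0 :=
  if Jumps X then jumpTime X (n + 1) - jumpTime X n else 1

lemma coe_chain [Nonempty S] (h : Jumps X) (n : ℕ) :
    (OnePoint.some (chain X n) : OnePoint S) = X (jumpTime X n) := by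
  obtain ⟨s, hs⟩ := (jumps_iff.1 h n).1
  simp [chain, h, hs]

lemma holding_pos (X : ℝ≥0 → OnePoint S) (n : ℕ) : 0 < holding X n := by
  by_cases h : Jumps X
  · simpa [holding, h] using (jumps_iff.1 h n).2
  · simp [holding, h]

lemma sum_holding (h : Jumps X) (n : ℕ) :
    ∑ i ∈ Finset.range n, holding X i = jumpTime X n := by
  induction n with
  | zero => simp [jumpTime]
  | succ n ih =>
    rw [Finset.sum_range_succ, ih, holding, if_pos h, add_tsub_cancel_of_le (jumps_iff.1 h n).2.le]

lemma lt_holding_iff (h : Jumps X) {n : ℕ} {s : ℝ≥0} :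
    s < holding X n ↔ jumpTime X n + s < jumpTime X (n + 1) := by
  rw [holding, if_pos h, lt_tsub_iff_left]

lemma visits_iff [Nonempty S] (h : Jumps X) {y : ℕ → S} {t : ℕ → ℝ≥0} {n : ℕ} :
    Visits X y t n ↔ (∀ i ≤ n, chain X i = y i) ∧ ∀ i < n, t i < holding X i := by
  simp only [Visits, lt_holding_iff h, ← coe_chain h, OnePoint.coe_eq_coe]

lemma Visits.congr {y y' : ℕ → S} {t t' : ℕ → ℝ≥0} {n : ℕ} (hy : ∀ i ≤ n, y i = y' i)
    (ht : ∀ i < n, t i = t' i) (h : Visits X y t n) : Visits X y' t' n :=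
  ⟨fun i hi => hy i hi ▸ h.1 i hi, fun i hi => ht i hi ▸ h.2 i hi⟩

end StepPath

namespace MarkovProcess

open StepPath Network JumpLaw

variable {S : Type*} [TopologicalSpace S] [DiscreteTopology S] [MeasurableSpace S]
  [MeasurableSingletonClass S] [Countable S] {Ω : Type*} [MeasurableSpace Ω]
  {M : MarkovProcess S Ω} {N : Network S}

omit [MeasurableSpace S] [MeasurableSingletonClass S] in
lemma measurableSet_jumps : MeasurableSet {ω | Jumps (M.trajectory ω)} := by
  have : {ω | Jumps (M.trajectory ω)} =
      ⋂ n, ⋃ y : Fin (n + 1) → S, {ω | Visits (M.trajectory ω) (extend y) 0 n} := by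
    ext ω; simp [Jumps]
  rw [this]
  exact MeasurableSet.iInter fun n => MeasurableSet.iUnion fun y => measurableSet_visits _ _ _

section

variable [Nonempty S]

omit [MeasurableSingletonClass S] in
lemma measurable_chain (n : ℕ) : Measurable fun ω => chain (M.trajectory ω) n := by
  refine measurable_to_countable' fun s => ?_
  have : (fun ω => chain (M.trajectory ω) n) ⁻¹' {s} =
      ({ω | Jumps (M.trajectory ω)} ∩ ⋃ (y : Fin (n + 1) → S) (_ : extend y n = s),
        {ω | Visits (M.trajectory ω) (extend y) 0 n}) ∪
      ({ω | Jumps (M.trajectory ω)}ᶜ ∩ {_ω | Classical.arbitrary S = s}) := by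
    ext ω
    by_cases h : Jumps (M.trajectory ω)
    · simp only [mem_preimage, mem_singleton_iff, mem_union, mem_inter_iff, mem_ofPred_eq, h,
        true_and, mem_iUnion, exists_prop, mem_compl_iff, not_true, false_and, or_false,
        visits_iff h]
      constructor
      · intro hs
        exact ⟨fun i => chain (M.trajectory ω) i, (extend_apply _ le_rfl).trans hs,
          fun i hi => (extend_apply _ hi).symm, fun i _ => holding_pos _ i⟩
      · rintro ⟨y, hy, hv, -⟩
        rw [hv n le_rfl, hy]
    · simp [chain, h]
  rw [this]
  exact (measurableSet_jumps.inter (MeasurableSet.iUnion fun y => MeasurableSet.iUnion fun _ =>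
    measurableSet_visits _ _ _)).union (measurableSet_jumps.compl.inter (MeasurableSet.const _))

omit [MeasurableSpace S] [MeasurableSingletonClass S] in
lemma measurable_holding (n : ℕ) : Measurable fun ω => holding (M.trajectory ω) n := by
  classical
  refine measurable_of_Ioi fun s => ?_
  have : (fun ω => holding (M.trajectory ω) n) ⁻¹' Ioi s =
      ({ω | Jumps (M.trajectory ω)} ∩ ⋃ y : Fin (n + 2) → S,
        {ω | Visits (M.trajectory ω) (extend y) (Function.update 0 n s) (n + 1)}) ∪
      ({ω | Jumps (M.trajectory ω)}ᶜ ∩ {_ω | s < 1}) := by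
    ext ω
    by_cases h : Jumps (M.trajectory ω)
    · simp only [mem_preimage, mem_Ioi, mem_union, mem_inter_iff, mem_ofPred_eq, h,
        true_and, mem_iUnion, mem_compl_iff, not_true, false_and, or_false,
        visits_iff h]
      constructor
      · intro hs
        refine ⟨fun i => chain (M.trajectory ω) i,
          fun i hi => (extend_apply (fun i => chain (M.trajectory ω) i) hi).symm, fun i _ => ?_⟩
        by_cases hi : i = n
        · subst hi; simpa using hs
        · simpa [hi] using holding_pos _ i
      · rintro ⟨y, -, hv⟩
        simpa using hv n n.lt_succ_self
    · simp [holding, h]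
  rw [this]
  exact (measurableSet_jumps.inter (MeasurableSet.iUnion fun y =>
    measurableSet_visits _ _ _)).union (measurableSet_jumps.compl.inter (MeasurableSet.const _))

end

open Classical in
omit [DiscreteTopology S] [MeasurableSpace S] [MeasurableSingletonClass S] [Countable S] in
lemma visits_inter_eq (y : ℕ → S) (t : ℕ → ℝ≥0) (n : ℕ) (s : ℝ≥0) (B : Set S) :
    {ω | Visits (M.trajectory ω) y t n} ∩
      {ω | jumpTime (M.trajectory ω) n + s < jumpTime (M.trajectory ω) (n + 1) ∧
        ∃ z ∈ B, M.trajectory ω (jumpTime (M.trajectory ω) (n + 1)) = OnePoint.some z} =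
      ⋃ z : B, {ω | Visits (M.trajectory ω) (Function.update y (n + 1) z)
        (Function.update t n s) (n + 1)} := by
  ext ω
  have h2 : ∀ z, Visits (M.trajectory ω) (Function.update y (n + 1) z)
      (Function.update t n s) n ↔ Visits (M.trajectory ω) y t n := fun z => by
    have hy : ∀ i ≤ n, Function.update y (n + 1) z i = y i := fun i hi =>
      Function.update_of_ne (by omega) _ _
    have ht : ∀ i < n, Function.update t n s i = t i := fun i hi =>
      Function.update_of_ne (by omega) _ _
    exact ⟨Visits.congr hy ht, Visits.congr (fun i hi => (hy i hi).symm)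
      fun i hi => (ht i hi).symm⟩
  simp only [mem_inter_iff, mem_ofPred_eq, mem_iUnion, visits_succ, h2, Function.update_self,
    Subtype.exists, exists_prop]
  tauto

/-- The joint law of the next holding time and the next state after prescribed visits. -/
lemma measure_visits_inter (hM : M.IsAssociatedWith N.measure ⊤ fun f g => N.energy f g)
    (x : OnePoint S) (y : ℕ → S) (t : ℕ → ℝ≥0) (n : ℕ) (s : ℝ≥0) (B : Set S) :
    M.P x ({ω | Visits (M.trajectory ω) y t n} ∩
      {ω | jumpTime (M.trajectory ω) n + s < jumpTime (M.trajectory ω) (n + 1) ∧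
        ∃ z ∈ B, M.trajectory ω (jumpTime (M.trajectory ω) (n + 1)) = OnePoint.some z}) =
      M.P x {ω | Visits (M.trajectory ω) y t n} *
        (ENNReal.ofReal (Real.exp (-(N.speed * s))) * N.jump (y n) B) := by
  classical
  have h3 : ∀ z : B, M.P x {ω | Visits (M.trajectory ω) (Function.update y (n + 1) z)
      (Function.update t n s) (n + 1)} = M.P x {ω | Visits (M.trajectory ω) y t n} *
        (ENNReal.ofReal (Real.exp (-(N.speed * s))) * N.jump (y n) {(z : S)}) := fun z => by
    rw [measure_visits_succ hM, Function.update_self, Function.update_self,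
      Function.update_of_ne (by omega)]
    congr 2
    ext ω
    exact ⟨Visits.congr (fun i hi => Function.update_of_ne (by omega) _ _)
        fun i hi => Function.update_of_ne (by omega) _ _,
      Visits.congr (fun i hi => (Function.update_of_ne (by omega) _ _).symm)
        fun i hi => (Function.update_of_ne (by omega) _ _).symm⟩
  rw [visits_inter_eq, measure_iUnion, tsum_congr h3, ENNReal.tsum_mul_left, ENNReal.tsum_mul_left]
  · congr 2
    rw [← measure_iUnion (fun z z' hz => by simpa [Subtype.ext_iff] using hz)
      fun z => measurableSet_singleton _]
    congr 1
    ext z; simp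
  · refine fun z z' hz => disjoint_left.2 fun ω h h' => hz (Subtype.ext ?_)
    have := (h.1 (n + 1) le_rfl).symm.trans (h'.1 (n + 1) le_rfl)
    simpa using this
  · exact fun z => measurableSet_visits _ _ _

/-- Almost surely every state is left after some time, and the next state is not the cemetery: the
jump law has total mass `1`. -/
lemma ae_jumps (hM : M.IsAssociatedWith N.measure ⊤ fun f g => N.energy f g) (x : S) :
    ∀ᵐ ω ∂(M.P x), Jumps (M.trajectory ω) := by
  refine ae_all_iff.2 fun n => ?_
  induction n with
  | zero =>
    filter_upwards [M.start x] with ω hω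
    refine ⟨fun _ => x, fun i hi => ?_, fun i hi => by omega⟩
    obtain rfl : i = 0 := by omega
    exact hω
  | succ n ih =>
    have h1 : ∀ y : Fin (n + 1) → S, ∀ᵐ ω ∂(M.P x), Visits (M.trajectory ω) (extend y) 0 n →
        ω ∈ {ω | jumpTime (M.trajectory ω) n + 0 < jumpTime (M.trajectory ω) (n + 1) ∧
          ∃ z ∈ univ, M.trajectory ω (jumpTime (M.trajectory ω) (n + 1)) = OnePoint.some z} := by
      intro y
      have h2 := measure_visits_inter hM x (extend y) 0 n 0 univ
      have := N.isProbabilityMeasure_jump (extend y n)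
      rw [NNReal.coe_zero, mul_zero, neg_zero, Real.exp_zero, ENNReal.ofReal_one, one_mul,
        measure_univ, mul_one] at h2
      have h3 := ae_eq_of_subset_of_measure_ge inter_subset_left h2.ge (by
        rw [visits_inter_eq]
        exact (MeasurableSet.iUnion fun z => measurableSet_visits _ _ _).nullMeasurableSet)
        (measure_ne_top _ _)
      filter_upwards [h3.mem_iff] with ω hω hv using (hω.2 hv).2
    filter_upwards [ih, ae_all_iff.2 h1] with ω ⟨y, hy⟩ h
    obtain ⟨h3, z, -, h4⟩ := h y hy
    classical
    refine ⟨fun i => Function.update (extend y) (n + 1) z i,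
      Visits.congr (y := Function.update (extend y) (n + 1) z) (t := 0)
        (fun i hi => (extend_apply _ hi).symm) (fun i hi => rfl) (visits_succ.2 ⟨hy.congr
          (fun i hi => (Function.update_of_ne (by omega) _ _).symm) fun i _ => rfl, ?_, h3⟩)⟩
    rw [h4, Function.update_self]

/-- A process that is associated with the energy form of a network is a pure jump process. -/
theorem isPureJump [Nonempty S]
    (hM : M.IsAssociatedWith N.measure ⊤ fun f g => N.energy f g) :
    M.IsPureJump (fun _ => N.speed) N.jump where
  speed_pos _ := N.speed_pos
  measurable_speed := measurable_const
  measurable_roadMap := measurable_of_countable _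
  probability_roadMap := N.isProbabilityMeasure_jump
  roadMap_self := jump_self
  jumps := by
    refine ⟨fun n ω => chain (M.trajectory ω) n, fun n ω => holding (M.trajectory ω) n,
      measurable_chain, measurable_holding, fun x => ?_⟩
    have hlaw : ∀ (n : ℕ) (A : Set Ω), MeasurableSet[jumpHistory
        (fun n ω => chain (M.trajectory ω) n) (fun n ω => holding (M.trajectory ω) n) n] A →
        ∀ (t : ℝ≥0) (B : Set S),
          M.P x (A ∩ {ω | t < holding (M.trajectory ω) n ∧ chain (M.trajectory ω) (n + 1) ∈ B}) =
            ∫⁻ ω in A, ENNReal.ofReal (Real.exp (-(N.speed * t))) *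
              N.jump (chain (M.trajectory ω) n) B ∂(M.P x) := by
      refine fun n A hA t B => measure_inter_eq (μ := M.P x) (Q := N.jump)
        (Y := fun n ω => chain (M.trajectory ω) n) (τ := fun n ω => holding (M.trajectory ω) n)
        measurable_chain measurable_holding (fun n ω => holding_pos _ n) ?_ n hA t B
      intro y t n s B
      have h1 : history (fun n ω => chain (M.trajectory ω) n)
          (fun n ω => holding (M.trajectory ω) n) y t n =ᵐ[M.P x]
          {ω | Visits (M.trajectory ω) y t n} := by
        filter_upwards [ae_jumps hM x] with ω hω
        exact propext (visits_iff hω).symm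
      have h2 : {ω | s < holding (M.trajectory ω) n ∧ chain (M.trajectory ω) (n + 1) ∈ B} =ᵐ[M.P x]
          {ω | jumpTime (M.trajectory ω) n + s < jumpTime (M.trajectory ω) (n + 1) ∧
            ∃ z ∈ B, M.trajectory ω (jumpTime (M.trajectory ω) (n + 1)) = OnePoint.some z} := by
        filter_upwards [ae_jumps hM x] with ω hω
        refine propext (and_congr (lt_holding_iff hω) ?_)
        simp [← coe_chain hω]
      rw [measure_congr (h1.inter h2), measure_congr h1, measure_visits_inter hM]
    refine ⟨?_, fun n A hA t B _ => hlaw n A hA t B⟩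
    filter_upwards [ae_jumps hM x, M.start x,
      ae_exists_lt_sum measurable_holding N.isProbabilityMeasure_jump hlaw] with ω hω h0 hinf
    have hsum := sum_holding hω
    refine ⟨?_, fun t => ⟨fun n h1 h2 => ?_, fun h => ?_⟩⟩
    · exact OnePoint.coe_injective ((coe_chain hω 0).trans h0)
    · rw [hsum] at h1 h2
      exact (apply_eq_of_lt_jumpTime h1 h2).trans (coe_chain hω n).symm
    · obtain ⟨n, hn⟩ := hinf t
      exact absurd (h n) (not_le.2 hn)

end MarkovProcess

/-! ### The lattice in the plane with a half-line attached -/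

namespace VDSpace

variable {ε : ℝ} {k : ℕ} {E₀ : Set (VDSpace ε)}

instance : BorelSpace (VDSpace ε) := ⟨rfl⟩

lemma mesh_pos (k : ℕ) : 0 < mesh k := by unfold mesh; positivity

lemma dist_star (x : VDSpace ε) : dist star x = radius x := by
  change rho star x = radius x
  rcases x with ⟨z, hz⟩ | _ | ⟨s, hs⟩ <;> simp [rho, radius]

/-- The lattice point with the coordinates `p.1 * 2^{-k}` and `p.2 * 2^{-k}`. -/
noncomputable def latticePoint (k : ℕ) (p : ℤ × ℤ) : Plane := !₂[p.1 * mesh k, p.2 * mesh k]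

lemma exists_latticePoint {z : Plane} (hz : z ∈ squareLattice k) : ∃ p, latticePoint k p = z := by
  choose n hn using hz
  refine ⟨(n 0, n 1), ?_⟩
  ext i
  fin_cases i <;> simp [latticePoint, hn]

lemma countable_isVertex : {x : VDSpace ε | IsVertex k x}.Countable := by
  refine ((countable_range fun p => ofPlane ε (latticePoint k p)).union
    (countable_range fun n : ℕ => ofPole ε (n * mesh k))).mono ?_
  rintro (⟨z, hz⟩ | _ | ⟨s, hs⟩) h
  · obtain ⟨p, rfl⟩ := exists_latticePoint h
    exact Or.inl ⟨p, by simp [ofPlane, hz]⟩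
  · exact Or.inr ⟨0, by simp [ofPole]⟩
  · obtain ⟨n, rfl⟩ := h
    exact Or.inr ⟨n, by simp only [ofPole, dif_pos hs]⟩

instance : Countable (Vertex ε k E₀) := (countable_isVertex.mono fun _ hx => hx.2).to_subtype

lemma finite_isVertex (R : ℝ) : {x : VDSpace ε | IsVertex k x ∧ radius x ≤ R}.Finite := by
  have hm := mesh_pos k
  set L : ℤ := ⌈(R + ε) / mesh k⌉
  refine ((((finite_Icc (-L) L).prod (finite_Icc (-L) L)).image fun p =>
    ofPlane ε (latticePoint k p)).union (((finite_Iic ⌈R / mesh k⌉₊).image fun n : ℕ =>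
      ofPole ε (n * mesh k)))).subset ?_
  rintro (⟨z, hz⟩ | _ | ⟨s, hs⟩) ⟨h, hR⟩
  · obtain ⟨p, rfl⟩ := exists_latticePoint h
    refine Or.inl ⟨p, ?_, by simp [ofPlane, hz]⟩
    have hR' : ‖latticePoint k p‖ ≤ R + ε := by simp only [radius] at hR; linarith
    have key : ∀ n : ℤ, |(n : ℝ) * mesh k| ≤ R + ε → n ∈ Icc (-L) L := by
      intro n hn
      rw [abs_mul, abs_of_pos hm, ← le_div_iff₀ hm] at hn
      have h1 : ((|n| : ℤ) : ℝ) ≤ L := by push_cast; exact hn.trans (Int.le_ceil _)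
      exact abs_le.1 (by exact_mod_cast h1)
    have h0 := (PiLp.norm_apply_le (latticePoint k p) 0).trans hR'
    have h1 := (PiLp.norm_apply_le (latticePoint k p) 1).trans hR'
    exact ⟨key _ (by simpa [latticePoint] using h0), key _ (by simpa [latticePoint] using h1)⟩
  · exact Or.inr ⟨0, by simp, by simp [ofPole]⟩
  · obtain ⟨n, rfl⟩ := h
    refine Or.inr ⟨n, ?_, by simp only [ofPole, dif_pos hs]⟩
    have : (n : ℝ) ≤ ⌈R / mesh k⌉₊ := ((le_div_iff₀ hm).2 hR).trans (Nat.le_ceil _)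
    exact_mod_cast this

lemma finite_vertex (R : ℝ) : {x : Vertex ε k E₀ | radius x.1 ≤ R}.Finite :=
  ((finite_isVertex R).preimage Subtype.val_injective.injOn).subset fun x hx => ⟨x.2.2, hx⟩

/-- Balls contain finitely many vertices only, as the distance to `a*` is bounded on them. -/
instance : DiscreteTopology (Vertex ε k E₀) := by
  refine discreteTopology_iff_isOpen_singleton.2 fun x => ?_
  have hfin : (Metric.ball x 1).Finite := by
    refine (finite_vertex (radius x.1 + 1)).subset fun y hy => ?_
    have h1 := dist_triangle star x.1 y.1
    have h2 : dist x.1 y.1 < 1 := Metric.mem_ball'.1 hy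
    simp only [dist_star] at h1
    exact h1.trans (by linarith)
  have h : ({x} : Set (Vertex ε k E₀)) = Metric.ball x 1 \ (Metric.ball x 1 \ {x}) := by
    rw [sdiff_sdiff_right_self]
    exact (inter_eq_right.2 (singleton_subset_iff.2 (Metric.mem_ball_self one_pos))).symm
  rw [h]
  exact Metric.isOpen_ball.sdiff hfin.sdiff.isClosed

lemma Joined.radius_le {x y : VDSpace ε} (h : Joined k E₀ x y) :
    radius y ≤ radius x + mesh k := by
  rcases x with ⟨z, hz⟩ | _ | ⟨s, hs⟩ <;> rcases y with ⟨w, hw⟩ | _ | ⟨t, ht⟩ <;>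
    simp only [Joined] at h <;> simp only [radius]
  · have := norm_sub_norm_le w z
    rw [norm_sub_rev, h.1] at this
    linarith
  · linarith [mesh_pos k]
  · obtain ⟨z, -, h1, h2, -⟩ := h
    have := norm_sub_norm_le w z
    linarith
  · linarith [h.1]
  · linarith [mesh_pos k]
  · have := (abs_le.1 h.1.le).1
    linarith

lemma finite_neighborSet (x : Vertex ε k E₀) : ((latticeGraph ε k E₀).neighborSet x).Finite :=
  (finite_vertex (radius x.1 + mesh k)).subset fun _ h => Joined.radius_le h

end VDSpace

/-! ### The lattice walk as a network -/

namespace VDSpace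

variable {ε : ℝ} {k : ℕ} {E₀ : Set (VDSpace ε)}

/-- Every vertex has a neighbour, and the first edge of the half-line is contained in `E₀`. -/
structure NonDegenerate (ε : ℝ) (k : ℕ) (E₀ : Set (VDSpace ε)) : Prop where
  exists_adj : ∀ x : Vertex ε k E₀, ∃ y, (latticeGraph ε k E₀).Adj x y
  pole_subset : ofPole ε '' segment ℝ 0 (mesh k) ⊆ E₀

lemma valency_pos (h : NonDegenerate ε k E₀) (x : Vertex ε k E₀) : 0 < valency x :=
  (ncard_pos (finite_neighborSet x)).2 (h.exists_adj x)

lemma vertexMass_pos (h : NonDegenerate ε k E₀) (x : Vertex ε k E₀) : 0 < vertexMass x := by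
  have hm := mesh_pos k
  have hv : (1 : ℝ) ≤ valency x := by exact_mod_cast valency_pos h x
  rcases x with ⟨⟨z, hz⟩ | _ | ⟨s, hs⟩, hx⟩ <;> simp only [vertexMass]
  · positivity
  · have : 0 ≤ mesh k ^ 2 / 4 * ((valency (⟨star, hx⟩ : Vertex ε k E₀) : ℝ) - 1) :=
      mul_nonneg (by positivity) (by linarith)
    positivity
  · positivity

open Classical in
/-- The conductance of an edge: `1/4` in the plane and `2^k/2` on the half-line. -/
noncomputable def conductance (x y : Vertex ε k E₀) : ℝ :=
  if (latticeGraph ε k E₀).Adj x y then (if InPlane x.1 ∧ InPlane y.1 then 1 / 4 else 2 ^ k / 2)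
  else 0

lemma conductance_symm (x y : Vertex ε k E₀) : conductance x y = conductance y x := by
  unfold conductance
  by_cases ha : (latticeGraph ε k E₀).Adj x y
  · rw [if_pos ha, if_pos ha.symm]
    by_cases hp : InPlane x.1 ∧ InPlane y.1
    · rw [if_pos hp, if_pos hp.symm]
    · rw [if_neg hp, if_neg fun h => hp h.symm]
  · rw [if_neg ha, if_neg fun h => ha h.symm]

lemma conductance_nonneg (x y : Vertex ε k E₀) : 0 ≤ conductance x y := by
  unfold conductance; split_ifs <;> positivity

lemma hasSum_conductance_of_forall (x : Vertex ε k E₀) {c : ℝ}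
    (hc : ∀ y, (latticeGraph ε k E₀).Adj x y → conductance x y = c) :
    HasSum (conductance x) (valency x * c) := by
  have hfin := finite_neighborSet x
  have h : ∑ y ∈ hfin.toFinset, conductance x y = valency x * c := by
    rw [Finset.sum_congr rfl fun y hy => hc y (hfin.mem_toFinset.1 hy), Finset.sum_const,
      nsmul_eq_mul, valency, ncard_eq_toFinset_card _ hfin]
  rw [← h]
  refine hasSum_sum_of_ne_finset_zero fun y hy => ?_
  have : ¬ (latticeGraph ε k E₀).Adj x y := fun h => hy (hfin.mem_toFinset.2 h)
  simp [conductance, this]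

lemma mesh_mul (k : ℕ) : 2 ^ k * mesh k = 1 := by
  unfold mesh; exact mul_inv_cancel₀ (by positivity)

/-- The first vertex of the half-line. -/
noncomputable def firstPole (h : NonDegenerate ε k E₀) : Vertex ε k E₀ :=
  ⟨pole (mesh k) (mesh_pos k),
    h.pole_subset ⟨mesh k, right_mem_segment ℝ 0 _, by simp [ofPole, mesh_pos]⟩, 1, by simp⟩

lemma adj_firstPole (h : NonDegenerate ε k E₀) (hx : star ∈ E₀ ∧ IsVertex k star) :
    (latticeGraph ε k E₀).Adj ⟨star, hx⟩ (firstPole h) := ⟨rfl, h.pole_subset⟩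

lemma eq_firstPole (h : NonDegenerate ε k E₀) {hx : star ∈ E₀ ∧ IsVertex k star}
    {y : Vertex ε k E₀} (ha : (latticeGraph ε k E₀).Adj ⟨star, hx⟩ y) (hy : ¬ InPlane y.1) :
    y = firstPole h := by
  rcases y with ⟨⟨w, hw⟩ | _ | ⟨t, ht⟩, hy'⟩
  · exact absurd trivial hy
  · exact absurd trivial hy
  · obtain ⟨rfl, -⟩ := ha
    rfl

/-- The total conductance is `4^k` times the mass. At `a*` it is the sum of `2^k / 2` for the single
edge of the half-line and of `1/4` for each of the other edges. -/
lemma hasSum_conductance (h : NonDegenerate ε k E₀) (x : Vertex ε k E₀) :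
    HasSum (conductance x) (2 ^ (2 * k) * vertexMass x) := by
  classical
  have hm := mesh_mul k
  have hm2 : (2 : ℝ) ^ (2 * k) * mesh k ^ 2 = 1 := by
    rw [mul_comm 2 k, pow_mul, ← mul_pow, hm, one_pow]
  have hm3 : (2 : ℝ) ^ (2 * k) * mesh k = 2 ^ k := by
    rw [two_mul, pow_add, mul_assoc, hm, mul_one]
  rcases x with ⟨⟨z, hz⟩ | _ | ⟨s, hs⟩, hx⟩
  · convert hasSum_conductance_of_forall (⟨plane z hz, hx⟩ : Vertex ε k E₀) (c := 1 / 4) ?_ using 1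
    · simp only [vertexMass]; linear_combination (valency _ : ℝ) / 4 * hm2
    · rintro ⟨⟨w, hw⟩ | _ | ⟨t, ht⟩, hy⟩ ha
      · rw [conductance, if_pos ha, if_pos ⟨trivial, trivial⟩]
      · rw [conductance, if_pos ha, if_pos ⟨trivial, trivial⟩]
      · exact ha.elim
  · set x : Vertex ε k E₀ := ⟨star, hx⟩
    have hfin := finite_neighborSet x
    have hmem : firstPole h ∈ hfin.toFinset := hfin.mem_toFinset.2 (adj_firstPole h hx)
    have hc : conductance x (firstPole h) = 2 ^ k / 2 := by
      rw [conductance, if_pos (adj_firstPole h hx), if_neg fun hp => hp.2]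
    have h1 : ∀ y ∈ hfin.toFinset.erase (firstPole h), conductance x y = 1 / 4 := by
      intro y hy
      obtain ⟨hy, ha⟩ := Finset.mem_erase.1 hy
      have ha' : (latticeGraph ε k E₀).Adj x y := hfin.mem_toFinset.1 ha
      rw [conductance, if_pos ha', if_pos ⟨trivial, by_contra fun hp => hy (eq_firstPole h ha' hp)⟩]
    have h2 : ∑ y ∈ hfin.toFinset, conductance x y = 2 ^ (2 * k) * vertexMass x := by
      rw [← Finset.add_sum_erase _ _ hmem, hc, Finset.sum_congr rfl h1, Finset.sum_const,
        nsmul_eq_mul, Finset.card_erase_of_mem hmem, ← ncard_eq_toFinset_card _ hfin]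
      change _ + ((valency x - 1 : ℕ) : ℝ) * _ = _ * (mesh k / 2 + mesh k ^ 2 / 4 *
        ((valency x : ℝ) - 1))
      rw [Nat.cast_sub (show 1 ≤ _ from valency_pos h x), Nat.cast_one]
      linear_combination - hm3 / 2 - ((valency x : ℝ) - 1) / 4 * hm2
    rw [← h2]
    refine hasSum_sum_of_ne_finset_zero fun y hy => ?_
    have : ¬ (latticeGraph ε k E₀).Adj x y := fun h => hy (hfin.mem_toFinset.2 h)
    simp [conductance, this]
  · convert hasSum_conductance_of_forall (⟨pole s hs, hx⟩ : Vertex ε k E₀) (c := 2 ^ k / 2) ?_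
      using 1
    · simp only [vertexMass]; linear_combination (valency _ : ℝ) / 2 * hm3
    · intro y ha
      rw [conductance, if_pos ha, if_neg fun hp => hp.1]

/-- The network of the lattice walk. -/
noncomputable def network (h : NonDegenerate ε k E₀) : Network (Vertex ε k E₀) where
  mass := vertexMass
  cond := conductance
  speed := 2 ^ (2 * k)
  mass_pos := vertexMass_pos h
  speed_pos := by positivity
  cond_nonneg := conductance_nonneg
  cond_symm := conductance_symm
  cond_self x := by simp [conductance]
  hasSum_cond := hasSum_conductance h

/-- Each oriented edge lies in the plane or on the half-line, but not in both. -/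
lemma conductance_eq (x y : Vertex ε k E₀) (d : ℝ) : conductance x y * d =
    indicator {p : Vertex ε k E₀ × Vertex ε k E₀ |
      (latticeGraph ε k E₀).Adj p.1 p.2 ∧ InPlane p.1.1 ∧ InPlane p.2.1}
        (fun _ => 1 / 4 * d) (x, y) +
    indicator {p : Vertex ε k E₀ × Vertex ε k E₀ |
      (latticeGraph ε k E₀).Adj p.1 p.2 ∧ InPole p.1.1 ∧ InPole p.2.1}
        (fun _ => 2 ^ k / 2 * d) (x, y) := by
  classical
  simp only [conductance, indicator_apply, mem_ofPred_eq]
  by_cases ha : (latticeGraph ε k E₀).Adj x y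
  · rcases x with ⟨⟨z, hz⟩ | _ | ⟨s, hs⟩, hx⟩ <;> rcases y with ⟨⟨w, hw⟩ | _ | ⟨t, ht⟩, hy⟩ <;>
      simp [InPlane, InPole, ha] <;> exact ha.elim
  · simp [ha]

lemma summable_edges (h : NonDegenerate ε k E₀) {f g : Vertex ε k E₀ → ℝ}
    (hf : (network h).SqSummable f) (hg : (network h).SqSummable g) :
    (Summable fun p : PlaneEdge ε k E₀ => (f p.1.1 - f p.1.2) * (g p.1.1 - g p.1.2)) ∧
    Summable fun p : PoleEdge ε k E₀ => (f p.1.1 - f p.1.2) * (g p.1.1 - g p.1.2) := by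
  have hs := Network.summable_energy hf hg
  constructor
  · refine ((hs.comp_injective (i := fun p : PlaneEdge ε k E₀ => p.1)
      Subtype.val_injective).mul_left 4).congr fun p => ?_
    have : (network h).cond p.1.1 p.1.2 = 1 / 4 := by
      change conductance _ _ = _
      rw [conductance, if_pos p.2.1, if_pos p.2.2]
    simp only [Function.comp_apply, this]
    ring
  · refine ((hs.comp_injective (i := fun p : PoleEdge ε k E₀ => p.1)
      Subtype.val_injective).mul_left (2 / 2 ^ k)).congr fun p => ?_
    have : (network h).cond p.1.1 p.1.2 = 2 ^ k / 2 := by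
      change conductance _ _ = _
      rw [conductance, if_pos p.2.1, if_neg]
      rcases p with ⟨⟨⟨⟨z, hz⟩ | _ | ⟨s, hs⟩, hx⟩, ⟨⟨w, hw⟩ | _ | ⟨t, ht⟩, hy⟩⟩, ha, hp, hp'⟩ <;>
        simp [InPlane, InPole] at hp hp' ⊢
      exact ha
    simp only [Function.comp_apply, this]
    field_simp

lemma tsum_edges_eq_energy (h : NonDegenerate ε k E₀) {f g : Vertex ε k E₀ → ℝ}
    (hf : (network h).SqSummable f) (hg : (network h).SqSummable g) :
    1 / 8 * ∑' p : PlaneEdge ε k E₀, (f p.1.1 - f p.1.2) * (g p.1.1 - g p.1.2) +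
      2 ^ k / 4 * ∑' p : PoleEdge ε k E₀, (f p.1.1 - f p.1.2) * (g p.1.1 - g p.1.2) =
    (network h).energy f g := by
  set d : Vertex ε k E₀ × Vertex ε k E₀ → ℝ := fun p => (f p.1 - f p.2) * (g p.1 - g p.2)
  set A := {p : Vertex ε k E₀ × Vertex ε k E₀ |
    (latticeGraph ε k E₀).Adj p.1 p.2 ∧ InPlane p.1.1 ∧ InPlane p.2.1}
  set B := {p : Vertex ε k E₀ × Vertex ε k E₀ |
    (latticeGraph ε k E₀).Adj p.1 p.2 ∧ InPole p.1.1 ∧ InPole p.2.1}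
  obtain ⟨h1, h2⟩ := summable_edges h hf hg
  have h3 : HasSum (indicator A fun p => 1 / 4 * d p)
      (1 / 4 * ∑' p : PlaneEdge ε k E₀, d p.1) :=
    hasSum_subtype_iff_indicator.1 (h1.hasSum.mul_left (1 / 4))
  have h4 : HasSum (indicator B fun p => 2 ^ k / 2 * d p)
      (2 ^ k / 2 * ∑' p : PoleEdge ε k E₀, d p.1) :=
    hasSum_subtype_iff_indicator.1 (h2.hasSum.mul_left (2 ^ k / 2))
  have h5 : (fun p : Vertex ε k E₀ × Vertex ε k E₀ => conductance p.1 p.2 * d p) =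
      fun p => indicator A (fun p => 1 / 4 * d p) p + indicator B (fun p => 2 ^ k / 2 * d p) p := by
    funext p
    rw [conductance_eq]
    rfl
  change _ = 1 / 2 * ∑' p : Vertex ε k E₀ × Vertex ε k E₀, conductance p.1 p.2 * d p
  rw [h5, (h3.add h4).tsum_eq]
  ring

lemma form_eq_energy (h : NonDegenerate ε k E₀) :
    form ε k E₀ = fun f g : Lp ℝ 2 (network h).measure => (network h).energy f g :=
  funext fun f => funext fun g => tsum_edges_eq_energy h
    (Network.sqSummable_coe (N := network h) f) (Network.sqSummable_coe (N := network h) g)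

lemma network_jump (h : NonDegenerate ε k E₀) : (network h).jump = roadMap ε k E₀ := by
  classical
  funext x
  refine Measure.ext_of_singleton fun y => ?_
  have hR : roadMap ε k E₀ x {y} =
      if (latticeGraph ε k E₀).Adj x y then ENNReal.ofReal (jumpProb x y) else 0 := by
    rw [roadMap, Measure.sum_apply _ (measurableSet_singleton y)]
    split_ifs with ha
    · rw [tsum_eq_single ⟨y, ha⟩]
      · simp
      · intro z hz
        have : z.1 ≠ y := fun e => hz (Subtype.ext e)
        simp [this]
    · refine ENNReal.tsum_eq_zero.2 fun z => ?_
      have : z.1 ≠ y := fun e => ha (e ▸ z.2)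
      simp [this]
  rw [hR, Network.jump_singleton]
  change ENNReal.ofReal (conductance x y / (2 ^ (2 * k) * vertexMass x)) = _
  by_cases ha : (latticeGraph ε k E₀).Adj x y
  · rw [if_pos ha]
    congr 1
    have hv : (1 : ℝ) ≤ valency x := by exact_mod_cast valency_pos h x
    have hm : mesh k = ((2 : ℝ) ^ k)⁻¹ := rfl
    have hk : (0 : ℝ) < 2 ^ k := by positivity
    have hk2 : (2 : ℝ) ^ (2 * k) = (2 ^ k) ^ 2 := by rw [mul_comm, pow_mul]
    have hden : 0 < (valency x : ℝ) + 2 ^ (k + 1) - 1 := by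
      rw [pow_succ]; linarith
    rw [conductance, if_pos ha, hk2]
    rcases x with ⟨⟨z, hz⟩ | _ | ⟨s, hs⟩, hx⟩ <;> rcases y with ⟨⟨w, hw⟩ | _ | ⟨t, ht⟩, hy⟩ <;>
      simp only [InPlane, and_true, and_false, if_true, if_false, vertexMass, jumpProb, hm] <;>
      first
        | exact ha.elim
        | (rw [div_eq_div_iff (by positivity) (by positivity)]; field_simp; done)
        | (rw [div_eq_div_iff ?_ hden.ne', pow_succ]
           · field_simp; ring_nf
           · refine ne_of_gt (mul_pos (by positivity) (add_pos_of_pos_of_nonneg (by positivity)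
               (mul_nonneg (by positivity) (by linarith)))))
  · simp [conductance, ha]

end VDSpace

/-! ### Vertex sets without isolated vertices -/

namespace VDSpace

variable {ε : ℝ} {k : ℕ} {E₀ : Set (VDSpace ε)}

lemma latticePoint_mem (k : ℕ) (p : ℤ × ℤ) : latticePoint k p ∈ squareLattice k := by
  intro i
  fin_cases i
  exacts [⟨p.1, rfl⟩, ⟨p.2, rfl⟩]

lemma norm_sq_latticePoint_add (p : ℤ × ℤ) (r : ℝ) :
    ‖latticePoint k p + r • latticePoint k (1, 0)‖ ^ 2 =
      (p.1 * mesh k + r * mesh k) ^ 2 + (p.2 * mesh k) ^ 2 := by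
  rw [EuclideanSpace.real_norm_sq_eq, Fin.sum_univ_two]
  simp [latticePoint]

/-- In the whole space a planar vertex has a neighbour that is farther from the disc. -/
lemma exists_joined_plane (z : Plane) (hz : ε < ‖z‖) (h : z ∈ squareLattice k) :
    ∃ y : VDSpace ε, IsVertex k y ∧ Joined k univ (plane z hz) y := by
  obtain ⟨p, rfl⟩ := exists_latticePoint h
  have hm := mesh_pos k
  -- the direction in which the absolute value of the first coordinate does not decrease
  obtain ⟨σ, hσ, hp⟩ : ∃ σ : ℤ, (σ = 1 ∨ σ = -1) ∧ 0 ≤ σ * p.1 := by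
    rcases le_total 0 p.1 with h | h
    · exact ⟨1, Or.inl rfl, by simpa using h⟩
    · exact ⟨-1, Or.inr rfl, by simpa using h⟩
  have hp' : (0 : ℝ) ≤ σ * p.1 := by exact_mod_cast hp
  have hσ' : |(σ : ℝ)| = 1 := by rcases hσ with rfl | rfl <;> simp
  have hseg : ∀ θ : ℝ, 0 ≤ θ →
      ‖latticePoint k p‖ ≤ ‖latticePoint k p + (θ * σ) • latticePoint k (1, 0)‖ := by
    intro θ hθ
    refine le_of_sq_le_sq ?_ (norm_nonneg _)
    have h0 := norm_sq_latticePoint_add (k := k) p 0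
    rw [zero_smul, add_zero] at h0
    rw [h0, norm_sq_latticePoint_add]
    have h1 : 0 ≤ mesh k ^ 2 * θ * (σ * p.1) := by positivity
    nlinarith [sq_nonneg (θ * σ * mesh k)]
  have hw : latticePoint k p + (1 * (σ : ℝ)) • latticePoint k (1, 0) =
      latticePoint k (p.1 + σ, p.2) := by
    ext i
    fin_cases i <;> simp [latticePoint]; ring
  have hone := hseg 1 zero_le_one
  rw [hw] at hone
  refine ⟨plane (latticePoint k (p.1 + σ, p.2)) (hz.trans_le hone), latticePoint_mem k _, ?_, ?_,
    subset_univ _⟩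
  · rw [← hw, sub_add_cancel_left, norm_neg, norm_smul, one_mul, Real.norm_eq_abs, hσ', one_mul,
      ← sq_eq_sq₀ (norm_nonneg _) hm.le, EuclideanSpace.real_norm_sq_eq, Fin.sum_univ_two]
    simp [latticePoint]
  · rw [segment_eq_image', disjoint_left]
    rintro _ ⟨θ, hθ, rfl⟩ hmem
    simp only [mem_closedBall_zero_iff, ← hw, add_sub_cancel_left, smul_smul, one_mul] at hmem
    exact absurd (hz.trans_le (hseg θ hθ.1)) (not_lt.2 hmem)

lemma nonDegenerate_univ : NonDegenerate ε k univ where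
  pole_subset := subset_univ _
  exists_adj := by
    have hm := mesh_pos k
    rintro ⟨⟨z, hz⟩ | _ | ⟨s, hs⟩, -, h⟩
    · obtain ⟨y, hy, hj⟩ := exists_joined_plane z hz h
      exact ⟨⟨y, trivial, hy⟩, hj⟩
    · exact ⟨⟨pole (mesh k) hm, trivial, 1, by simp⟩, rfl, subset_univ _⟩
    · obtain ⟨n, rfl⟩ := h
      refine ⟨⟨pole (n * mesh k + mesh k) (by positivity), trivial, n + 1, by push_cast; ring⟩, ?_,
        subset_univ _⟩
      rw [sub_add_cancel_left, abs_neg, abs_of_pos hm]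

lemma continuousOn_ofPole : ContinuousOn (ofPole ε) (Ici 0) := by
  have h : ∀ s ∈ Ici (0 : ℝ), ∀ t ∈ Ici (0 : ℝ), dist (ofPole ε s) (ofPole ε t) = dist s t := by
    intro s hs t ht
    change rho _ _ = |s - t|
    rcases eq_or_lt_of_le (mem_Ici.1 hs) with rfl | hs' <;>
      rcases eq_or_lt_of_le (mem_Ici.1 ht) with rfl | ht'
    · simp [ofPole, rho, radius]
    · simp [ofPole, rho, radius, ht', abs_of_pos ht']
    · simp [ofPole, rho, radius, hs', abs_of_pos hs']
    · simp [ofPole, rho, hs', ht']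
  refine fun s hs => Metric.continuousWithinAt_iff.2 fun δ hδ => ⟨δ, hδ, fun t ht hst => ?_⟩
  rwa [h t ht s hs]

/-- The beginning of the half-line is contained in `E₀` as it does not reach the frontier. -/
lemma pole_subset_of_lt_infDist (ho : IsOpen E₀) (hstar : star ∈ E₀)
    (hd : mesh k < Metric.infDist star (frontier E₀)) :
    ofPole ε '' segment ℝ 0 (mesh k) ⊆ E₀ := by
  have hm := mesh_pos k
  rw [segment_eq_Icc hm.le]
  refine ((isPreconnected_Icc.image _ (continuousOn_ofPole.mono Icc_subset_Ici_self)
    ).subset_left_of_subset_union ho isClosed_closure.isOpen_compl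
    (disjoint_compl_right_iff_subset.2 subset_closure) ?_
    ⟨star, ⟨0, left_mem_Icc.2 hm.le, by simp [ofPole]⟩, hstar⟩)
  rintro _ ⟨s, hs, rfl⟩
  by_contra hn
  simp only [mem_union, mem_compl_iff, not_or, not_not] at hn
  have h1 : ofPole ε s ∈ frontier E₀ := by
    rw [frontier, ho.interior_eq]; exact ⟨hn.2, hn.1⟩
  have h2 := Metric.infDist_le_dist_of_mem (x := (star : VDSpace ε)) h1
  have h3 : radius (ofPole ε s) = s := by
    rcases eq_or_lt_of_le hs.1 with rfl | h
    · simp [ofPole, radius]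
    · simp [ofPole, radius, h]
  rw [dist_star, h3] at h2
  linarith [hs.2]

lemma nonDegenerate_of_connected (hp : ofPole ε '' segment ℝ 0 (mesh k) ⊆ E₀) (hstar : star ∈ E₀)
    (hc : (latticeGraph ε k E₀).Connected) : NonDegenerate ε k E₀ where
  pole_subset := hp
  exists_adj x := by
    have : Nontrivial (Vertex ε k E₀) := by
      refine ⟨⟨star, hstar, trivial⟩, ⟨pole (mesh k) (mesh_pos k),
        hp ⟨mesh k, right_mem_segment ℝ 0 _, by simp [ofPole, mesh_pos]⟩, 1, by simp⟩, ?_⟩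
      simp
    exact hc.preconnected.exists_adj_of_nontrivial x

/-- The properties of the form and of the associated processes, on any vertex set without isolated
vertices that contains the first edge of the half-line. -/
lemma walk_of_nonDegenerate (h : NonDegenerate ε k E₀) :
      (∀ f : Lp ℝ 2 (refMeasure ε k E₀),
        (Summable fun p : PlaneEdge ε k E₀ => (f p.1.1 - f p.1.2) ^ 2) ∧
        (Summable fun p : PoleEdge ε k E₀ => (f p.1.1 - f p.1.2) ^ 2)) ∧
      IsRegularDirichletForm (refMeasure ε k E₀) ⊤ (form ε k E₀) ∧
      (∃ (Ω : Type) (_ : MeasurableSpace Ω) (M : MarkovProcess (Vertex ε k E₀) Ω),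
        M.IsAssociatedWith (refMeasure ε k E₀) ⊤ (form ε k E₀) ∧
          M.IsPureJump (fun _ => 2 ^ (2 * k)) (roadMap ε k E₀)) ∧
      (∀ (Ω : Type*) [MeasurableSpace Ω] (M : MarkovProcess (Vertex ε k E₀) Ω),
        M.IsAssociatedWith (refMeasure ε k E₀) ⊤ (form ε k E₀) →
        M.IsPureJump (fun _ => 2 ^ (2 * k)) (roadMap ε k E₀)) := by
  have hne : Nonempty (Vertex ε k E₀) := ⟨firstPole h⟩
  have key : ∀ (Ω : Type _) [MeasurableSpace Ω] (M : MarkovProcess (Vertex ε k E₀) Ω),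
      M.IsAssociatedWith (refMeasure ε k E₀) ⊤ (form ε k E₀) →
      M.IsPureJump (fun _ => 2 ^ (2 * k)) (roadMap ε k E₀) := fun Ω _ M hM => by
    rw [form_eq_energy h] at hM
    rw [← network_jump h]
    exact MarkovProcess.isPureJump (N := network h) hM
  refine ⟨fun f => ?_, ?_, ?_, key⟩
  · have hf := Network.sqSummable_coe (N := network h) f
    obtain ⟨h1, h2⟩ := summable_edges h hf hf
    exact ⟨h1.congr fun p => (sq _).symm, h2.congr fun p => (sq _).symm⟩
  · rw [form_eq_energy h]
    exact Network.isRegularDirichletForm (N := network h)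
  · refine ⟨_, inferInstance, (network h).walk, ?_, ?_⟩
    · rw [form_eq_energy h]
      exact Network.walk_isAssociatedWith
    · rw [← network_jump h]
      exact MarkovProcess.isPureJump (N := network h) Network.walk_isAssociatedWith

end VDSpace

theorem proposition2p2 (ε : ℝ) (hε : 0 < ε) (k : ℕ) (hk : 1 ≤ k) :
    -- the walk `X^k` on `E^k`
    ((∀ f : Lp ℝ 2 (refMeasure ε k univ),
        (Summable fun p : PlaneEdge ε k univ => (f p.1.1 - f p.1.2) ^ 2) ∧
        (Summable fun p : PoleEdge ε k univ => (f p.1.1 - f p.1.2) ^ 2)) ∧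
      IsRegularDirichletForm (refMeasure ε k univ) ⊤ (form ε k univ) ∧
      (∃ (Ω : Type) (_ : MeasurableSpace Ω) (M : MarkovProcess (Vertex ε k univ) Ω),
        M.IsAssociatedWith (refMeasure ε k univ) ⊤ (form ε k univ) ∧
          M.IsPureJump (fun _ => 2 ^ (2 * k)) (roadMap ε k univ)) ∧
      (∀ (Ω : Type*) [MeasurableSpace Ω] (M : MarkovProcess (Vertex ε k univ) Ω),
        M.IsAssociatedWith (refMeasure ε k univ) ⊤ (form ε k univ) →
        M.IsPureJump (fun _ => 2 ^ (2 * k)) (roadMap ε k univ))) ∧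
    -- the reflected walk on `E₀^k`
    (∀ E₀ : Set (VDSpace ε), IsOpen E₀ → IsConnected E₀ → Bornology.IsBounded E₀ → VDSpace.star ∈ E₀ →
      16 * ε < Metric.infDist VDSpace.star (frontier E₀) → mesh k < ε / 4 →
      (latticeGraph ε k E₀).Connected →
      (∀ f : Lp ℝ 2 (refMeasure ε k E₀),
        (Summable fun p : PlaneEdge ε k E₀ => (f p.1.1 - f p.1.2) ^ 2) ∧
        (Summable fun p : PoleEdge ε k E₀ => (f p.1.1 - f p.1.2) ^ 2)) ∧
      IsRegularDirichletForm (refMeasure ε k E₀) ⊤ (form ε k E₀) ∧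
      (∃ (Ω : Type) (_ : MeasurableSpace Ω) (M : MarkovProcess (Vertex ε k E₀) Ω),
        M.IsAssociatedWith (refMeasure ε k E₀) ⊤ (form ε k E₀) ∧
          M.IsPureJump (fun _ => 2 ^ (2 * k)) (roadMap ε k E₀)) ∧
      (∀ (Ω : Type*) [MeasurableSpace Ω] (M : MarkovProcess (Vertex ε k E₀) Ω),
        M.IsAssociatedWith (refMeasure ε k E₀) ⊤ (form ε k E₀) →
        M.IsPureJump (fun _ => 2 ^ (2 * k)) (roadMap ε k E₀))) := by
  refine ⟨walk_of_nonDegenerate nonDegenerate_univ, fun E₀ ho _ _ hstar hd hm hc =>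
    walk_of_nonDegenerate ?_⟩
  exact nonDegenerate_of_connected (pole_subset_of_lt_infDist ho hstar (by linarith)) hstar hc
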